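/- Let $M_0=\{b_k:k\in\mathbb N\}\subset[0,1]$ with $b_k<b_{k+1}$ and $b_k\to 1$ (so $1$ is the only accumulation point of $M_0$). Let $\mathbf A=(\mathbf A_{b_i,b_j})$ be a $\{0,1\}$-matrix indexed by $M_0\times M_0$ that is irreducible (for all $i,j$ there is $k\ge1$ with $(\mathbf A^k)_{b_i,b_j}>0$) and for which there is $j_0$ such that $\mathbf A_{b_i,b_j}=\mathbf A_{b_i,b_{j_0}}$ for all $j\ge j_0$ and all $i$. Let $\Sigma_{\mathbf A}$ be the set of sequences $x=(x_n)_{n\ge1}$ in $M_0$ with $\mathbf A_{x_n,x_{n+1}}=1$ for all $n$, with the metric $d(x,y)=\sum_{n\ge1}2^{-n}|x_n-y_n|$ and the shift map $\sigma$. For $\alpha>0$ let $\mathcal H_\alpha(\Sigma_{\mathbf A})$ be the space of real $\alpha$-Hölder functions on $\Sigma_{\mathbf A}$ with the norm $\|\psi\|_\alpha=\|\psi\|_\infty+\mathrm{Hol}_\psi$, where $\mathrm{Hol}_\psi=\sup_{x\ne y}|\psi(x)-\psi(y)|/d(x,y)^\alpha$. Spectra and eigenvalues of operators on $\mathcal H_\alpha(\Sigma_{\mathbf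 A})$ are those of their complexifications, that is, of the same operators on the complex-valued $\alpha$-Hölder functions. Let $\phi=\varphi+\log(p\circ\pi_1)$, where $\varphi\in\mathcal H_\alpha(\Sigma_{\mathbf A})$, $\pi_1(x)=x_1$, and $p:M_0\to[0,1]$ satisfies $p(b_k)>0$ for every $k$ and $\sum_k p(b_k)=1$. For every $\psi\in\mathcal H_\alpha(\Sigma_{\mathbf A})$ and every $x$ the series $$L_\phi(\psi)(x)=\sum_{a\in M_0,\ \mathbf A_{a,x_1}=1}e^{\phi(ax)}\psi(ax)$$ converges, and it defines a bounded linear operator $L_\phi$ on $\mathcal H_\alpha(\Sigma_{\mathbf A})$. For Borel probability measures $\mu$ and constants $\lambda>0$, the equation $L_\phi^*(\mu)=\lambda\mu$ means $\int L_\phi(\psi)\,d\mu=\lambda\int\psi\,d\mu$ for all $\psi\in\mathcal H_\alpha(\Sigma_{\mathbf A})$, and similarly for other potentials. Moreover: 1. There are $\lambda_\phi>0$ and a strictly positive $f_\phi\in\mathcal H_\alpha(\Sigma_{\mathbf A})$ (with $\inf f_\phi>0$) such that $L_\phi(f_\phi)=\lambda_\phi f_\phi$. The eigenvalue $\lambda_\phi$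 is simple (its generalized eigenspace is one-dimensional) and maximal (every $z$ in the spectrum of $L_\phi$ satisfies $|z|\le\lambda_\phi$). 2. There is a Borel probability measure $\rho_\phi$ on $\Sigma_{\mathbf A}$ with $L_\phi^*(\rho_\phi)=\lambda_\phi\rho_\phi$. 3. Let $\overline\phi=\phi+\log f_\phi-\log(f_\phi\circ\sigma)-\log\lambda_\phi$. The operator $L_{\overline\phi}$ is well defined in the same sense, and there is a unique Borel probability measure $\mu_\phi$ on $\Sigma_{\mathbf A}$ with $L_{\overline\phi}^*(\mu_\phi)=\mu_\phi$. It is $\sigma$-invariant, and $d\mu_\phi=f_\phi\,d\rho_\phi$ for suitable $f_\phi$ and $\rho_\phi$ as in 1 and 2. 4. If $\mathbf A$ is aperiodic (there is $k\ge1$ such that all entries of $\mathbf A^k$ are positive), then for every $\psi\in\mathcal H_\alpha(\Sigma_{\mathbf A})$ one has $L_{\overline\phi}^n(\psi)\to\int\psi\,d\mu_\phi$ uniformly on $\Sigma_{\mathbf A}$ as $n\to\infty$. Furthermore, $\lambda_\phi$ is isolated: there is $r<\lambda_\phi$ such that every $z\ne\lambda_\phi$ in the spectrum of $L_\phi$ satisfies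 $|z|\le r$. -/

import Mathlib

open scoped NNReal ENNReal BoundedContinuousFunction

noncomputable section

namespace RPF

/-! Hölder spaces -/

section Holder

variable (α : ℝ≥0) (Y : Type*) [MetricSpace Y] (𝕜 : Type*) [RCLike 𝕜]

/-- The bounded continuous functions `f : Y → 𝕜` that are `α`-Hölder, i.e. such that
`|f x - f y| ≤ C * d(x, y) ^ α` for some finite constant `C`. -/
def holderSubmodule : Submodule 𝕜 (Y →ᵇ 𝕜) where
  carrier := {f | MemHolder α f}
  add_mem' := fun hf hg => MemHolder.add hf hg
  zero_mem' := memHolder_zero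
  smul_mem' := fun c _ hf => MemHolder.smul (c := c) hf

/-- The space of `α`-Hölder functions on `Y` with values in `𝕜`, with the norm
`‖f‖ = ‖f‖_∞ + Hol f` (see the instances below). -/
def HolderSpace : Type _ := holderSubmodule α Y 𝕜

instance : AddCommGroup (HolderSpace α Y 𝕜) :=
  inferInstanceAs (AddCommGroup (holderSubmodule α Y 𝕜))

instance : Module 𝕜 (HolderSpace α Y 𝕜) :=
  inferInstanceAs (Module 𝕜 (holderSubmodule α Y 𝕜))

variable {α Y 𝕜}

/-- The underlying bounded continuous function. -/
def HolderSpace.toBCF (f : HolderSpace α Y 𝕜) : Y →ᵇ 𝕜 := f.1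

instance : CoeFun (HolderSpace α Y 𝕜) (fun _ => Y → 𝕜) := ⟨fun f => f.toBCF⟩

/-- `‖f‖_α = ‖f‖_∞ + Hol f`, where `nnHolderNorm α f` is the best Hölder constant of `f`. -/
instance : Norm (HolderSpace α Y 𝕜) := ⟨fun f => ‖f.toBCF‖ + nnHolderNorm α f.toBCF⟩

theorem HolderSpace.memHolder (f : HolderSpace α Y 𝕜) : MemHolder α (f.toBCF : Y → 𝕜) := f.2

theorem HolderSpace.norm_def (f : HolderSpace α Y 𝕜) :
    ‖f‖ = ‖f.toBCF‖ + (nnHolderNorm α (f.toBCF : Y → 𝕜) : ℝ) := rfl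

theorem HolderSpace.toBCF_add (f g : HolderSpace α Y 𝕜) :
    (f + g).toBCF = f.toBCF + g.toBCF := rfl

theorem HolderSpace.toBCF_smul (c : 𝕜) (f : HolderSpace α Y 𝕜) :
    (c • f).toBCF = c • f.toBCF := rfl

theorem HolderSpace.normCore : NormedSpace.Core 𝕜 (HolderSpace α Y 𝕜) where
  norm_nonneg f := add_nonneg (norm_nonneg f.toBCF) (nnHolderNorm α f.toBCF).2
  norm_smul c f := by
    rw [HolderSpace.norm_def, HolderSpace.norm_def, HolderSpace.toBCF_smul,
      BoundedContinuousFunction.coe_smul, norm_smul]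
    have h : nnHolderNorm α (c • (f.toBCF : Y → 𝕜)) = ‖c‖₊ * nnHolderNorm α f.toBCF :=
      MemHolder.nnHolderNorm_smul f.memHolder c
    have h' : (fun x => c • f.toBCF x) = c • (f.toBCF : Y → 𝕜) := rfl
    rw [h', h, NNReal.coe_mul, coe_nnnorm]
    ring
  norm_triangle f g := by
    rw [HolderSpace.norm_def, HolderSpace.norm_def, HolderSpace.norm_def, HolderSpace.toBCF_add,
      BoundedContinuousFunction.coe_add]
    have h1 := norm_add_le f.toBCF g.toBCF
    have h2 : (nnHolderNorm α ((f.toBCF : Y → 𝕜) + (g.toBCF : Y → 𝕜)) : ℝ)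
        ≤ (nnHolderNorm α f.toBCF : ℝ) + (nnHolderNorm α g.toBCF : ℝ) := by
      exact_mod_cast MemHolder.nnHolderNorm_add_le f.memHolder g.memHolder
    linarith
  norm_eq_zero_iff f := by
    constructor
    · intro h
      have h' : ‖f.toBCF‖ + (nnHolderNorm α f.toBCF : ℝ) = 0 := h
      have h1 : ‖f.toBCF‖ = 0 := by
        have := norm_nonneg f.toBCF
        have := (nnHolderNorm α f.toBCF).2
        linarith
      exact Subtype.ext (norm_eq_zero.1 h1)
    · rintro rfl
      change ‖(0 : Y →ᵇ 𝕜)‖ + (nnHolderNorm α (0 : Y → 𝕜) : ℝ) = 0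
      rw [norm_zero, nnHolderNorm_zero]
      simp

instance : NormedAddCommGroup (HolderSpace α Y 𝕜) :=
  NormedAddCommGroup.ofCore (HolderSpace.normCore (α := α) (Y := Y) (𝕜 := 𝕜))

instance : NormedSpace 𝕜 (HolderSpace α Y 𝕜) :=
  NormedSpace.ofCore (HolderSpace.normCore (α := α) (Y := Y) (𝕜 := 𝕜))

end Holder

/-! The countable Markov shift -/

/-- A countable alphabet `{b 0 < b 1 < ...}` contained in `[0, 1]` whose only accumulation
point is `1`. -/
structure Alphabet where
  b : ℕ → ℝ
  mem_Icc : ∀ k, b k ∈ Set.Icc (0 : ℝ) 1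
  strictMono : StrictMono b
  tendsto_one : Filter.Tendsto b Filter.atTop (nhds 1)

/-- The `k`-th power of the infinite matrix `A`, with entries in `[0, ∞]`. -/
def matPow (A : Matrix ℕ ℕ ℕ) : ℕ → Matrix ℕ ℕ ℝ≥0∞
  | 0 => fun i j => if i = j then 1 else 0
  | k + 1 => fun i j => ∑' l, (A i l : ℝ≥0∞) * matPow A k l j

/-- For each pair of letters, some positive power of `A` has a positive entry there. -/
def IsIrreducible (A : Matrix ℕ ℕ ℕ) : Prop :=
  ∀ i j, ∃ k, 1 ≤ k ∧ 0 < matPow A k i j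

/-- A single positive power of `A` has all its entries positive. -/
def IsAperiodic (A : Matrix ℕ ℕ ℕ) : Prop :=
  ∃ k, 1 ≤ k ∧ ∀ i j, 0 < matPow A k i j

/-- The countable Markov shift with incidence matrix `A` on the alphabet `M`: the one-sided
sequences of letters with `A (x n) (x (n + 1)) = 1` for all `n`. The letter `b k` is
represented by its index `k`. -/
def Shift (_M : Alphabet) (A : Matrix ℕ ℕ ℕ) : Type :=
  {x : ℕ → ℕ // ∀ n, A (x n) (x (n + 1)) = 1}

namespace Shift

variable {M : Alphabet} {A : Matrix ℕ ℕ ℕ}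

theorem abs_le_one (M : Alphabet) (i j : ℕ) : |M.b i - M.b j| ≤ 1 := by
  have h1 := M.mem_Icc i
  have h2 := M.mem_Icc j
  rw [abs_le]
  constructor <;> linarith [h1.1, h1.2, h2.1, h2.2]

theorem summable_dist (x y : Shift M A) :
    Summable fun n : ℕ => (1 / 2 : ℝ) ^ (n + 1) * |M.b (x.1 n) - M.b (y.1 n)| := by
  have hs : Summable fun n : ℕ => (1 / 2 : ℝ) ^ (n + 1) :=
    (summable_nat_add_iff 1).2 summable_geometric_two
  refine hs.of_nonneg_of_le (fun n => by positivity) (fun n => ?_)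
  exact mul_le_of_le_one_right (by positivity) (abs_le_one M _ _)

/-- The metric `d(x, y) = ∑_{n ≥ 1} 2⁻ⁿ |x_n - y_n|` (indices start at `0` here). -/
instance : MetricSpace (Shift M A) where
  dist x y := ∑' n : ℕ, (1 / 2 : ℝ) ^ (n + 1) * |M.b (x.1 n) - M.b (y.1 n)|
  dist_self x := by simp
  dist_comm x y := by simp only [abs_sub_comm]
  dist_triangle x y z := by
    rw [← (summable_dist x y).tsum_add (summable_dist y z)]
    refine (summable_dist x z).tsum_le_tsum (fun n => ?_)
      ((summable_dist x y).add (summable_dist y z))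
    rw [← mul_add]
    exact mul_le_mul_of_nonneg_left (abs_sub_le _ _ _) (by positivity)
  eq_of_dist_eq_zero := by
    intro x y h
    have h0 := (hasSum_zero_iff_of_nonneg (fun n => by positivity)).1
      (h ▸ (summable_dist x y).hasSum)
    refine Subtype.ext (funext fun n => M.strictMono.injective ?_)
    have hn := congrFun h0 n
    have hpos : ((1 / 2 : ℝ) ^ (n + 1)) ≠ 0 := by positivity
    have habs : |M.b (x.1 n) - M.b (y.1 n)| = 0 := by
      simpa using (mul_eq_zero.1 hn).resolve_left hpos
    exact sub_eq_zero.1 (abs_eq_zero.1 habs)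

instance : MeasurableSpace (Shift M A) := borel (Shift M A)

instance : BorelSpace (Shift M A) := ⟨rfl⟩

/-- The shift map. -/
def shift (x : Shift M A) : Shift M A := ⟨fun n => x.1 (n + 1), fun n => x.2 (n + 1)⟩

/-- The concatenation `a x`, for a letter `a` that may precede `x`. -/
def cons (x : Shift M A) (a : {a : ℕ // A a (x.1 0) = 1}) : Shift M A :=
  ⟨fun n => Nat.casesOn n a.1 x.1, fun n => by
    cases n with
    | zero => exact a.2
    | succ n => exact x.2 n⟩

end Shift

/-! The Ruelle operator -/

section Ruelle

variable {M : Alphabet} {A : Matrix ℕ ℕ ℕ} {α : ℝ≥0}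

/-- `L` is the Ruelle operator of the potential `φ` on the space of `α`-Hölder functions: for
every `ψ` and every `x`, the series `∑_a exp (φ (a x)) ψ (a x)` over all letters `a` with
`A a x₁ = 1` converges (absolutely), with sum `L ψ x`. -/
def IsRuelleOperator {𝕜 : Type*} [RCLike 𝕜] (φ : Shift M A → ℝ)
    (L : HolderSpace α (Shift M A) 𝕜 →L[𝕜] HolderSpace α (Shift M A) 𝕜) : Prop :=
  ∀ (ψ : HolderSpace α (Shift M A) 𝕜) (x : Shift M A),
    HasSum (fun a : {a : ℕ // A a (x.1 0) = 1} =>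
      ((Real.exp (φ (x.cons a)) : ℝ) : 𝕜) * ψ (x.cons a)) (L ψ x)

/-- The measure `μ'` is the image `L^* μ` of the measure `μ` under the dual of `L`:
`μ'(ψ) = μ(L ψ)` for every Hölder function `ψ`. -/
def IsDualImage (L : HolderSpace α (Shift M A) ℝ →L[ℝ] HolderSpace α (Shift M A) ℝ)
    (μ μ' : MeasureTheory.Measure (Shift M A)) : Prop :=
  ∀ ψ : HolderSpace α (Shift M A) ℝ, ∫ x, ψ x ∂μ' = ∫ x, L ψ x ∂μ

end Ruelle

end RPF

end

/-!
The proof is Birkhoff's contraction argument for a positive operator on a cone, applied to the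
Ruelle operator `L` on Hölder functions.

*The cone.* Let `j₀` be an index after which the columns of `A` coincide, so that the
predecessors of the letter `b i` depend only on `min i j₀`. The cone `holderCone` consists of
the nonnegative functions `h` with `h x ≤ exp (a d(x, y) ^ α) h y` whenever the first letters of
`x` and `y` have the same predecessors. Taking preimages halves distances, so for suitable `a`
the operator `L` maps the cone with parameter `a` into the one with parameter `a - 1`
(`exists_mapsTo_holderCone`). Points whose first letters have different predecessors are
uniformly separated, although the space need not be compact; hence the cone is solid and normal for
the Hölder norm (`exists_isSolidNormal_holderCone`). An operator `T` that improves the parameter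
and satisfies `δ h y ≤ T h x` for all `x` and `y` has an image of finite diameter in the cone
(`exists_isPrimitiveOn`), and therefore contracts it: there are an interior eigenvector, an
eigenfunctional, and exponential convergence of the normalized iterates
(`IsPrimitiveOn.exists_eigenvector`, `IsPrimitiveOn.exists_functional`).

*Irreducible matrices.* No power of `L` need be primitive, but only finitely many pairs of
letters `b i`, `b j` with `i, j ≤ j₀` matter, so some sum `S = L + ⋯ + L ^ N` is. Since `L`
commutes with `S`, the eigenfunction `f` and the eigenfunctional `Λ` of `S`, being unique up to
scalars, are eigenvectors of `L` and of its dual for an eigenvalue `lam > 0`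
(`exists_eigendata`). Its eigenspace is spanned by `f`, and `Λ f = 1` makes it algebraically
simple (`maxGenEigenspace_eq_span`). Since `f` lies in the interior of the cone, `‖L ^ n‖` is at
most a multiple of `lam ^ n` (`IsSolidNormal.norm_pow_le`), which bounds the spectrum.

*The measure.* The functional `Λ` is positive. Under it the letters are tight: for the first
letter because `p` is summable, for the next ones because `L (ψ ∘ σ) = ψ · L 1`
(`tendsto_eigenfunctional_indicator`). Clopen cylinders have Hölder indicator functions, so `Λ`
defines an additive set function on them. Tightness makes it countably additive, and its
Carathéodory extension represents `Λ` (`exists_measure_of_functional`). Conversely every measure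
that is fixed by the dual of the normalized operator yields an eigenfunctional of `L`, hence is
`f ρ` (`eq_withDensity_of_isDualImage`).

*Aperiodic matrices.* Here a power of `L` is itself primitive, so that `lam⁻ⁿ L ^ n ψ` converges
exponentially fast to `(∫ ψ dρ) f` in the Hölder norm (`exists_exponential_convergence`). This
gives both the uniform convergence and the spectral gap, the latter by splitting off the
rank-one eigenprojection (`norm_le_of_mem_spectrum_of_ne`). Statements on complex functions
follow from the real ones by treating real and imaginary parts separately.
-/

noncomputable section

namespace RPF

/-! ### Hölder spaces -/

namespace HolderSpace

variable {α : ℝ≥0} {Y : Type*} [MetricSpace Y] {𝕜 : Type*} [RCLike 𝕜]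

@[simp] theorem add_apply (f g : HolderSpace α Y 𝕜) (x : Y) : (f + g) x = f x + g x := rfl

@[simp] theorem smul_apply (c : 𝕜) (f : HolderSpace α Y 𝕜) (x : Y) : (c • f) x = c * f x := rfl

@[simp] theorem sub_apply (f g : HolderSpace α Y 𝕜) (x : Y) : (f - g) x = f x - g x := rfl

@[simp] theorem neg_apply (f : HolderSpace α Y 𝕜) (x : Y) : (-f) x = -f x := rfl

@[simp] theorem zero_apply (x : Y) : (0 : HolderSpace α Y 𝕜) x = 0 := rfl

theorem ext {f g : HolderSpace α Y 𝕜} (h : ∀ x, f x = g x) : f = g :=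
  Subtype.ext (BoundedContinuousFunction.ext h)

theorem norm_apply_le (f : HolderSpace α Y 𝕜) (x : Y) : ‖f x‖ ≤ ‖f‖ := by
  rw [norm_def]
  exact (f.toBCF.norm_coe_le_norm x).trans (le_add_of_nonneg_right (NNReal.coe_nonneg _))

theorem norm_sub_apply_le (f : HolderSpace α Y 𝕜) (x y : Y) :
    ‖f x - f y‖ ≤ ‖f‖ * dist x y ^ (α : ℝ) := by
  have h := f.memHolder.holderWith.dist_le x y
  rw [dist_eq_norm] at h
  refine h.trans (mul_le_mul_of_nonneg_right ?_ (by positivity))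
  rw [norm_def]
  exact le_add_of_nonneg_left (norm_nonneg _)

theorem holderWith_of_norm_sub_le {f : Y → 𝕜} {C : ℝ}
    (hC : ∀ x y, ‖f x - f y‖ ≤ C * dist x y ^ (α : ℝ)) : HolderWith C.toNNReal α f := by
  intro x y
  rw [edist_nndist, edist_nndist, ← ENNReal.coe_rpow_of_nonneg _ α.coe_nonneg, ← ENNReal.coe_mul,
    ENNReal.coe_le_coe, ← NNReal.coe_le_coe]
  push_cast
  rw [dist_eq_norm]
  exact (hC x y).trans (mul_le_mul_of_nonneg_right (Real.le_coe_toNNReal C) (by positivity))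

/-- A bounded continuous function that is Hölder, as an element of the Hölder space. -/
def mk (f : Y →ᵇ 𝕜) (hf : MemHolder α (f : Y → 𝕜)) : HolderSpace α Y 𝕜 :=
  (⟨f, hf⟩ : holderSubmodule α Y 𝕜)

theorem norm_le_of_bounds {f : HolderSpace α Y 𝕜} {B C : ℝ} (hB0 : 0 ≤ B) (hC0 : 0 ≤ C)
    (hB : ∀ x, ‖f x‖ ≤ B) (hC : ∀ x y, ‖f x - f y‖ ≤ C * dist x y ^ (α : ℝ)) :
    ‖f‖ ≤ B + C := by
  rw [norm_def]
  refine add_le_add ((BoundedContinuousFunction.norm_le hB0).2 hB) ?_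
  have h := NNReal.coe_le_coe.2 (holderWith_of_norm_sub_le hC).nnholderNorm_le
  rwa [Real.coe_toNNReal _ hC0] at h

/-- The Hölder function given by a function with explicit sup and Hölder bounds. -/
def ofBounds (hα : 0 < α) (f : Y → 𝕜) {B C : ℝ} (hB : ∀ x, ‖f x‖ ≤ B)
    (hC : ∀ x y, ‖f x - f y‖ ≤ C * dist x y ^ (α : ℝ)) : HolderSpace α Y 𝕜 :=
  mk (BoundedContinuousFunction.ofNormedAddCommGroup f
    ((holderWith_of_norm_sub_le hC).continuous hα) B hB) ⟨_, holderWith_of_norm_sub_le hC⟩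

@[simp] theorem ofBounds_apply (hα : 0 < α) (f : Y → 𝕜) {B C : ℝ}
    (hB : ∀ x, ‖f x‖ ≤ B) (hC : ∀ x y, ‖f x - f y‖ ≤ C * dist x y ^ (α : ℝ)) (x : Y) :
    ofBounds hα f hB hC x = f x := rfl

/-- Evaluation at a point. -/
def eval (x : Y) : HolderSpace α Y 𝕜 →L[𝕜] 𝕜 :=
  LinearMap.mkContinuous
    { toFun := fun f => f x
      map_add' := fun _ _ => rfl
      map_smul' := fun _ _ => rfl } 1 (fun f => by rw [one_mul]; exact norm_apply_le f x)

@[simp] theorem eval_apply (x : Y) (f : HolderSpace α Y 𝕜) : eval x f = f x := rfl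

theorem sum_apply {ι : Type*} (s : Finset ι) (f : ι → HolderSpace α Y 𝕜) (x : Y) :
    (∑ i ∈ s, f i) x = ∑ i ∈ s, f i x :=
  map_sum (eval (𝕜 := 𝕜) (α := α) x) f s

instance : CompleteSpace (HolderSpace α Y 𝕜) := by
  refine Metric.complete_of_cauchySeq_tendsto fun u hu => ?_
  have hbcf : CauchySeq fun n => (u n).toBCF := by
    rw [Metric.cauchySeq_iff] at hu ⊢
    intro ε hε
    obtain ⟨N, hN⟩ := hu ε hε
    refine ⟨N, fun m hm n hn => lt_of_le_of_lt ?_ (hN m hm n hn)⟩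
    rw [dist_eq_norm, dist_eq_norm, norm_def]
    exact le_add_of_nonneg_right (NNReal.coe_nonneg _)
  obtain ⟨g, hg⟩ := cauchySeq_tendsto_of_complete hbcf
  have hgx : ∀ x, Filter.Tendsto (fun n => u n x) Filter.atTop (nhds (g x)) := fun x =>
    ((BoundedContinuousFunction.lipschitz_eval_const x).continuous.tendsto g).comp hg
  -- the sup and Hölder estimates for `u n - u m` survive the pointwise limit in `m`
  have key : ∀ ε > 0, ∃ N, ∀ n ≥ N, (∀ x, ‖u n x - g x‖ ≤ ε) ∧
      ∀ x y, ‖(u n x - g x) - (u n y - g y)‖ ≤ ε * dist x y ^ (α : ℝ) := by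
    intro ε hε
    obtain ⟨N, hN⟩ := Metric.cauchySeq_iff.1 hu ε hε
    refine ⟨N, fun n hn => ⟨fun x => ?_, fun x y => ?_⟩⟩
    · refine le_of_tendsto ((tendsto_const_nhds.sub (hgx x)).norm) ?_
      filter_upwards [Filter.eventually_ge_atTop N] with m hm
      have := (hN n hn m hm).le
      rw [dist_eq_norm] at this
      exact (norm_apply_le (u n - u m) x).trans this
    · refine le_of_tendsto (((tendsto_const_nhds.sub (hgx x)).sub
        (tendsto_const_nhds.sub (hgx y))).norm) ?_
      filter_upwards [Filter.eventually_ge_atTop N] with m hm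
      have := (hN n hn m hm).le
      rw [dist_eq_norm] at this
      exact (norm_sub_apply_le (u n - u m) x y).trans
        (mul_le_mul_of_nonneg_right this (by positivity))
  obtain ⟨N, hN⟩ := key 1 one_pos
  have hmem : MemHolder α (g : Y → 𝕜) := by
    refine ⟨_, holderWith_of_norm_sub_le (C := ‖u N‖ + 1) fun x y => ?_⟩
    have h1 := (hN N le_rfl).2 x y
    have h2 := norm_sub_apply_le (u N) x y
    calc ‖g x - g y‖ = ‖(u N x - u N y) - ((u N x - g x) - (u N y - g y))‖ := by
          congr 1; ring
      _ ≤ _ := norm_sub_le _ _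
      _ ≤ ‖u N‖ * dist x y ^ (α : ℝ) + 1 * dist x y ^ (α : ℝ) := add_le_add h2 h1
      _ = _ := by rw [← add_mul]
  refine ⟨mk g hmem, ?_⟩
  rw [Metric.tendsto_atTop]
  intro ε hε
  obtain ⟨N, hN⟩ := key (ε / 3) (by positivity)
  refine ⟨N, fun n hn => ?_⟩
  rw [dist_eq_norm]
  have : ‖u n - mk g hmem‖ ≤ ε / 3 + ε / 3 :=
    norm_le_of_bounds (by positivity) (by positivity) (hN n hn).1 (hN n hn).2
  linarith

/-- The constant function `1`. -/
instance : One (HolderSpace α Y 𝕜) :=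
  ⟨mk 1 (memHolder_const (X := Y) (c := (1 : 𝕜)))⟩

@[simp] theorem one_apply (x : Y) : (1 : HolderSpace α Y 𝕜) x = 1 := rfl

/-- Multiplication by a real Hölder function, on Hölder functions with values in `𝕜`. -/
def mulReal (hα : 0 < α) (g : HolderSpace α Y ℝ) :
    HolderSpace α Y 𝕜 →L[𝕜] HolderSpace α Y 𝕜 :=
  have hB : ∀ (ψ : HolderSpace α Y 𝕜) x, ‖((g x : ℝ) : 𝕜) * ψ x‖ ≤ ‖g‖ * ‖ψ‖ := fun ψ x => by
    rw [norm_mul, RCLike.norm_ofReal]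
    exact mul_le_mul (norm_apply_le g x) (norm_apply_le ψ x) (norm_nonneg _) (norm_nonneg _)
  have hC : ∀ (ψ : HolderSpace α Y 𝕜) x y, ‖((g x : ℝ) : 𝕜) * ψ x - ((g y : ℝ) : 𝕜) * ψ y‖ ≤
      (2 * (‖g‖ * ‖ψ‖)) * dist x y ^ (α : ℝ) := fun ψ x y => by
    have h1 := norm_sub_apply_le g x y
    have h2 := norm_sub_apply_le ψ x y
    have h3 := norm_apply_le g x
    have h4 := norm_apply_le ψ y
    calc ‖((g x : ℝ) : 𝕜) * ψ x - ((g y : ℝ) : 𝕜) * ψ y‖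
        = ‖((g x : ℝ) : 𝕜) * (ψ x - ψ y) + ((g x - g y : ℝ) : 𝕜) * ψ y‖ := by
          congr 1; push_cast; ring
      _ ≤ ‖g x‖ * ‖ψ x - ψ y‖ + ‖g x - g y‖ * ‖ψ y‖ := by
          refine (norm_add_le _ _).trans_eq ?_
          rw [norm_mul, norm_mul, RCLike.norm_ofReal, RCLike.norm_ofReal]; rfl
      _ ≤ ‖g‖ * (‖ψ‖ * dist x y ^ (α : ℝ)) + ‖g‖ * dist x y ^ (α : ℝ) * ‖ψ‖ := by gcongr
      _ = _ := by ring
  LinearMap.mkContinuous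
    { toFun := fun ψ => ofBounds hα (fun x => ((g x : ℝ) : 𝕜) * ψ x) (hB ψ) (hC ψ)
      map_add' := fun ψ χ => ext fun x => by simp [mul_add]
      map_smul' := fun c ψ => ext fun x => by simp; ring }
    (3 * ‖g‖) (fun ψ => by
      refine (norm_le_of_bounds (by positivity) (by positivity) (hB ψ) (hC ψ)).trans_eq ?_
      ring)

@[simp] theorem mulReal_apply (hα : 0 < α) (g : HolderSpace α Y ℝ) (ψ : HolderSpace α Y 𝕜)
    (x : Y) : mulReal hα g ψ x = ((g x : ℝ) : 𝕜) * ψ x := rfl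

/-- The complex Hölder function with the values of a real one. -/
def toComplex (hα : 0 < α) (g : HolderSpace α Y ℝ) : HolderSpace α Y ℂ := mulReal hα g 1

@[simp] theorem toComplex_apply (hα : 0 < α) (g : HolderSpace α Y ℝ) (x : Y) :
    toComplex hα g x = ((g x : ℝ) : ℂ) := by
  simp [toComplex]

theorem norm_toComplex_le (hα : 0 < α) (g : HolderSpace α Y ℝ) : ‖toComplex hα g‖ ≤ 2 * ‖g‖ := by
  refine (norm_le_of_bounds (B := ‖g‖) (C := ‖g‖) (norm_nonneg _) (norm_nonneg _)
    (fun x => ?_) (fun x y => ?_)).trans_eq (two_mul _).symm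
  · simpa using norm_apply_le g x
  · rw [toComplex_apply, toComplex_apply, ← Complex.ofReal_sub, Complex.norm_real]
    exact norm_sub_apply_le g x y

/-- Composition of a complex Hölder function with a real functional of norm at most one. -/
def compCLM (hα : 0 < α) (T : ℂ →L[ℝ] ℝ) (hT : ‖T‖ ≤ 1) :
    HolderSpace α Y ℂ →+ HolderSpace α Y ℝ where
  toFun ψ := ofBounds hα (fun x => T (ψ x)) (B := ‖ψ‖) (C := ‖ψ‖)
    (fun x => (T.le_of_opNorm_le hT _).trans (by simpa using norm_apply_le ψ x))
    (fun x y => by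
      rw [← map_sub]
      exact (T.le_of_opNorm_le hT _).trans (by simpa using norm_sub_apply_le ψ x y))
  map_zero' := ext fun x => by simp
  map_add' ψ χ := ext fun x => by simp

/-- The real part of a complex Hölder function. -/
def re (hα : 0 < α) : HolderSpace α Y ℂ →+ HolderSpace α Y ℝ :=
  compCLM hα Complex.reCLM Complex.reCLM_norm.le

/-- The imaginary part of a complex Hölder function. -/
def im (hα : 0 < α) : HolderSpace α Y ℂ →+ HolderSpace α Y ℝ :=
  compCLM hα Complex.imCLM Complex.imCLM_norm.le

@[simp] theorem re_apply (hα : 0 < α) (ψ : HolderSpace α Y ℂ) (x : Y) :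
    re hα ψ x = (ψ x).re := rfl

@[simp] theorem im_apply (hα : 0 < α) (ψ : HolderSpace α Y ℂ) (x : Y) :
    im hα ψ x = (ψ x).im := rfl

theorem norm_re_le (hα : 0 < α) (ψ : HolderSpace α Y ℂ) : ‖re hα ψ‖ ≤ 2 * ‖ψ‖ := by
  refine (norm_le_of_bounds (B := ‖ψ‖) (C := ‖ψ‖) (norm_nonneg _) (norm_nonneg _)
    (fun x => ?_) (fun x y => ?_)).trans_eq (two_mul _).symm
  · exact (Complex.abs_re_le_norm _).trans (norm_apply_le ψ x)
  · rw [re_apply, re_apply, ← Complex.sub_re]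
    exact (Complex.abs_re_le_norm _).trans (norm_sub_apply_le ψ x y)

theorem norm_im_le (hα : 0 < α) (ψ : HolderSpace α Y ℂ) : ‖im hα ψ‖ ≤ 2 * ‖ψ‖ := by
  refine (norm_le_of_bounds (B := ‖ψ‖) (C := ‖ψ‖) (norm_nonneg _) (norm_nonneg _)
    (fun x => ?_) (fun x y => ?_)).trans_eq (two_mul _).symm
  · exact (Complex.abs_im_le_norm _).trans (norm_apply_le ψ x)
  · rw [im_apply, im_apply, ← Complex.sub_im]
    exact (Complex.abs_im_le_norm _).trans (norm_sub_apply_le ψ x y)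

theorem re_add_im (hα : 0 < α) (ψ : HolderSpace α Y ℂ) :
    ψ = toComplex hα (re hα ψ) + Complex.I • toComplex hα (im hα ψ) :=
  ext fun x => by
    rw [add_apply, smul_apply, toComplex_apply, toComplex_apply, mul_comm]
    exact (Complex.re_add_im _).symm

end HolderSpace

/-! ### Contraction of a cone by a positive operator -/

section Cone

variable {E : Type*} [NormedAddCommGroup E] [NormedSpace ℝ E]

/-- A closed convex cone `K` that is solid with interior point `e` (every `ψ` satisfies
`ψ ≤ κ ‖ψ‖ e` in the order of `K`) and normal (`0 ≤ h ≤ m e` implies `‖h‖ ≤ κ m`), with a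
functional `ℓ` that is nonnegative on `K` and normalized by `ℓ e = 1`. -/
structure IsSolidNormal (K : ConvexCone ℝ E) (e : E) (ℓ : E →L[ℝ] ℝ) (κ : ℝ) : Prop where
  isClosed : IsClosed (K : Set E)
  pos : 0 < κ
  unit_mem : e ∈ K
  solid : ∀ ψ, (κ * ‖ψ‖) • e - ψ ∈ K
  normal : ∀ h ∈ K, ∀ m : ℝ, m • e - h ∈ K → ‖h‖ ≤ κ * m
  nonneg : ∀ h ∈ K, 0 ≤ ℓ h
  map_unit : ℓ e = 1

/-- `T` maps the cone `K` into a part of it of finite diameter: `δ ℓ(h) e ≤ T h ≤ B ℓ(T h) e` in the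
order of `K`, for every `h ∈ K`. -/
structure IsPrimitiveOn (K : ConvexCone ℝ E) (e : E) (ℓ : E →L[ℝ] ℝ) (δ B : ℝ)
    (T : E →L[ℝ] E) : Prop where
  pos : 0 < δ
  one_le : 1 ≤ B
  mapsTo : ∀ h ∈ K, T h ∈ K
  lower : ∀ h ∈ K, T h - (δ * ℓ h) • e ∈ K
  upper : ∀ h ∈ K, (B * ℓ (T h)) • e - T h ∈ K

variable {K : ConvexCone ℝ E} {e : E} {ℓ : E →L[ℝ] ℝ} {κ δ B : ℝ} {T : E →L[ℝ] E}

namespace IsSolidNormal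

theorem zero_mem (hK : IsSolidNormal K e ℓ κ) : (0 : E) ∈ K := by
  simpa using hK.solid 0

theorem smul_mem (hK : IsSolidNormal K e ℓ κ) {c : ℝ} (hc : 0 ≤ c) {h : E} (hh : h ∈ K) :
    c • h ∈ K := by
  rcases hc.eq_or_lt with rfl | hc
  · simpa using hK.zero_mem
  · exact K.smul_mem hc hh

theorem add_solid (hK : IsSolidNormal K e ℓ κ) (ψ : E) : ψ + (κ * ‖ψ‖) • e ∈ K := by
  have := hK.solid (-ψ)
  rwa [norm_neg, sub_neg_eq_add, add_comm] at this

theorem pow_mapsTo {L : E →L[ℝ] E} (hL : ∀ h ∈ K, L h ∈ K) (n : ℕ) : ∀ h ∈ K, (L ^ n) h ∈ K := by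
  induction n with
  | zero => intro h hh; simpa using hh
  | succ n ih => intro h hh; rw [pow_succ']; exact hL _ (ih h hh)

theorem pow_eigen {L : E →L[ℝ] E} {lam : ℝ} {F : E} (hF : L F = lam • F) (n : ℕ) :
    (L ^ n) F = lam ^ n • F := by
  induction n with
  | zero => simp
  | succ n ih =>
    rw [pow_succ', mul_apply_eq_comp, ih, map_smul, hF, smul_smul, pow_succ]

/-- An operator that preserves the cone and has an eigenvector in its interior is power bounded
after division by the eigenvalue. -/
theorem norm_pow_le (hK : IsSolidNormal K e ℓ κ) {L : E →L[ℝ] E} (hL : ∀ h ∈ K, L h ∈ K)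
    {lam c : ℝ} (hlam : 0 < lam) (hc : 0 < c) {F : E} (hF : L F = lam • F)
    (hFc : F - c • e ∈ K) :
    ∃ C, 0 ≤ C ∧ ∀ (n : ℕ) ψ, ‖(L ^ n) ψ‖ ≤ C * lam ^ n * ‖ψ‖ := by
  have hκ := hK.pos
  refine ⟨κ * (2 * (κ / c) * (κ * ‖F‖)) + κ / c * ‖F‖, by positivity, fun n ψ => ?_⟩
  set b : ℝ := κ / c * ‖ψ‖ with hb
  have hb0 : 0 ≤ b := by positivity
  have hbc : b * c = κ * ‖ψ‖ := by rw [hb]; field_simp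
  have hpow : 0 < lam ^ n := by positivity
  have hn := pow_mapsTo hL n
  have h1 : ψ + b • F ∈ K := by
    have := K.add_mem (hK.add_solid ψ) (hK.smul_mem hb0 hFc)
    convert! this using 1
    rw [smul_sub, smul_smul, hbc]; abel
  have h2 : b • F - ψ ∈ K := by
    have := K.add_mem (hK.solid ψ) (hK.smul_mem hb0 hFc)
    convert! this using 1
    rw [smul_sub, smul_smul, hbc]; abel
  have h1n := hn _ h1
  have h2n := hn _ h2
  rw [map_add, map_smul, pow_eigen hF] at h1n
  rw [map_sub, map_smul, pow_eigen hF] at h2n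
  have h3 : (2 * b * lam ^ n * (κ * ‖F‖)) • e - ((L ^ n) ψ + b • lam ^ n • F) ∈ K := by
    have := K.add_mem h2n (hK.smul_mem (c := 2 * b * lam ^ n) (by positivity) (hK.solid F))
    convert! this using 1
    module
  have h4 := hK.normal _ h1n _ h3
  have h5 : ‖b • lam ^ n • F‖ = b * lam ^ n * ‖F‖ := by
    rw [norm_smul, norm_smul, Real.norm_of_nonneg hb0, Real.norm_of_nonneg hpow.le]
    ring
  calc ‖(L ^ n) ψ‖ = ‖((L ^ n) ψ + b • lam ^ n • F) - b • lam ^ n • F‖ := by simp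
    _ ≤ κ * (2 * b * lam ^ n * (κ * ‖F‖)) + b * lam ^ n * ‖F‖ :=
      (norm_sub_le _ _).trans (add_le_add h4 h5.le)
    _ = _ := by rw [hb]; ring

end IsSolidNormal

namespace IsPrimitiveOn

/-- One step of Birkhoff's argument: the interval of constants comparing `T h` with `T g` is shorter
by a fixed factor than the one comparing `h` with `g`. -/
theorem exists_contraction (hK : IsSolidNormal K e ℓ κ) (hT : IsPrimitiveOn K e ℓ δ B T) :
    ∃ η : ℝ, 0 < η ∧ η < 1 ∧ ∀ g h : E, ∀ s t : ℝ, g ∈ K → (B * ℓ g) • e - g ∈ K → s ≤ t →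
      h - s • g ∈ K → t • g - h ∈ K →
      ∃ s' t', s ≤ s' ∧ s' ≤ t' ∧ t' ≤ t ∧ t' - s' = (1 - η) * (t - s) ∧
        T h - s' • T g ∈ K ∧ t' • T g - T h ∈ K := by
  have hκ := hK.pos
  have hδ := hT.pos
  have hB : 0 < B := one_pos.trans_le hT.one_le
  -- `D` satisfies `T g ≤ D ℓ(g) e`; the summand `δ` only makes `D` positive
  set D : ℝ := B * (κ * ‖T e‖) + δ with hD
  have hD0 : 0 < D := by positivity
  have hη1 : δ / (2 * D) < 1 := by
    rw [div_lt_one (by positivity)]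
    have : 0 ≤ B * (κ * ‖T e‖) := by positivity
    linarith
  have hη0 : 0 < δ / (2 * D) := by positivity
  refine ⟨δ / (2 * D), hη0, hη1, fun g h s t hg hgB hst hs ht => ?_⟩
  set η := δ / (2 * D) with hη
  have hηD : η * D = δ / 2 := by rw [hη]; field_simp
  have hℓg := hK.nonneg g hg
  have hts : 0 ≤ t - s := sub_nonneg.2 hst
  have hup : (D * ℓ g) • e - T g ∈ K := by
    have h1 := hT.mapsTo _ hgB
    have h2 := hK.smul_mem (c := B * ℓ g) (by positivity) (hK.solid (T e))
    have h3 := hK.smul_mem (c := δ * ℓ g) (by positivity) hK.unit_mem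
    rw [map_sub, map_smul] at h1
    convert! K.add_mem (K.add_mem h1 h2) h3 using 1
    rw [hD]; module
  have key : ∀ u ∈ K, (t - s) * ℓ g / 2 ≤ ℓ u → T u - (η * (t - s)) • T g ∈ K := by
    intro u hu hℓu
    have h1 := hT.lower u hu
    have h2 := hK.smul_mem (c := δ * (ℓ u - (t - s) * ℓ g / 2))
      (mul_nonneg hδ.le (sub_nonneg.2 hℓu)) hK.unit_mem
    have h3 := hK.smul_mem (c := η * (t - s)) (by positivity) hup
    convert! K.add_mem (K.add_mem h1 h2) h3 using 1
    have h4 : η * (t - s) * (D * ℓ g) = δ * ((t - s) * ℓ g / 2) := by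
      linear_combination (t - s) * ℓ g * hηD
    rw [smul_sub, smul_smul, h4]
    module
  have hsum : ℓ (h - s • g) + ℓ (t • g - h) = (t - s) * ℓ g := by
    simp only [map_sub, map_smul, smul_eq_mul]; ring
  have hTs := hT.mapsTo _ hs
  have hTt := hT.mapsTo _ ht
  rw [map_sub, map_smul] at hTs hTt
  have hη' : 0 ≤ η * (t - s) := by positivity
  have hη'' : η * (t - s) ≤ t - s := by nlinarith
  -- one of `ℓ (h - s g)`, `ℓ (t g - h)` is at least half of their sum, so that one end of the
  -- interval can be moved
  rcases le_total ((t - s) * ℓ g / 2) (ℓ (h - s • g)) with hc | hc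
  · refine ⟨s + η * (t - s), t, by linarith, by linarith, le_rfl, by ring, ?_, hTt⟩
    have := key _ hs hc
    rw [map_sub, map_smul] at this
    convert! this using 1
    module
  · refine ⟨s, t - η * (t - s), le_rfl, by linarith, by linarith, by ring, hTs, ?_⟩
    have := key _ ht (by linarith)
    rw [map_sub, map_smul] at this
    convert! this using 1
    module

/-- Iterating the contraction: nested intervals `[s n, t n]` of length `θ ^ n (t₀ - s₀)` with
`s n • T ^ n g ≤ T ^ n h ≤ t n • T ^ n g` in the order of the cone. -/
theorem exists_seq (hK : IsSolidNormal K e ℓ κ) (hT : IsPrimitiveOn K e ℓ δ B T) :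
    ∃ θ : ℝ, 0 < θ ∧ θ < 1 ∧ ∀ g h : E, ∀ s₀ t₀ : ℝ, g ∈ K → (B * ℓ g) • e - g ∈ K → s₀ ≤ t₀ →
      h - s₀ • g ∈ K → t₀ • g - h ∈ K →
      ∃ s t : ℕ → ℝ, Monotone s ∧ Antitone t ∧ s 0 = s₀ ∧ t 0 = t₀ ∧
        (∀ n, t n - s n = θ ^ n * (t₀ - s₀)) ∧ (∀ n, (T ^ n) h - s n • (T ^ n) g ∈ K) ∧
        ∀ n, t n • (T ^ n) g - (T ^ n) h ∈ K := by
  obtain ⟨η, hη0, hη1, hη⟩ := exists_contraction hK hT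
  refine ⟨1 - η, by linarith, by linarith, fun g h s₀ t₀ hg hgB hst hs ht => ?_⟩
  let P : ℕ → ℝ × ℝ → Prop := fun n q =>
    q.1 ≤ q.2 ∧ (T ^ n) h - q.1 • (T ^ n) g ∈ K ∧ q.2 • (T ^ n) g - (T ^ n) h ∈ K
  have hmem := IsSolidNormal.pow_mapsTo hT.mapsTo
  have hgood : ∀ n, (B * ℓ ((T ^ n) g)) • e - (T ^ n) g ∈ K := by
    intro n
    cases n with
    | zero => simpa using hgB
    | succ n => rw [pow_succ']; exact hT.upper _ (hmem n g hg)
  have hstep : ∀ n (q : {q // P n q}), ∃ r : {r // P (n + 1) r}, q.1.1 ≤ r.1.1 ∧ r.1.2 ≤ q.1.2 ∧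
      r.1.2 - r.1.1 = (1 - η) * (q.1.2 - q.1.1) := by
    rintro n ⟨⟨s, t⟩, h1, h2, h3⟩
    obtain ⟨s', t', a1, a2, a3, a4, a5, a6⟩ :=
      hη _ _ s t (hmem n g hg) (hgood n) h1 h2 h3
    refine ⟨⟨(s', t'), a2, ?_, ?_⟩, a1, a3, a4⟩
    · rw [pow_succ']; exact a5
    · rw [pow_succ']; exact a6
  choose f hf using hstep
  let u : ∀ n, {q // P n q} := fun n =>
    Nat.rec ⟨(s₀, t₀), hst, by simpa using hs, by simpa using ht⟩ (fun n q => f n q) n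
  refine ⟨fun n => (u n).1.1, fun n => (u n).1.2, monotone_nat_of_le_succ fun n => (hf n (u n)).1,
    antitone_nat_of_succ_le fun n => (hf n (u n)).2.1, rfl, rfl, fun n => ?_,
    fun n => (u n).2.2.1, fun n => (u n).2.2.2⟩
  induction n with
  | zero => rw [pow_zero, one_mul]; rfl
  | succ n ih =>
    refine (hf n (u n)).2.2.trans ?_
    rw [ih, pow_succ]; ring

/-- Existence of an interior eigenvector: the iterates `T ^ n e`, normalized by `ℓ`, form a Cauchy
sequence. -/
theorem exists_eigenvector [CompleteSpace E] (hK : IsSolidNormal K e ℓ κ)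
    (hT : IsPrimitiveOn K e ℓ δ B T) :
    ∃ (lam c : ℝ) (F : E), 0 < lam ∧ 0 < c ∧ T F = lam • F ∧ F - c • e ∈ K := by
  have hκ := hK.pos
  have hδ := hT.pos
  have hB : 0 < B := one_pos.trans_le hT.one_le
  obtain ⟨θ, hθ0, hθ1, hθ⟩ := exists_seq hK hT
  have hs₀ : T e - δ • e ∈ K := by simpa [hK.map_unit] using hT.lower e hK.unit_mem
  have ht₀ := hK.solid (T e)
  set t₀ := κ * ‖T e‖
  have hst : δ ≤ t₀ := by
    have := hK.nonneg _ (K.add_mem hs₀ ht₀)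
    simp only [map_add, map_sub, map_smul, smul_eq_mul, hK.map_unit] at this
    linarith
  have hgood : (B * ℓ e) • e - e ∈ K := by
    have := hK.smul_mem (c := B - 1) (by linarith [hT.one_le]) hK.unit_mem
    rw [sub_smul, one_smul] at this
    simpa [hK.map_unit] using this
  obtain ⟨s, t, hsm, htm, hs0, ht0, hdiff, hs, ht⟩ :=
    hθ e (T e) δ t₀ hK.unit_mem hgood hst hs₀ ht₀
  have hsucc : ∀ n, (T ^ n) (T e) = (T ^ (n + 1)) e := fun n => by rw [pow_succ]; rfl
  simp only [hsucc] at hs ht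
  set g : ℕ → E := fun n => (T ^ n) e with hg
  have hgT : ∀ n, T (g n) = g (n + 1) := fun n => by simp only [hg]; rw [pow_succ']; rfl
  have hgK : ∀ n, g n ∈ K := fun n => IsSolidNormal.pow_mapsTo hT.mapsTo n e hK.unit_mem
  have hgB : ∀ n, (B * ℓ (g n)) • e - g n ∈ K := by
    intro n
    cases n with
    | zero => simpa [hg] using hgood
    | succ n => rw [← hgT]; exact hT.upper _ (hgK n)
  have hlow : ∀ n, g (n + 1) - (δ * ℓ (g n)) • e ∈ K := fun n => by
    rw [← hgT]; exact hT.lower _ (hgK n)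
  set u : ℕ → ℝ := fun n => ℓ (g n) with hu
  have hu1 : ∀ n, δ * u n ≤ u (n + 1) := fun n => by
    have := hK.nonneg _ (hlow n)
    simp only [map_sub, map_smul, smul_eq_mul, hK.map_unit] at this
    simp only [hu]; linarith
  have hu0 : ∀ n, 0 < u n := by
    intro n
    induction n with
    | zero => simp [hu, hg, hK.map_unit]
    | succ n ih => exact (mul_pos hδ ih).trans_le (hu1 n)
  have hus : ∀ n, s n * u n ≤ u (n + 1) := fun n => by
    have := hK.nonneg _ (hs n)
    simp only [map_sub, map_smul, smul_eq_mul] at this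
    simp only [hu, hg]; linarith
  have hut : ∀ n, u (n + 1) ≤ t n * u n := fun n => by
    have := hK.nonneg _ (ht n)
    simp only [map_sub, map_smul, smul_eq_mul] at this
    simp only [hu, hg]; linarith
  have hut0 : ∀ n, u (n + 1) ≤ t₀ * u n := fun n =>
    (hut n).trans (mul_le_mul_of_nonneg_right (ht0 ▸ htm (Nat.zero_le n)) (hu0 n).le)
  have hgnorm : ∀ n, ‖g n‖ ≤ κ * (B * u n) := fun n => hK.normal _ (hgK n) _ (hgB n)
  set F : ℕ → E := fun n => (u n)⁻¹ • g n with hF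
  have hdist : ∀ n, dist (F n) (F (n + 1)) ≤ (2 * κ * B * (t₀ - δ) / δ) * θ ^ n := by
    intro n
    have hts : 0 ≤ t n - s n := by
      rw [hdiff]; exact mul_nonneg (by positivity) (by linarith)
    have h1 : ‖g (n + 1) - s n • g n‖ ≤ κ * ((t n - s n) * (B * u n)) := by
      refine hK.normal _ (hs n) _ ?_
      convert! K.add_mem (ht n) (hK.smul_mem hts (hgB n)) using 1
      simp only [hg, hu]
      module
    set r := u (n + 1) / u n with hr
    have hr1 : s n ≤ r := (le_div_iff₀ (hu0 n)).2 (hus n)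
    have hr2 : r ≤ t n := (div_le_iff₀ (hu0 n)).2 (hut n)
    have h2 : ‖(r - s n) • g n‖ ≤ (t n - s n) * (κ * (B * u n)) := by
      rw [norm_smul, Real.norm_of_nonneg (by linarith)]
      exact mul_le_mul (by linarith) (hgnorm n) (norm_nonneg _) hts
    have h3 : F n - F (n + 1) =
        (u (n + 1))⁻¹ • ((r - s n) • g n - (g (n + 1) - s n • g n)) := by
      have h4 : (u (n + 1))⁻¹ * r = (u n)⁻¹ := by
        rw [hr]; field_simp [(hu0 n).ne', (hu0 (n + 1)).ne']
      simp only [hF]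
      rw [← h4]
      module
    have h5 : (u (n + 1))⁻¹ * u n ≤ δ⁻¹ := by
      rw [inv_mul_le_iff₀ (hu0 _)]
      rw [← div_eq_mul_inv, le_div_iff₀ hδ, mul_comm]
      exact hu1 n
    rw [dist_eq_norm, h3, norm_smul, norm_inv, Real.norm_of_nonneg (hu0 _).le]
    calc (u (n + 1))⁻¹ * ‖(r - s n) • g n - (g (n + 1) - s n • g n)‖
        ≤ (u (n + 1))⁻¹ * ((t n - s n) * (κ * (B * u n)) + κ * ((t n - s n) * (B * u n))) := by
          refine mul_le_mul_of_nonneg_left ((norm_sub_le _ _).trans (add_le_add h2 h1)) ?_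
          exact (inv_pos.2 (hu0 _)).le
      _ = ((u (n + 1))⁻¹ * u n) * (2 * κ * B * (t n - s n)) := by ring
      _ ≤ δ⁻¹ * (2 * κ * B * (t n - s n)) := by gcongr
      _ = _ := by rw [hdiff, div_eq_mul_inv]; ring
  obtain ⟨F', hF'⟩ := cauchySeq_tendsto_of_complete (cauchySeq_of_le_geometric θ _ hθ1 hdist)
  have hTF : ∀ n, T (F n) = (u (n + 1) / u n) • F (n + 1) := fun n => by
    simp only [hF, map_smul, hgT, smul_smul]
    congr 1
    field_simp [(hu0 n).ne', (hu0 (n + 1)).ne']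
  have hℓF : ∀ n, ℓ (F n) = 1 := fun n => by
    simp only [hF, map_smul, smul_eq_mul]
    exact inv_mul_cancel₀ (hu0 n).ne'
  have hlim : Filter.Tendsto (fun n => u (n + 1) / u n) Filter.atTop (nhds (ℓ (T F'))) := by
    have h1 : Filter.Tendsto (fun n => ℓ (T (F n))) Filter.atTop (nhds (ℓ (T F'))) :=
      ((ℓ.continuous.comp T.continuous).tendsto F').comp hF'
    refine h1.congr fun n => ?_
    rw [hTF, map_smul, hℓF, smul_eq_mul, mul_one]
  have ht₀pos : 0 < t₀ := hδ.trans_le hst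
  refine ⟨ℓ (T F'), δ / t₀, F', ?_, by positivity, ?_, ?_⟩
  · refine hδ.trans_le (ge_of_tendsto' hlim fun n => ?_)
    exact (le_div_iff₀ (hu0 n)).2 (hu1 n)
  · refine tendsto_nhds_unique ((T.continuous.tendsto F').comp hF') ?_
    refine (hlim.smul (hF'.comp (Filter.tendsto_add_atTop_nat 1))).congr fun n => ?_
    exact (hTF n).symm
  · refine hK.isClosed.mem_of_tendsto
      ((hF'.comp (Filter.tendsto_add_atTop_nat 1)).sub_const _) (Filter.Eventually.of_forall ?_)
    intro n
    have h1 : 0 ≤ (u (n + 1))⁻¹ * (δ * u n) - δ / t₀ := by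
      rw [sub_nonneg, div_le_iff₀ ht₀pos, inv_mul_eq_div, div_mul_eq_mul_div,
        le_div_iff₀ (hu0 _)]
      nlinarith [hut0 n]
    have h2 := K.add_mem (hK.smul_mem (inv_pos.2 (hu0 (n + 1))).le (hlow n))
      (hK.smul_mem h1 hK.unit_mem)
    convert! h2 using 1
    simp only [Function.comp, hF, hu]
    module

/-- Exponential convergence to the eigenprojection `ψ ↦ Λ ψ • F`. The value `Λ ψ` is the common
point of the nested intervals comparing `T ^ n ψ` with `T ^ n F`; uniqueness of limits makes it
linear. -/
theorem exists_functional (hK : IsSolidNormal K e ℓ κ)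
    (hT : IsPrimitiveOn K e ℓ δ B T) {lam c : ℝ} {F : E} (hlam : 0 < lam) (hc : 0 < c)
    (hF : T F = lam • F) (hFc : F - c • e ∈ K) :
    ∃ (Λ : E →L[ℝ] ℝ) (θ D : ℝ), 0 < θ ∧ θ < 1 ∧ 0 ≤ D ∧
      (∀ (n : ℕ) ψ, ‖(T ^ n) ψ - (lam ^ n * Λ ψ) • F‖ ≤ D * (θ * lam) ^ n * ‖ψ‖) ∧
      ∀ ψ, Filter.Tendsto (fun n : ℕ => (lam ^ n)⁻¹ • (T ^ n) ψ) Filter.atTop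
        (nhds (Λ ψ • F)) := by
  have hκ := hK.pos
  have hB : 0 < B := one_pos.trans_le hT.one_le
  have hFK : F ∈ K := by
    simpa using K.add_mem hFc (hK.smul_mem hc.le hK.unit_mem)
  have hℓF : 0 < ℓ F := by
    have := hK.nonneg _ hFc
    simp only [map_sub, map_smul, smul_eq_mul, hK.map_unit] at this
    linarith
  have hF0 : F ≠ 0 := by rintro rfl; simp at hℓF
  have hFB : (B * ℓ F) • e - F ∈ K := by
    have := hK.smul_mem (inv_pos.2 hlam).le (hT.upper F hFK)
    rw [hF, map_smul, smul_sub, smul_smul, smul_smul, inv_mul_cancel₀ hlam.ne', one_smul,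
      smul_eq_mul] at this
    convert! this using 3
    field_simp
  obtain ⟨θ, hθ0, hθ1, hθ⟩ := exists_seq hK hT
  set D : ℝ := (2 * κ / c) * (κ * (B * ℓ F) + ‖F‖) with hD
  have hD0 : 0 ≤ D := by positivity
  have key : ∀ ψ, ∃ a : ℝ, ∀ n : ℕ, ‖(T ^ n) ψ - (lam ^ n * a) • F‖ ≤ D * (θ * lam) ^ n * ‖ψ‖ := by
    intro ψ
    set b : ℝ := κ / c * ‖ψ‖ with hb
    have hb0 : 0 ≤ b := by positivity
    have hbc : b * c = κ * ‖ψ‖ := by rw [hb]; field_simp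
    have h1 : ψ - (-b) • F ∈ K := by
      have := K.add_mem (hK.add_solid ψ) (hK.smul_mem hb0 hFc)
      convert! this using 1
      rw [smul_sub, smul_smul, hbc, neg_smul]; abel
    have h2 : b • F - ψ ∈ K := by
      have := K.add_mem (hK.solid ψ) (hK.smul_mem hb0 hFc)
      convert! this using 1
      rw [smul_sub, smul_smul, hbc]; abel
    obtain ⟨s, t, hsm, htm, hs0, ht0, hdiff, hs, ht⟩ :=
      hθ F ψ (-b) b hFK hFB (by linarith) h1 h2
    have hle : ∀ m n, s m ≤ t n := fun m n => by
      have h3 := hdiff (max m n)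
      have h4 : 0 ≤ θ ^ max m n * (b - -b) := mul_nonneg (by positivity) (by linarith)
      have h5 := hsm (le_max_left m n)
      have h6 := htm (le_max_right m n)
      linarith
    have hbdd : BddAbove (Set.range s) := ⟨t 0, by rintro _ ⟨m, rfl⟩; exact hle m 0⟩
    refine ⟨⨆ n, s n, fun n => ?_⟩
    set a := ⨆ n, s n
    have ha1 : s n ≤ a := le_ciSup hbdd n
    have ha2 : a ≤ t n := ciSup_le fun m => hle m n
    have hts : 0 ≤ t n - s n := by linarith
    have hpow : 0 < lam ^ n := by positivity
    have hsn := hs n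
    have htn := ht n
    rw [IsSolidNormal.pow_eigen hF] at hsn htn
    have h3 : ‖(T ^ n) ψ - s n • lam ^ n • F‖ ≤ κ * ((t n - s n) * lam ^ n * (B * ℓ F)) := by
      refine hK.normal _ hsn _ ?_
      convert! K.add_mem htn (hK.smul_mem (mul_nonneg hts hpow.le) hFB) using 1
      module
    have h4 : ‖((a - s n) * lam ^ n) • F‖ ≤ (t n - s n) * lam ^ n * ‖F‖ := by
      rw [norm_smul, Real.norm_of_nonneg (mul_nonneg (by linarith) hpow.le)]
      gcongr
    calc ‖(T ^ n) ψ - (lam ^ n * a) • F‖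
        = ‖((T ^ n) ψ - s n • lam ^ n • F) - ((a - s n) * lam ^ n) • F‖ := by
          congr 1; module
      _ ≤ κ * ((t n - s n) * lam ^ n * (B * ℓ F)) + (t n - s n) * lam ^ n * ‖F‖ :=
          (norm_sub_le _ _).trans (add_le_add h3 h4)
      _ = (t n - s n) * lam ^ n * (κ * (B * ℓ F) + ‖F‖) := by ring
      _ = _ := by rw [hdiff, hD, mul_pow, hb]; ring
  choose Λ hΛ using key
  have hlim : ∀ ψ, Filter.Tendsto (fun n : ℕ => (lam ^ n)⁻¹ • (T ^ n) ψ) Filter.atTop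
      (nhds (Λ ψ • F)) := by
    intro ψ
    rw [tendsto_iff_norm_sub_tendsto_zero]
    have h0 : Filter.Tendsto (fun n : ℕ => D * ‖ψ‖ * θ ^ n) Filter.atTop (nhds 0) := by
      simpa using (tendsto_pow_atTop_nhds_zero_of_lt_one hθ0.le hθ1).const_mul (D * ‖ψ‖)
    refine squeeze_zero (fun _ => norm_nonneg _) (fun n => ?_) h0
    have hpow : 0 < lam ^ n := by positivity
    have h1 : (lam ^ n)⁻¹ • (T ^ n) ψ - Λ ψ • F =
        (lam ^ n)⁻¹ • ((T ^ n) ψ - (lam ^ n * Λ ψ) • F) := by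
      rw [smul_sub, smul_smul, inv_mul_cancel_left₀ hpow.ne']
    rw [h1, norm_smul, norm_inv, Real.norm_of_nonneg hpow.le, inv_mul_le_iff₀ hpow]
    refine (hΛ ψ n).trans_eq ?_
    rw [mul_pow]; ring
  have huniq : ∀ ψ a, Filter.Tendsto (fun n : ℕ => (lam ^ n)⁻¹ • (T ^ n) ψ) Filter.atTop
      (nhds (a • F)) → Λ ψ = a := fun ψ a h =>
    smul_left_injective ℝ hF0 (tendsto_nhds_unique (hlim ψ) h)
  let Λ' : E →ₗ[ℝ] ℝ :=
    { toFun := Λ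
      map_add' := fun ψ χ => huniq _ _ (by
        rw [add_smul]
        refine ((hlim ψ).add (hlim χ)).congr fun n => ?_
        rw [map_add, smul_add])
      map_smul' := fun a ψ => huniq _ _ (by
        rw [RingHom.id_apply, smul_assoc]
        refine ((hlim ψ).const_smul a).congr fun n => ?_
        rw [map_smul, smul_comm]) }
  refine ⟨Λ'.mkContinuous ((1 + D) / ‖F‖) fun ψ => ?_, θ, D, hθ0, hθ1, hD0,
    fun n ψ => hΛ ψ n, hlim⟩
  have h0 := hΛ ψ 0
  simp only [pow_zero, one_mul, mul_one, one_apply_eq_self] at h0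
  have h1 : ‖Λ ψ • F‖ ≤ (1 + D) * ‖ψ‖ := by
    calc ‖Λ ψ • F‖ = ‖ψ - (ψ - Λ ψ • F)‖ := by rw [sub_sub_cancel]
      _ ≤ ‖ψ‖ + D * ‖ψ‖ := (norm_sub_le _ _).trans (add_le_add le_rfl h0)
      _ = _ := by ring
  rw [norm_smul] at h1
  change ‖Λ ψ‖ ≤ _
  rw [div_mul_eq_mul_div, le_div_iff₀ (norm_pos_iff.2 hF0)]
  exact h1

end IsPrimitiveOn

end Cone

/-! ### Simple and isolated eigenvalues -/

/-- A one-dimensional eigenspace that is not annihilated by an eigenfunctional for the same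
eigenvalue is the whole generalized eigenspace: `(f - lam) v = c F` gives `0 = c Λ F`. -/
theorem maxGenEigenspace_eq_span {k V : Type*} [Field k] [AddCommGroup V] [Module k V]
    (f : Module.End k V) (Λ : V →ₗ[k] k) {lam : k} {F : V} (hF : f F = lam • F)
    (hΛ : ∀ v, Λ (f v) = lam * Λ v) (hΛF : Λ F ≠ 0)
    (hsimple : ∀ v, f v = lam • v → v ∈ Submodule.span k {F}) :
    f.maxGenEigenspace lam = Submodule.span k {F} := by
  apply le_antisymm
  · intro v hv
    obtain ⟨n, hn⟩ := (Module.End.mem_maxGenEigenspace f lam v).1 hv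
    clear hv
    induction n generalizing v with
    | zero =>
      have : v = 0 := by simpa using hn
      rw [this]; exact Submodule.zero_mem _
    | succ n ih =>
      rw [pow_succ] at hn
      have h1 := ih hn
      obtain ⟨c, hc⟩ := Submodule.mem_span_singleton.1 h1
      have h2 : (f - lam • (1 : Module.End k V)) v = f v - lam • v := rfl
      rw [h2] at hc
      have h3 := congrArg Λ hc
      rw [map_sub, map_smul, map_smul, hΛ, smul_eq_mul, smul_eq_mul, sub_self] at h3
      have h4 : c = 0 := (mul_eq_zero.1 h3).resolve_right hΛF
      rw [h4, zero_smul] at hc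
      exact hsimple v (sub_eq_zero.1 hc.symm)
  · rw [Submodule.span_le, Set.singleton_subset_iff]
    refine (Module.End.mem_maxGenEigenspace f lam F).2 ⟨1, ?_⟩
    rw [pow_one]
    exact sub_eq_zero.2 hF

section Spectrum

variable {R : Type*} [NormedRing R] [NormedAlgebra ℂ R] [CompleteSpace R]

theorem norm_le_of_mem_spectrum_of_norm_pow_le {a : R} {C r : ℝ} (hr : 0 ≤ r)
    (h : ∀ n, ‖a ^ n‖ ≤ C * r ^ n) {z : ℂ} (hz : z ∈ spectrum ℂ a) : ‖z‖ ≤ r := by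
  have h1 : ∀ n, ‖z‖ ^ n ≤ (C * ‖(1 : R)‖) * r ^ n := fun n => by
    rw [← norm_pow]
    refine (spectrum.norm_le_norm_mul_of_mem (spectrum.pow_mem_pow a n hz)).trans ?_
    calc ‖a ^ n‖ * ‖(1 : R)‖ ≤ C * r ^ n * ‖(1 : R)‖ := by gcongr; exact h n
      _ = _ := by ring
  by_contra! hlt
  rcases hr.eq_or_lt with rfl | hr
  · have := h1 1
    simp only [pow_one, mul_zero] at this
    exact absurd hlt this.not_gt
  · have h2 : 1 < ‖z‖ / r := (one_lt_div hr).2 hlt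
    obtain ⟨n, hn⟩ := pow_unbounded_of_one_lt (C * ‖(1 : R)‖) h2
    rw [div_pow, lt_div_iff₀ (by positivity)] at hn
    exact absurd (h1 n) hn.not_ge

/-- If `a ^ n` is approximated by `lam ^ n • p` up to `O (r ^ n)`, for an idempotent `p` with
`a * p = p * a = lam • p`, then the spectrum of `a` without `lam` lies in the disc of radius `r`. -/
theorem norm_le_of_mem_spectrum_of_ne {a p : R} {lam : ℂ} {C r : ℝ} (hr : 0 ≤ r)
    (hpp : p * p = p) (hap : a * p = lam • p) (hpa : p * a = lam • p)
    (h : ∀ n, ‖a ^ n - lam ^ n • p‖ ≤ C * r ^ n) {z : ℂ} (hz : z ∈ spectrum ℂ a)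
    (hne : z ≠ lam) : ‖z‖ ≤ r := by
  by_contra! hlt
  have hz0 : z ≠ 0 := norm_pos_iff.1 (hr.trans_lt hlt)
  have hq : ∀ n, (a - lam • p) ^ (n + 1) = a ^ (n + 1) - lam ^ (n + 1) • p := by
    intro n
    induction n with
    | zero => simp
    | succ n ih =>
      have h1 : a ^ (n + 1) * p = lam ^ (n + 1) • p := by
        clear ih
        induction n with
        | zero => simpa using hap
        | succ n ih => rw [pow_succ', mul_assoc, ih, mul_smul_comm, hap, smul_smul, ← pow_succ]
      rw [pow_succ, ih, mul_sub, sub_mul, sub_mul, ← pow_succ, mul_smul_comm, h1, smul_mul_assoc,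
        hpa, smul_mul_smul_comm, hpp, smul_smul, smul_smul, ← pow_succ, ← pow_succ']
      abel
  have hqbound : ∀ n, ‖(a - lam • p) ^ n‖ ≤ (max C ‖(1 : R)‖) * r ^ n := by
    intro n
    cases n with
    | zero => simp
    | succ n =>
      rw [hq]
      exact (h _).trans (mul_le_mul_of_nonneg_right (le_max_left _ _) (by positivity))
  -- `z - a = (z - (a - lam p)) (1 - (lam / z) p)`, and both factors are invertible
  have hzq : IsUnit (algebraMap ℂ R z - (a - lam • p)) := by
    by_contra hnot
    exact absurd (norm_le_of_mem_spectrum_of_norm_pow_le hr hqbound hnot) hlt.not_ge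
  set s : ℂ := lam / z with hs
  have hs1 : 1 - s ≠ 0 := by
    rw [hs, sub_ne_zero, ne_comm, Ne, div_eq_one_iff_eq hz0]
    exact fun h => hne h.symm
  have hunit : IsUnit (1 - s • p) := by
    have hst : s / (1 - s) - s - s * (s / (1 - s)) = 0 := by field_simp; ring
    have h1 : (1 - s • p) * (1 + (s / (1 - s)) • p) = 1 := by
      have : (1 - s • p) * (1 + (s / (1 - s)) • p) =
          1 + (s / (1 - s) - s - s * (s / (1 - s))) • p := by
        rw [sub_mul, one_mul, mul_add, mul_one, smul_mul_smul_comm, hpp]; module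
      rw [this, hst, zero_smul, add_zero]
    have h2 : (1 + (s / (1 - s)) • p) * (1 - s • p) = 1 := by
      have : (1 + (s / (1 - s)) • p) * (1 - s • p) =
          1 + (s / (1 - s) - s - s * (s / (1 - s))) • p := by
        rw [add_mul, one_mul, mul_sub, mul_one, smul_mul_smul_comm, hpp]; module
      rw [this, hst, zero_smul, add_zero]
    exact ⟨⟨_, _, h1, h2⟩, rfl⟩
  have hprod : algebraMap ℂ R z - a = (algebraMap ℂ R z - (a - lam • p)) * (1 - s • p) := by
    have hzs : z * s = lam := by rw [hs]; field_simp
    rw [Algebra.algebraMap_eq_smul_one, mul_sub, mul_one, sub_mul, sub_mul, smul_mul_smul_comm,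
      one_mul, hzs, smul_mul_smul_comm, hpp, mul_smul_comm, hap, smul_smul, mul_comm s lam,
      sub_self, sub_zero]
    abel
  refine hz (show IsUnit (algebraMap ℂ R z - a) from ?_)
  rw [hprod]
  exact hzq.mul hunit

end Spectrum

/-! ### Geometry of the shift space -/

theorem exists_pos_le_of_forall_lt {f : ℕ → ℝ} (hf : ∀ k, 0 < f k) (N : ℕ) :
    ∃ ε, 0 < ε ∧ ∀ k < N, ε ≤ f k := by
  induction N with
  | zero => exact ⟨1, one_pos, fun k hk => absurd hk (Nat.not_lt_zero k)⟩
  | succ N ih =>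
    obtain ⟨ε, hε, h⟩ := ih
    refine ⟨min ε (f N), lt_min hε (hf N), fun k hk => ?_⟩
    rcases (Nat.lt_succ_iff.1 hk).lt_or_eq with hk | rfl
    · exact (min_le_left _ _).trans (h k hk)
    · exact min_le_right _ _

namespace Shift

variable {M : Alphabet} {A : Matrix ℕ ℕ ℕ}

theorem ext {x y : Shift M A} (h : ∀ n, x.1 n = y.1 n) : x = y := Subtype.ext (funext h)

@[simp] theorem cons_zero (x : Shift M A) (a : {a : ℕ // A a (x.1 0) = 1}) :
    (x.cons a).1 0 = a.1 := rfl

@[simp] theorem cons_succ (x : Shift M A) (a : {a : ℕ // A a (x.1 0) = 1}) (n : ℕ) :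
    (x.cons a).1 (n + 1) = x.1 n := rfl

@[simp] theorem shift_apply (x : Shift M A) (n : ℕ) : x.shift.1 n = x.1 (n + 1) := rfl

@[simp] theorem shift_cons (x : Shift M A) (a : {a : ℕ // A a (x.1 0) = 1}) :
    (x.cons a).shift = x := ext fun _ => rfl

theorem dist_eq (x y : Shift M A) :
    dist x y = ∑' n : ℕ, (1 / 2 : ℝ) ^ (n + 1) * |M.b (x.1 n) - M.b (y.1 n)| := rfl

theorem hasSum_half_pow : HasSum (fun n : ℕ => (1 / 2 : ℝ) ^ (n + 1)) 1 := by
  simpa [pow_succ] using hasSum_geometric_two.mul_right (1 / 2 : ℝ)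

theorem dist_le_one (x y : Shift M A) : dist x y ≤ 1 := by
  refine le_trans ?_ hasSum_half_pow.tsum_eq.le
  refine (summable_dist x y).tsum_le_tsum (fun n => ?_) hasSum_half_pow.summable
  exact mul_le_of_le_one_right (by positivity) (abs_le_one M _ _)

theorem le_dist (x y : Shift M A) (n : ℕ) :
    (1 / 2 : ℝ) ^ (n + 1) * |M.b (x.1 n) - M.b (y.1 n)| ≤ dist x y :=
  (summable_dist x y).le_tsum n fun _ _ => by positivity

theorem dist_cons (x y : Shift M A) (a : ℕ) (hx : A a (x.1 0) = 1) (hy : A a (y.1 0) = 1) :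
    dist (x.cons ⟨a, hx⟩) (y.cons ⟨a, hy⟩) = dist x y / 2 := by
  rw [dist_eq, (summable_dist _ _).tsum_eq_zero_add]
  simp only [cons_zero, cons_succ, sub_self, abs_zero, mul_zero, zero_add]
  rw [dist_eq, ← tsum_div_const]
  refine tsum_congr fun n => ?_
  rw [pow_succ _ (n + 1)]
  ring

/-- The first `N` letters of `x` and `y` agree, all letters `b k` with `k ≥ N` being identified.
These relations have finitely many classes and generate the uniformity of the shift space. -/
def Agree (N : ℕ) (x y : Shift M A) : Prop := ∀ i < N, min (x.1 i) N = min (y.1 i) N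

theorem Agree.symm {N : ℕ} {x y : Shift M A} (h : Agree N x y) : Agree N y x :=
  fun i hi => (h i hi).symm

theorem Agree.min_eq {N k i : ℕ} {x y : Shift M A} (h : Agree N x y) (hk : k ≤ N) (hi : i < N) :
    min (x.1 i) k = min (y.1 i) k := by
  have := h i hi
  omega

theorem Agree.mono {N N' : ℕ} (hN : N ≤ N') {x y : Shift M A} (h : Agree N' x y) : Agree N x y :=
  fun _ hi => h.min_eq hN (hi.trans_le hN)

theorem Agree.shift {N : ℕ} {x y : Shift M A} (h : Agree (N + 1) x y) :
    Agree N x.shift y.shift :=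
  fun i hi => h.min_eq (i := i + 1) (Nat.le_succ N) (by omega)

/-- Points that do not agree are uniformly separated, because the letters `b k` are isolated. -/
theorem exists_le_dist_of_not_agree (M : Alphabet) (A : Matrix ℕ ℕ ℕ) (N : ℕ) :
    ∃ ε, 0 < ε ∧ ε ≤ 1 ∧ ∀ x y : Shift M A, ¬ Agree N x y → ε ≤ dist x y := by
  obtain ⟨δ, hδ, hgap⟩ := exists_pos_le_of_forall_lt
    (f := fun k => M.b (k + 1) - M.b k) (fun k => sub_pos.2 (M.strictMono (Nat.lt_succ_self k))) N
  have hlt : ∀ a b : ℕ, a < b → a < N → δ ≤ |M.b a - M.b b| := by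
    intro a b hab ha
    have h1 := hgap a ha
    have h2 := M.strictMono.monotone (Nat.succ_le_of_lt hab)
    rw [abs_sub_comm]
    refine le_trans ?_ (le_abs_self _)
    simp only [Nat.succ_eq_add_one] at h2
    linarith
  refine ⟨min 1 ((1 / 2 : ℝ) ^ N * δ), by positivity, min_le_left _ _, fun x y h => ?_⟩
  refine (min_le_right _ _).trans ?_
  simp only [Agree, not_forall] at h
  obtain ⟨i, hi, hne⟩ := h
  refine le_trans ?_ (le_dist x y i)
  refine mul_le_mul (pow_le_pow_of_le_one (by norm_num) (by norm_num) hi) ?_ hδ.le (by positivity)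
  rcases lt_trichotomy (x.1 i) (y.1 i) with h | h | h
  · exact hlt _ _ h (by omega)
  · rw [h] at hne; exact absurd rfl hne
  · rw [abs_sub_comm]; exact hlt _ _ h (by omega)

theorem dist_le_of_agree {N : ℕ} {x y : Shift M A} (h : Agree N x y) :
    dist x y ≤ (1 - M.b N) + (1 / 2 : ℝ) ^ N := by
  have hb : ∀ i, M.b i ≤ 1 := fun i => (M.mem_Icc i).2
  rw [dist_eq, ← (summable_dist x y).sum_add_tsum_nat_add N]
  have hgeo := hasSum_half_pow
  refine add_le_add ?_ ?_
  · calc ∑ n ∈ Finset.range N, (1 / 2 : ℝ) ^ (n + 1) * |M.b (x.1 n) - M.b (y.1 n)|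
        ≤ ∑ n ∈ Finset.range N, (1 / 2 : ℝ) ^ (n + 1) * (1 - M.b N) := by
          refine Finset.sum_le_sum fun n hn => mul_le_mul_of_nonneg_left ?_ (by positivity)
          have h1 := h n (Finset.mem_range.1 hn)
          rcases lt_or_ge (x.1 n) N with h2 | h2
          · have h3 : x.1 n = y.1 n := by omega
            rw [h3, sub_self, abs_zero]
            exact sub_nonneg.2 (hb N)
          · have h3 : N ≤ y.1 n := by omega
            have h4 := M.strictMono.monotone h2
            have h5 := M.strictMono.monotone h3
            have h6 := hb (x.1 n)
            have h7 := hb (y.1 n)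
            rw [abs_le]
            constructor <;> linarith
      _ = (∑ n ∈ Finset.range N, (1 / 2 : ℝ) ^ (n + 1)) * (1 - M.b N) := by rw [Finset.sum_mul]
      _ ≤ 1 * (1 - M.b N) := by
          refine mul_le_mul_of_nonneg_right ?_ (sub_nonneg.2 (hb N))
          exact sum_le_hasSum _ (fun _ _ => by positivity) hgeo
      _ = 1 - M.b N := one_mul _
  · have h1 : HasSum (fun n : ℕ => (1 / 2 : ℝ) ^ (n + N + 1)) ((1 / 2) ^ N) := by
      have := hgeo.mul_left ((1 / 2 : ℝ) ^ N)
      rw [mul_one] at this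
      refine this.congr_fun ?_
      intro n
      rw [← pow_add]
      congr 1
      ring
    rw [← h1.tsum_eq]
    refine Summable.tsum_le_tsum (fun n => ?_) ?_ h1.summable
    · exact mul_le_of_le_one_right (by positivity) (abs_le_one M _ _)
    · exact (summable_nat_add_iff N).2 (summable_dist x y)

theorem tendsto_agree_bound (M : Alphabet) :
    Filter.Tendsto (fun N => (1 - M.b N) + (1 / 2 : ℝ) ^ N) Filter.atTop (nhds 0) := by
  have h1 := M.tendsto_one.const_sub 1
  have h2 := tendsto_pow_atTop_nhds_zero_of_lt_one (r := (1 / 2 : ℝ)) (by norm_num) (by norm_num)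
  simpa using h1.add h2

variable (M A) in
/-- The sets that are unions of classes of one of the relations `Agree N`. -/
def cylinders : Set (Set (Shift M A)) := {s | ∃ N, ∀ x y, Agree N x y → (x ∈ s ↔ y ∈ s)}

theorem isSetRing_cylinders : MeasureTheory.IsSetRing (cylinders M A) where
  empty_mem := ⟨0, fun _ _ _ => Iff.rfl⟩
  union_mem := by
    rintro s t ⟨N, hs⟩ ⟨N', ht⟩
    exact ⟨max N N', fun x y h => or_congr (hs x y (h.mono (le_max_left _ _)))
      (ht x y (h.mono (le_max_right _ _)))⟩
  sdiff_mem := by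
    rintro s t ⟨N, hs⟩ ⟨N', ht⟩
    exact ⟨max N N', fun x y h => and_congr (hs x y (h.mono (le_max_left _ _)))
      (not_congr (ht x y (h.mono (le_max_right _ _))))⟩

theorem univ_mem_cylinders : Set.univ ∈ cylinders M A := ⟨0, fun _ _ _ => Iff.rfl⟩

theorem preimage_shift_mem_cylinders {s : Set (Shift M A)} (hs : s ∈ cylinders M A) :
    shift ⁻¹' s ∈ cylinders M A := by
  obtain ⟨N, hs⟩ := hs
  exact ⟨N + 1, fun x y h => hs _ _ h.shift⟩

theorem setOf_lt_mem_cylinders (j k : ℕ) : {x : Shift M A | k < x.1 j} ∈ cylinders M A := by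
  refine ⟨max j k + 1, fun x y h => ?_⟩
  have := h j (by omega)
  simp only [Set.mem_ofPred_eq]
  omega

theorem isOpen_of_mem_cylinders {s : Set (Shift M A)} (hs : s ∈ cylinders M A) : IsOpen s := by
  obtain ⟨N, hs⟩ := hs
  obtain ⟨ε, hε, -, h⟩ := exists_le_dist_of_not_agree M A N
  refine Metric.isOpen_iff.2 fun x hx => ⟨ε, hε, fun y hy => ?_⟩
  by_contra hys
  have : ¬ Agree N y x := fun hxy => hys ((hs y x hxy).2 hx)
  exact absurd (h y x this) (not_le.2 hy)

theorem isClosed_of_mem_cylinders {s : Set (Shift M A)} (hs : s ∈ cylinders M A) :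
    IsClosed s := by
  rw [← isOpen_compl_iff, Set.compl_eq_univ_sdiff]
  exact isOpen_of_mem_cylinders (isSetRing_cylinders.sdiff_mem univ_mem_cylinders hs)

/-- The truncated word of length `N`, a finite invariant that determines the class of a point under
`Agree N`. -/
def code (N : ℕ) (x : Shift M A) : Fin N → Fin (N + 1) :=
  fun i => ⟨min (x.1 i) N, by omega⟩

theorem code_eq_iff {N : ℕ} {x y : Shift M A} : code N x = code N y ↔ Agree N x y := by
  constructor
  · intro h i hi
    exact congrArg Fin.val (congrFun h ⟨i, hi⟩)
  · intro h
    exact funext fun i => Fin.ext (h i i.2)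

theorem code_fiber_mem_cylinders (N : ℕ) (v : Fin N → Fin (N + 1)) :
    {x : Shift M A | code N x = v} ∈ cylinders M A :=
  ⟨N, fun x y h => by simp only [Set.mem_ofPred_eq, code_eq_iff.2 h]⟩

theorem borel_eq_generateFrom_cylinders :
    (inferInstance : MeasurableSpace (Shift M A)) =
      MeasurableSpace.generateFrom (cylinders M A) := by
  apply le_antisymm
  · refine MeasurableSpace.generateFrom_le fun U hU => ?_
    have hU' : U = ⋃ (q : Σ N, Fin N → Fin (N + 1)) (_ : {x | code q.1 x = q.2} ⊆ U),
        {x : Shift M A | code q.1 x = q.2} := by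
      apply Set.Subset.antisymm
      · intro x hx
        obtain ⟨ε, hε, hball⟩ := Metric.isOpen_iff.1 (show IsOpen U from hU) x hx
        obtain ⟨N, hN⟩ := ((tendsto_agree_bound M).eventually_lt_const hε).exists
        refine Set.mem_iUnion₂.2 ⟨⟨N, code N x⟩, fun y hy => hball ?_, rfl⟩
        exact (dist_le_of_agree (code_eq_iff.1 hy)).trans_lt hN
      · exact Set.iUnion₂_subset fun _ h => h
    rw [hU']
    refine MeasurableSet.iUnion fun q => MeasurableSet.iUnion fun _ => ?_
    exact MeasurableSpace.measurableSet_generateFrom (code_fiber_mem_cylinders _ _)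
  · refine MeasurableSpace.generateFrom_le fun s hs => ?_
    exact (isOpen_of_mem_cylinders hs).measurableSet

/-- A finite measure on the shift is determined by its values on cylinders. -/
theorem measure_ext {μ ν : MeasureTheory.Measure (Shift M A)} [MeasureTheory.IsFiniteMeasure μ]
    (h : ∀ s ∈ cylinders M A, μ s = ν s) : μ = ν :=
  MeasureTheory.ext_of_generate_finite _ borel_eq_generateFrom_cylinders
    isSetRing_cylinders.isSetSemiring.isPiSystem h (h _ univ_mem_cylinders)

theorem continuous_shift : Continuous (shift : Shift M A → Shift M A) := by
  refine (LipschitzWith.of_dist_le_mul (K := 2) fun x y => ?_).continuous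
  rw [dist_eq, dist_eq, (summable_dist x y).tsum_eq_zero_add, mul_add, ← tsum_mul_left]
  refine le_add_of_nonneg_of_le (by positivity) (le_of_eq (tsum_congr fun n => ?_))
  simp only [shift_apply]
  push_cast
  ring

section Compact

/-- Replacing the letters after the `N`-th one by successive chosen followers. -/
def truncate {next : ℕ → ℕ} (hnext : ∀ i, A i (next i) = 1) (N : ℕ) (x : Shift M A) :
    Shift M A :=
  ⟨fun n => next^[n - N] (x.1 (min n N)), fun n => by
    beta_reduce
    rcases lt_or_ge n N with h | h
    · have h1 : n - N = 0 := by omega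
      have h2 : n + 1 - N = 0 := by omega
      rw [h1, h2, min_eq_left h.le, min_eq_left h]
      exact x.2 n
    · rw [Nat.succ_sub h, Function.iterate_succ_apply', min_eq_right h,
        min_eq_right (h.trans n.le_succ)]
      exact hnext _⟩

theorem truncate_apply_of_le {next : ℕ → ℕ} (hnext : ∀ i, A i (next i) = 1) {N n : ℕ}
    (x : Shift M A) (h : n ≤ N) : (truncate hnext N x).1 n = x.1 n := by
  simp only [truncate, Nat.sub_eq_zero_of_le h, min_eq_left h, Function.iterate_zero, id]

theorem agree_truncate {next : ℕ → ℕ} (hnext : ∀ i, A i (next i) = 1) (N : ℕ) (x : Shift M A) :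
    Agree N (truncate hnext N x) x :=
  fun _ hi => by rw [truncate_apply_of_le hnext x hi.le]

theorem exists_truncate_apply_eq {next : ℕ → ℕ} (hnext : ∀ i, A i (next i) = 1) {N n : ℕ}
    (x : Shift M A) (h : N < n) : ∃ i, (truncate hnext N x).1 n = next i := by
  obtain ⟨k, rfl⟩ := Nat.exists_eq_add_of_lt h
  refine ⟨next^[k] (x.1 (min (N + k + 1) N)), ?_⟩
  have : N + k + 1 - N = k + 1 := by omega
  simp only [truncate, this, Function.iterate_succ_apply']

/-- The shift space need not be compact, but bounding each letter gives a compact set: it is the image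
of a closed subset of a product of finite sets. -/
theorem isCompact_setOf_le (m : ℕ → ℕ) : IsCompact {x : Shift M A | ∀ j, x.1 j ≤ m j} := by
  have hK : IsCompact {x : ℕ → ℕ | (∀ j, x j ≤ m j) ∧ ∀ n, A (x n) (x (n + 1)) = 1} := by
    have h1 : IsCompact (Set.univ.pi fun j => Set.Iic (m j)) :=
      isCompact_univ_pi fun j => (Set.finite_Iic (m j)).isCompact
    have h2 : IsClosed {x : ℕ → ℕ | ∀ n, A (x n) (x (n + 1)) = 1} := by
      have h3 : ∀ n, IsClosed {x : ℕ → ℕ | A (x n) (x (n + 1)) = 1} := fun n => by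
        have h4 : Continuous fun x : ℕ → ℕ => (x n, x (n + 1)) := by fun_prop
        exact (isClosed_discrete {q : ℕ × ℕ | A q.1 q.2 = 1}).preimage h4
      simpa only [Set.ofPred_forall] using isClosed_iInter h3
    convert! h1.inter_right h2 using 1
    ext x
    exact and_congr (by simp only [Set.mem_pi, Set.mem_univ, true_imp_iff, Set.mem_Iic]) Iff.rfl
  let Φ : {x : ℕ → ℕ // ∀ n, A (x n) (x (n + 1)) = 1} → Shift M A := fun x => x
  have hΦ : Continuous Φ := by
    refine continuous_iff_continuousAt.2 fun x => tendsto_iff_dist_tendsto_zero.2 ?_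
    have h1 : Continuous fun y => dist (Φ y) (Φ x) := by
      refine continuous_tsum (u := fun n : ℕ => (1 / 2 : ℝ) ^ (n + 1)) (fun n => ?_)
        hasSum_half_pow.summable (fun n y => ?_)
      · have h2 : Continuous fun y : {x : ℕ → ℕ // ∀ n, A (x n) (x (n + 1)) = 1} => y.1 n :=
          (continuous_apply n).comp continuous_subtype_val
        have h3 : Continuous M.b := continuous_of_discreteTopology
        exact continuous_const.mul ((h3.comp h2).sub continuous_const).abs
      · rw [Real.norm_of_nonneg (by positivity)]
        exact mul_le_of_le_one_right (by positivity) (abs_le_one M _ _)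
    simpa using h1.tendsto x
  have hS : IsCompact {x : {x : ℕ → ℕ // ∀ n, A (x n) (x (n + 1)) = 1} | ∀ j, x.1 j ≤ m j} := by
    rw [Topology.IsEmbedding.subtypeVal.isCompact_iff]
    convert! hK using 1
    ext x
    constructor
    · rintro ⟨y, hy, rfl⟩; exact ⟨hy, y.2⟩
    · rintro ⟨h1, h2⟩; exact ⟨⟨x, h2⟩, h1, rfl⟩
  convert! hS.image hΦ using 1
  ext x
  constructor
  · intro hx; exact ⟨x, hx, rfl⟩
  · rintro ⟨y, hy, rfl⟩; exact hy

end Compact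

end Shift

/-! ### Measures from positive functionals on Hölder functions -/

section Representation

open MeasureTheory Filter

variable {M : Alphabet} {A : Matrix ℕ ℕ ℕ} {α : ℝ≥0}

/-- Functions that are constant on the classes of `Agree N` are Hölder, for every exponent. -/
theorem exists_holder_of_agree (hα : 0 < α) {f : Shift M A → ℝ} {N : ℕ} {B : ℝ}
    (hf : ∀ x y, Shift.Agree N x y → f x = f y) (hB : ∀ x, ‖f x‖ ≤ B) :
    ∃ g : HolderSpace α (Shift M A) ℝ, ∀ x, g x = f x := by
  obtain ⟨ε, hε, -, hdist⟩ := Shift.exists_le_dist_of_not_agree M A N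
  refine ⟨HolderSpace.ofBounds hα f (C := 2 * B / ε ^ (α : ℝ)) hB fun x y => ?_, fun _ => rfl⟩
  have hB0 : 0 ≤ B := (norm_nonneg _).trans (hB x)
  by_cases h : Shift.Agree N x y
  · rw [hf x y h, sub_self, norm_zero]
    positivity
  · have h1 : ε ^ (α : ℝ) ≤ dist x y ^ (α : ℝ) :=
      Real.rpow_le_rpow hε.le (hdist x y h) α.coe_nonneg
    have h2 : 0 < ε ^ (α : ℝ) := by positivity
    calc ‖f x - f y‖ ≤ B + B := (norm_sub_le _ _).trans (add_le_add (hB x) (hB y))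
      _ = 2 * B / ε ^ (α : ℝ) * ε ^ (α : ℝ) := by field_simp; ring
      _ ≤ _ := by gcongr

open Classical in
/-- The indicator function of `s` as a Hölder function; the zero function if the indicator function
is not Hölder. -/
def holderIndicator (α : ℝ≥0) (s : Set (Shift M A)) : HolderSpace α (Shift M A) ℝ :=
  if h : ∃ g : HolderSpace α (Shift M A) ℝ, ∀ x, g x = s.indicator 1 x then h.choose else 0

theorem holderIndicator_apply (hα : 0 < α) {s : Set (Shift M A)} (hs : s ∈ Shift.cylinders M A)
    (x : Shift M A) : holderIndicator α s x = s.indicator 1 x := by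
  have h : ∃ g : HolderSpace α (Shift M A) ℝ, ∀ x, g x = s.indicator 1 x := by
    obtain ⟨N, hN⟩ := hs
    refine exists_holder_of_agree (N := N) (B := 1) hα (fun x y hxy => ?_) (fun x => ?_)
    · by_cases hx : x ∈ s
      · rw [Set.indicator_of_mem hx, Set.indicator_of_mem ((hN x y hxy).1 hx)]; rfl
      · rw [Set.indicator_of_notMem hx, Set.indicator_of_notMem (mt (hN x y hxy).2 hx)]
    · by_cases hx : x ∈ s <;> simp [hx]
  rw [holderIndicator, dif_pos h]
  exact h.choose_spec x

theorem HolderSpace.integrable (ψ : HolderSpace α (Shift M A) ℝ) (μ : Measure (Shift M A))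
    [IsFiniteMeasure μ] : Integrable (fun x => ψ x) μ :=
  ψ.toBCF.integrable μ

theorem integral_holderIndicator (hα : 0 < α) (μ : Measure (Shift M A))
    {s : Set (Shift M A)} (hs : s ∈ Shift.cylinders M A) :
    ∫ x, holderIndicator α s x ∂μ = μ.real s := by
  simp only [holderIndicator_apply hα hs]
  exact integral_indicator_one (Shift.isOpen_of_mem_cylinders hs).measurableSet

theorem measure_ext_of_integral (hα : 0 < α) {μ ν : Measure (Shift M A)} [IsFiniteMeasure μ]
    [IsFiniteMeasure ν] (h : ∀ ψ : HolderSpace α (Shift M A) ℝ, ∫ x, ψ x ∂μ = ∫ x, ψ x ∂ν) :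
    μ = ν := by
  refine Shift.measure_ext fun s hs => ?_
  have := h (holderIndicator α s)
  rw [integral_holderIndicator hα μ hs, integral_holderIndicator hα ν hs] at this
  rwa [measureReal_def, measureReal_def, ENNReal.toReal_eq_toReal_iff' (measure_ne_top _ _)
    (measure_ne_top _ _)] at this

/-- A functional is positive if it is nonnegative on nonnegative functions. -/
def IsPositiveFunctional (Λ : HolderSpace α (Shift M A) ℝ →L[ℝ] ℝ) : Prop :=
  ∀ ψ : HolderSpace α (Shift M A) ℝ, (∀ x, 0 ≤ ψ x) → 0 ≤ Λ ψ

theorem IsPositiveFunctional.mono {Λ : HolderSpace α (Shift M A) ℝ →L[ℝ] ℝ}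
    (hΛ : IsPositiveFunctional Λ) {ψ χ : HolderSpace α (Shift M A) ℝ} (h : ∀ x, ψ x ≤ χ x) :
    Λ ψ ≤ Λ χ := by
  have := hΛ (χ - ψ) fun x => sub_nonneg.2 (h x)
  rwa [map_sub, sub_nonneg] at this

theorem IsPositiveFunctional.abs_apply_le {Λ : HolderSpace α (Shift M A) ℝ →L[ℝ] ℝ}
    (hΛ : IsPositiveFunctional Λ) (h1 : Λ 1 = 1) {ψ : HolderSpace α (Shift M A) ℝ} {c : ℝ}
    (h : ∀ x, |ψ x| ≤ c) : |Λ ψ| ≤ c := by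
  have hc : Λ (c • 1) = c := by rw [map_smul, h1, smul_eq_mul, mul_one]
  rw [abs_le]
  constructor
  · have := hΛ.mono (ψ := (-c) • 1) (χ := ψ) fun x => by simpa using (abs_le.1 (h x)).1
    rwa [neg_smul, map_neg, hc] at this
  · have := hΛ.mono (ψ := ψ) (χ := c • 1) fun x => by simpa using (abs_le.1 (h x)).2
    rwa [hc] at this

/-- The values of a tight positive functional on cylinders are continuous at `∅`. On a compact set
of almost full mass this is the finite intersection property; a cylinder that meets the finite-level
condition `x j ≤ m j` for `j ≤ N` also meets the compact set, since words can be prolonged with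
finitely many letters. -/
theorem tendsto_functional_indicator (hα : 0 < α) {Λ : HolderSpace α (Shift M A) ℝ →L[ℝ] ℝ}
    (hΛ : IsPositiveFunctional Λ) {next : ℕ → ℕ} (hnext : ∀ i, A i (next i) = 1) {k₀ : ℕ}
    (hk₀ : ∀ i, next i ≤ k₀)
    (htight : ∀ j, Tendsto (fun k => Λ (holderIndicator α {x | k < x.1 j})) atTop (nhds 0))
    {s : ℕ → Set (Shift M A)} (hs : ∀ n, s n ∈ Shift.cylinders M A) (hanti : Antitone s)
    (hempty : ⋂ n, s n = ∅) :
    Tendsto (fun n => Λ (holderIndicator α (s n))) atTop (nhds 0) := by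
  have hnonneg : ∀ n, 0 ≤ Λ (holderIndicator α (s n)) := fun n => hΛ _ fun x => by
    rw [holderIndicator_apply hα (hs n)]
    exact Set.indicator_nonneg (fun _ _ => zero_le_one) _
  have hle : ∀ i j, i ≤ j → Λ (holderIndicator α (s j)) ≤ Λ (holderIndicator α (s i)) :=
    fun i j hij => hΛ.mono fun x => by
      rw [holderIndicator_apply hα (hs i), holderIndicator_apply hα (hs j)]
      exact Set.indicator_le_indicator_of_subset (hanti hij) (fun _ => zero_le_one) x
  suffices h : ∀ ε > 0, ∃ n, Λ (holderIndicator α (s n)) < ε by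
    rw [Metric.tendsto_atTop]
    intro ε hε
    obtain ⟨n, hn⟩ := h ε hε
    refine ⟨n, fun k hk => ?_⟩
    rw [Real.dist_eq, sub_zero, abs_of_nonneg (hnonneg k)]
    exact (hle n k hk).trans_lt hn
  intro ε hε
  by_contra! hcon
  have hm : ∀ j, ∃ k, k₀ ≤ k ∧
      Λ (holderIndicator α {x | k < x.1 j}) < ε / 2 * (1 / 2 : ℝ) ^ (j + 1) := fun j =>
    ((eventually_ge_atTop k₀).and
      ((htight j).eventually_lt_const (by positivity))).exists
  choose m hmk hm using hm
  have hKcomp := Shift.isCompact_setOf_le (M := M) (A := A) m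
  set K := {x : Shift M A | ∀ j, x.1 j ≤ m j}
  have hne : ∀ n, (s n ∩ K).Nonempty := by
    intro n
    obtain ⟨N, hN⟩ := hs n
    have hex : ∃ x ∈ s n, ∀ j ∈ Finset.range (N + 1), x.1 j ≤ m j := by
      by_contra! hno
      have h1 : Λ (holderIndicator α (s n)) ≤
          Λ (∑ j ∈ Finset.range (N + 1), holderIndicator α {x | m j < x.1 j}) := by
        refine hΛ.mono fun x => ?_
        rw [HolderSpace.sum_apply, holderIndicator_apply hα (hs n)]
        have hterm : ∀ j, 0 ≤ holderIndicator α {x : Shift M A | m j < x.1 j} x := fun j => by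
          rw [holderIndicator_apply hα (Shift.setOf_lt_mem_cylinders _ _)]
          exact Set.indicator_nonneg (fun _ _ => zero_le_one) _
        by_cases hx : x ∈ s n
        · obtain ⟨j, hj, hjx⟩ := hno x hx
          refine le_trans ?_ (Finset.single_le_sum (fun i _ => hterm i) hj)
          rw [holderIndicator_apply hα (Shift.setOf_lt_mem_cylinders _ _),
            Set.indicator_of_mem hx, Set.indicator_of_mem (by exact hjx)]
        · rw [Set.indicator_of_notMem hx]
          exact Finset.sum_nonneg fun i _ => hterm i
      have h2 : Λ (∑ j ∈ Finset.range (N + 1), holderIndicator α {x | m j < x.1 j}) ≤ ε / 2 := by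
        rw [map_sum]
        calc _ ≤ ∑ j ∈ Finset.range (N + 1), ε / 2 * (1 / 2 : ℝ) ^ (j + 1) :=
              Finset.sum_le_sum fun j _ => (hm j).le
          _ = ε / 2 * ∑ j ∈ Finset.range (N + 1), (1 / 2 : ℝ) ^ (j + 1) := by
              rw [Finset.mul_sum]
          _ ≤ ε / 2 * 1 := by
              refine mul_le_mul_of_nonneg_left ?_ (by positivity)
              exact sum_le_hasSum _ (fun _ _ => by positivity) Shift.hasSum_half_pow
          _ = ε / 2 := mul_one _
      linarith [hcon n]
    obtain ⟨x, hx, hxm⟩ := hex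
    refine ⟨Shift.truncate hnext N x, (hN _ _ (Shift.agree_truncate hnext N x)).2 hx, fun j => ?_⟩
    rcases le_or_gt j N with hj | hj
    · rw [Shift.truncate_apply_of_le hnext x hj]
      exact hxm j (Finset.mem_range.2 (Nat.lt_succ_of_le hj))
    · obtain ⟨i, hi⟩ := Shift.exists_truncate_apply_eq hnext x hj
      rw [hi]
      exact (hk₀ i).trans (hmk j)
  have hinter := IsCompact.nonempty_iInter_of_sequence_nonempty_isCompact_isClosed
    (fun n => s n ∩ K) (fun n => Set.inter_subset_inter_left _ (hanti n.le_succ)) hne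
    (hKcomp.inter_left (Shift.isClosed_of_mem_cylinders (hs 0)))
    (fun n => (Shift.isClosed_of_mem_cylinders (hs n)).inter hKcomp.isClosed)
  obtain ⟨x, hx⟩ := hinter
  have : x ∈ ⋂ n, s n := Set.mem_iInter.2 fun n => (Set.mem_iInter.1 hx n).1
  rw [hempty] at this
  exact this

/-- A tight normalized positive functional on Hölder functions is integration with respect to a
probability measure. -/
theorem exists_measure_of_functional (hα : 0 < α) {Λ : HolderSpace α (Shift M A) ℝ →L[ℝ] ℝ}
    (hΛ : IsPositiveFunctional Λ) (h1 : Λ 1 = 1) {next : ℕ → ℕ}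
    (hnext : ∀ i, A i (next i) = 1) {k₀ : ℕ} (hk₀ : ∀ i, next i ≤ k₀)
    (htight : ∀ j, Tendsto (fun k => Λ (holderIndicator α {x | k < x.1 j})) atTop (nhds 0)) :
    ∃ ρ : Measure (Shift M A), IsProbabilityMeasure ρ ∧
      ∀ ψ : HolderSpace α (Shift M A) ℝ, ∫ x, ψ x ∂ρ = Λ ψ := by
  have hring := Shift.isSetRing_cylinders (M := M) (A := A)
  have hind0 : holderIndicator α (∅ : Set (Shift M A)) = 0 := HolderSpace.ext fun x => by
    rw [holderIndicator_apply hα hring.empty_mem, Set.indicator_empty]; rfl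
  have hnonneg : ∀ s ∈ Shift.cylinders M A, 0 ≤ Λ (holderIndicator α s) := fun s hs =>
    hΛ _ fun x => by
      rw [holderIndicator_apply hα hs]
      exact Set.indicator_nonneg (fun _ _ => zero_le_one) _
  let m : AddContent ℝ≥0∞ (Shift.cylinders M A) :=
    hring.addContent_of_union (fun s => ENNReal.ofReal (Λ (holderIndicator α s)))
      (by rw [hind0, map_zero, ENNReal.ofReal_zero])
      (fun {s t} hs ht hst => by
        rw [← ENNReal.ofReal_add (hnonneg s hs) (hnonneg t ht), ← map_add]
        congr 2
        refine HolderSpace.ext fun x => ?_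
        rw [HolderSpace.add_apply, holderIndicator_apply hα hs, holderIndicator_apply hα ht,
          holderIndicator_apply hα (hring.union_mem hs ht),
          Set.indicator_union_of_disjoint hst])
  have hm : ∀ s, m s = ENNReal.ofReal (Λ (holderIndicator α s)) := fun s => rfl
  have hsub : m.IsSigmaSubadditive := by
    refine isSigmaSubadditive_of_addContent_iUnion_eq_tsum hring fun f hf hU hd => ?_
    refine addContent_iUnion_eq_sum_of_tendsto_zero hring m
      (fun s _ => by rw [hm]; exact ENNReal.ofReal_ne_top) (fun s hs hanti hempty => ?_) hf hU hd
    simp only [hm]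
    rw [← ENNReal.ofReal_zero]
    exact ENNReal.tendsto_ofReal
      (tendsto_functional_indicator hα hΛ hnext hk₀ htight hs hanti hempty)
  let ρ := m.measure hring.isSetSemiring Shift.borel_eq_generateFrom_cylinders.le hsub
  have hρ : ∀ s ∈ Shift.cylinders M A, ρ s = ENNReal.ofReal (Λ (holderIndicator α s)) :=
    fun s hs => m.measure_eq hring.isSetSemiring Shift.borel_eq_generateFrom_cylinders hsub hs
  have hprob : IsProbabilityMeasure ρ := by
    refine ⟨?_⟩
    rw [hρ _ Shift.univ_mem_cylinders]
    have : holderIndicator α (Set.univ : Set (Shift M A)) = 1 := HolderSpace.ext fun x => by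
      rw [holderIndicator_apply hα Shift.univ_mem_cylinders, Set.indicator_univ]; rfl
    rw [this, h1, ENNReal.ofReal_one]
  refine ⟨ρ, hprob, fun ψ => ?_⟩
  -- `ψ` is approximated uniformly by functions constant on the classes of `Agree N`
  have key : ∀ N : ℕ, |∫ x, ψ x ∂ρ - Λ ψ| ≤
      2 * (‖ψ‖ * ((1 - M.b N) + (1 / 2 : ℝ) ^ N) ^ (α : ℝ)) := by
    intro N
    classical
    let c : (Fin N → Fin (N + 1)) → ℝ := fun v =>
      if h : ∃ x : Shift M A, Shift.code N x = v then ψ h.choose else 0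
    let F : (Fin N → Fin (N + 1)) → Set (Shift M A) := fun v => {x | Shift.code N x = v}
    have hF : ∀ v, F v ∈ Shift.cylinders M A := Shift.code_fiber_mem_cylinders N
    let g : HolderSpace α (Shift M A) ℝ := ∑ v, c v • holderIndicator α (F v)
    have hg : ∀ x, g x = c (Shift.code N x) := by
      intro x
      rw [HolderSpace.sum_apply, Finset.sum_eq_single (Shift.code N x)]
      · rw [HolderSpace.smul_apply, holderIndicator_apply hα (hF _),
          Set.indicator_of_mem (show x ∈ F (Shift.code N x) from rfl), Pi.one_apply, mul_one]
      · intro v _ hv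
        rw [HolderSpace.smul_apply, holderIndicator_apply hα (hF _),
          Set.indicator_of_notMem (show x ∉ F v from fun h => hv (Eq.symm h)), mul_zero]
      · intro h
        exact absurd (Finset.mem_univ _) h
    have happrox : ∀ x, |(ψ - g) x| ≤ ‖ψ‖ * ((1 - M.b N) + (1 / 2 : ℝ) ^ N) ^ (α : ℝ) := by
      intro x
      have hx : ∃ y : Shift M A, Shift.code N y = Shift.code N x := ⟨x, rfl⟩
      rw [HolderSpace.sub_apply, hg]
      simp only [c]
      rw [dif_pos hx]
      refine (HolderSpace.norm_sub_apply_le ψ _ _).trans ?_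
      refine mul_le_mul_of_nonneg_left ?_ (norm_nonneg _)
      refine Real.rpow_le_rpow dist_nonneg ?_ α.coe_nonneg
      exact Shift.dist_le_of_agree (Shift.code_eq_iff.1 hx.choose_spec).symm
    have hint : ∫ x, g x ∂ρ = Λ g := by
      have h2 : ∀ v, ∫ x, (c v • holderIndicator α (F v)) x ∂ρ =
          c v * Λ (holderIndicator α (F v)) := by
        intro v
        simp only [HolderSpace.smul_apply]
        rw [integral_const_mul, integral_holderIndicator hα ρ (hF v), measureReal_def, hρ _ (hF v),
          ENNReal.toReal_ofReal (hnonneg _ (hF v))]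
      simp only [g, HolderSpace.sum_apply]
      rw [integral_finsetSum _ fun v _ => HolderSpace.integrable _ ρ, map_sum]
      refine Finset.sum_congr rfl fun v _ => ?_
      rw [h2, map_smul, smul_eq_mul]
    have h3 : ∫ x, ψ x ∂ρ - Λ ψ = ∫ x, (ψ - g) x ∂ρ - Λ (ψ - g) := by
      simp only [HolderSpace.sub_apply]
      rw [integral_sub (ψ.integrable ρ) (g.integrable ρ), map_sub, hint]
      ring
    have h4 : |∫ x, (ψ - g) x ∂ρ| ≤ ‖ψ‖ * ((1 - M.b N) + (1 / 2 : ℝ) ^ N) ^ (α : ℝ) := by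
      have := norm_integral_le_of_norm_le_const (μ := ρ) (f := fun x => (ψ - g) x)
        (Eventually.of_forall happrox)
      simpa using this
    rw [h3, two_mul]
    exact (abs_sub _ _).trans (add_le_add h4 (hΛ.abs_apply_le h1 happrox))
  have hlim : Tendsto (fun N : ℕ => 2 * (‖ψ‖ * ((1 - M.b N) + (1 / 2 : ℝ) ^ N) ^ (α : ℝ)))
      atTop (nhds 0) := by
    have h2 := ((Shift.tendsto_agree_bound M).rpow_const
      (p := (α : ℝ)) (Or.inr α.coe_nonneg))
    rw [Real.zero_rpow (NNReal.coe_ne_zero.2 hα.ne')] at h2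
    simpa using (h2.const_mul ‖ψ‖).const_mul 2
  have h0 : |∫ x, ψ x ∂ρ - Λ ψ| ≤ 0 := ge_of_tendsto' hlim key
  exact sub_eq_zero.1 (abs_nonpos_iff.1 h0)

end Representation

/-! ### The Ruelle operator -/

theorem abs_exp_sub_exp_le {a b R : ℝ} (ha : |a| ≤ R) (hb : |b| ≤ R) :
    |Real.exp a - Real.exp b| ≤ Real.exp R * |a - b| := by
  wlog h : b ≤ a generalizing a b
  · rw [abs_sub_comm, abs_sub_comm a b]
    exact this hb ha (le_of_not_ge h)
  have h1 := Real.add_one_le_exp (b - a)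
  have h2 : Real.exp b = Real.exp a * Real.exp (b - a) := by rw [← Real.exp_add]; ring_nf
  rw [abs_of_nonneg (sub_nonneg.2 (Real.exp_le_exp.2 h)), abs_of_nonneg (sub_nonneg.2 h)]
  calc Real.exp a - Real.exp b = Real.exp a * (1 - Real.exp (b - a)) := by rw [h2]; ring
    _ ≤ Real.exp a * (a - b) := mul_le_mul_of_nonneg_left (by linarith) (Real.exp_pos _).le
    _ ≤ Real.exp R * (a - b) :=
        mul_le_mul_of_nonneg_right (Real.exp_le_exp.2 ((le_abs_self a).trans ha))
          (sub_nonneg.2 h)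

section Existence

variable {M : Alphabet} {A : Matrix ℕ ℕ ℕ} {α : ℝ≥0} {𝕜 : Type*} [RCLike 𝕜]

/-- The exponential of a Hölder function is Hölder. -/
def holderExp (hα : 0 < α) (ϕ : HolderSpace α (Shift M A) ℝ) : HolderSpace α (Shift M A) ℝ :=
  HolderSpace.ofBounds hα (fun x => Real.exp (ϕ x)) (B := Real.exp ‖ϕ‖) (C := Real.exp ‖ϕ‖ * ‖ϕ‖)
    (fun x => by
      rw [Real.norm_of_nonneg (Real.exp_pos _).le]
      exact Real.exp_le_exp.2 ((le_abs_self _).trans (HolderSpace.norm_apply_le ϕ x)))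
    (fun x y => by
      refine (abs_exp_sub_exp_le (HolderSpace.norm_apply_le ϕ x)
        (HolderSpace.norm_apply_le ϕ y)).trans ?_
      rw [mul_assoc]
      exact mul_le_mul_of_nonneg_left (HolderSpace.norm_sub_apply_le ϕ x y) (Real.exp_pos _).le)

theorem min_eq_of_agree {j₀ : ℕ} {x y : Shift M A} (h : Shift.Agree (j₀ + 1) x y) :
    min (x.1 0) j₀ = min (y.1 0) j₀ :=
  h.min_eq (Nat.le_succ j₀) (Nat.succ_pos j₀)

open Classical in
/-- The summand of `∑ a, p a * ψ (a x)`, extended by zero to all letters. -/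
def transferTerm (p : ℕ → ℝ) (ψ : HolderSpace α (Shift M A) 𝕜) (x : Shift M A) (a : ℕ) : 𝕜 :=
  if h : A a (x.1 0) = 1 then ((p a : ℝ) : 𝕜) * ψ (x.cons ⟨a, h⟩) else 0

theorem norm_transferTerm_le {p : ℕ → ℝ} (hp : ∀ k, 0 < p k) (ψ : HolderSpace α (Shift M A) 𝕜)
    (x : Shift M A) (a : ℕ) : ‖transferTerm p ψ x a‖ ≤ p a * ‖ψ‖ := by
  rw [transferTerm]
  split_ifs
  · rw [norm_mul, RCLike.norm_ofReal, abs_of_pos (hp a)]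
    exact mul_le_mul_of_nonneg_left (HolderSpace.norm_apply_le _ _) (hp a).le
  · rw [norm_zero]
    exact mul_nonneg (hp a).le (norm_nonneg _)

theorem summable_transferTerm {p : ℕ → ℝ} (hp : ∀ k, 0 < p k) (hp1 : HasSum p 1)
    (ψ : HolderSpace α (Shift M A) 𝕜) (x : Shift M A) : Summable (transferTerm p ψ x) :=
  Summable.of_norm_bounded (hp1.summable.mul_right ‖ψ‖) (norm_transferTerm_le hp ψ x)

/-- The operator `ψ ↦ ∑ a, p a * ψ (a x)` preserves Hölder functions: points whose first letters
have the same predecessors have term by term close sums, and the other pairs of points are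
uniformly separated. -/
theorem exists_transfer (hα : 0 < α) {j₀ : ℕ}
    (hcol : ∀ a i j, min i j₀ = min j j₀ → A a i = A a j)
    {p : ℕ → ℝ} (hp : ∀ k, 0 < p k) (hp1 : HasSum p 1) :
    ∃ T : HolderSpace α (Shift M A) 𝕜 →L[𝕜] HolderSpace α (Shift M A) 𝕜,
      ∀ ψ x, T ψ x = ∑' a, transferTerm p ψ x a := by
  obtain ⟨ε, hε, -, hdist⟩ := Shift.exists_le_dist_of_not_agree M A (j₀ + 1)
  have hεα : 0 < ε ^ (α : ℝ) := by positivity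
  have hB : ∀ (ψ : HolderSpace α (Shift M A) 𝕜) x, ‖∑' a, transferTerm p ψ x a‖ ≤ ‖ψ‖ :=
    fun ψ x => by
      have := hp1.mul_right ‖ψ‖
      rw [one_mul] at this
      exact tsum_of_norm_bounded this (norm_transferTerm_le hp ψ x)
  have hC : ∀ (ψ : HolderSpace α (Shift M A) 𝕜) x y,
      ‖∑' a, transferTerm p ψ x a - ∑' a, transferTerm p ψ y a‖ ≤
        ((2 / ε ^ (α : ℝ) + 1) * ‖ψ‖) * dist x y ^ (α : ℝ) := fun ψ x y => by
    have hd : 0 ≤ dist x y ^ (α : ℝ) := by positivity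
    by_cases h : Shift.Agree (j₀ + 1) x y
    · rw [← (summable_transferTerm hp hp1 ψ x).tsum_sub (summable_transferTerm hp hp1 ψ y)]
      have h1 := hp1.mul_right (‖ψ‖ * dist x y ^ (α : ℝ))
      rw [one_mul] at h1
      refine (tsum_of_norm_bounded h1 fun a => ?_).trans ?_
      · by_cases hx : A a (x.1 0) = 1
        · have hy : A a (y.1 0) = 1 := (hcol a _ _ (min_eq_of_agree h)) ▸ hx
          rw [transferTerm, transferTerm, dif_pos hx, dif_pos hy, ← mul_sub, norm_mul,
            RCLike.norm_ofReal, abs_of_pos (hp a)]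
          refine mul_le_mul_of_nonneg_left ?_ (hp a).le
          refine (HolderSpace.norm_sub_apply_le ψ _ _).trans ?_
          rw [Shift.dist_cons]
          gcongr
          exact half_le_self dist_nonneg
        · have hy : ¬ A a (y.1 0) = 1 := (hcol a _ _ (min_eq_of_agree h)) ▸ hx
          rw [transferTerm, transferTerm, dif_neg hx, dif_neg hy, sub_self, norm_zero]
          exact mul_nonneg (hp a).le (by positivity)
      · have : 0 ≤ 2 / ε ^ (α : ℝ) * (‖ψ‖ * dist x y ^ (α : ℝ)) := by positivity
        linarith
    · have h1 : ε ^ (α : ℝ) ≤ dist x y ^ (α : ℝ) :=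
        Real.rpow_le_rpow hε.le (hdist x y h) α.coe_nonneg
      calc _ ≤ ‖ψ‖ + ‖ψ‖ := (norm_sub_le _ _).trans (add_le_add (hB ψ x) (hB ψ y))
        _ = 2 / ε ^ (α : ℝ) * ‖ψ‖ * ε ^ (α : ℝ) := by field_simp; ring
        _ ≤ 2 / ε ^ (α : ℝ) * ‖ψ‖ * dist x y ^ (α : ℝ) := by gcongr
        _ ≤ _ := by
          have : 0 ≤ ‖ψ‖ * dist x y ^ (α : ℝ) := by positivity
          linarith
  refine ⟨LinearMap.mkContinuous
    { toFun := fun ψ => HolderSpace.ofBounds hα (fun x => ∑' a, transferTerm p ψ x a) (hB ψ) (hC ψ)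
      map_add' := fun ψ χ => HolderSpace.ext fun x => ?_
      map_smul' := fun c ψ => HolderSpace.ext fun x => ?_ }
    (1 + (2 / ε ^ (α : ℝ) + 1)) (fun ψ => ?_), fun ψ x => rfl⟩
  · rw [HolderSpace.add_apply, HolderSpace.ofBounds_apply, HolderSpace.ofBounds_apply,
      HolderSpace.ofBounds_apply,
      ← (summable_transferTerm hp hp1 ψ x).tsum_add (summable_transferTerm hp hp1 χ x)]
    refine tsum_congr fun a => ?_
    simp only [transferTerm]
    split_ifs
    · rw [HolderSpace.add_apply, mul_add]
    · rw [add_zero]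
  · rw [RingHom.id_apply, HolderSpace.smul_apply, HolderSpace.ofBounds_apply,
      HolderSpace.ofBounds_apply, ← tsum_mul_left]
    refine tsum_congr fun a => ?_
    simp only [transferTerm]
    split_ifs
    · rw [HolderSpace.smul_apply, mul_left_comm]
    · rw [mul_zero]
  · refine (HolderSpace.norm_le_of_bounds (norm_nonneg ψ) (by positivity) (hB ψ)
      (hC ψ)).trans_eq ?_
    ring

variable (𝕜) in
theorem exists_isRuelleOperator (hα : 0 < α) {j₀ : ℕ}
    (hcol : ∀ a i j, min i j₀ = min j j₀ → A a i = A a j)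
    {p : ℕ → ℝ} (hp : ∀ k, 0 < p k) (hp1 : HasSum p 1) {ϕ : HolderSpace α (Shift M A) ℝ}
    {φ : Shift M A → ℝ} (hφ : ∀ x, φ x = ϕ x + Real.log (p (x.1 0))) :
    ∃ L : HolderSpace α (Shift M A) 𝕜 →L[𝕜] HolderSpace α (Shift M A) 𝕜,
      IsRuelleOperator φ L := by
  obtain ⟨T, hT⟩ := exists_transfer (M := M) (𝕜 := 𝕜) hα hcol hp hp1
  refine ⟨T.comp (HolderSpace.mulReal hα (holderExp hα ϕ)), fun ψ x => ?_⟩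
  set χ := HolderSpace.mulReal hα (holderExp hα ϕ) ψ with hχ
  have h1 : HasSum (transferTerm p χ x) (T χ x) := by
    rw [hT]
    exact (summable_transferTerm hp hp1 χ x).hasSum
  have h2 : ∀ a : ℕ, a ∉ Set.range (Subtype.val : {a : ℕ // A a (x.1 0) = 1} → ℕ) →
      transferTerm p χ x a = 0 := fun a ha => by
    rw [transferTerm, dif_neg]
    exact fun h => ha ⟨⟨a, h⟩, rfl⟩
  have h3 := (Subtype.val_injective.hasSum_iff h2).2 h1
  refine h3.congr_fun fun a => ?_
  rw [Function.comp_apply, transferTerm, dif_pos a.2, hχ, HolderSpace.mulReal_apply, hφ,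
    Real.exp_add, Shift.cons_zero, Real.exp_log (hp _), RCLike.ofReal_mul]
  change _ = ((p a.1 : ℝ) : 𝕜) * (((Real.exp (ϕ (x.cons a)) : ℝ) : 𝕜) * ψ (x.cons a))
  ring

end Existence

section Ruelle

variable {M : Alphabet} {A : Matrix ℕ ℕ ℕ} {α : ℝ≥0} {φ : Shift M A → ℝ}
  {L : HolderSpace α (Shift M A) ℝ →L[ℝ] HolderSpace α (Shift M A) ℝ}

namespace IsRuelleOperator

theorem nonneg (hL : IsRuelleOperator φ L) {h : HolderSpace α (Shift M A) ℝ}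
    (hh : ∀ x, 0 ≤ h x) (x : Shift M A) : 0 ≤ L h x :=
  (hL h x).nonneg fun _ => mul_nonneg (Real.exp_pos _).le (hh _)

theorem pow_nonneg (hL : IsRuelleOperator φ L) (n : ℕ) {h : HolderSpace α (Shift M A) ℝ}
    (hh : ∀ x, 0 ≤ h x) (x : Shift M A) : 0 ≤ (L ^ n) h x := by
  induction n generalizing x with
  | zero => exact hh x
  | succ n ih => rw [pow_succ']; exact hL.nonneg ih x

theorem term_le (hL : IsRuelleOperator φ L) {h : HolderSpace α (Shift M A) ℝ}
    (hh : ∀ x, 0 ≤ h x) (x : Shift M A) (a : {a : ℕ // A a (x.1 0) = 1}) :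
    Real.exp (φ (x.cons a)) * h (x.cons a) ≤ L h x :=
  le_hasSum (hL h x) a fun _ _ => mul_nonneg (Real.exp_pos _).le (hh _)

/-- `L (f · (ψ ∘ σ)) = ψ · L f`. -/
theorem apply_mul_shift (hL : IsRuelleOperator φ L) {f g : HolderSpace α (Shift M A) ℝ}
    {ψ : Shift M A → ℝ} (hg : ∀ x, g x = f x * ψ x.shift) (x : Shift M A) :
    L g x = ψ x * L f x := by
  refine (hL g x).unique (((hL f x).mul_left (ψ x)).congr_fun fun a => ?_)
  rw [hg, Shift.shift_cons]
  simp only [RCLike.ofReal_real_eq_id, id]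
  ring

theorem toComplex (hα : 0 < α) (hL : IsRuelleOperator φ L)
    {Lc : HolderSpace α (Shift M A) ℂ →L[ℂ] HolderSpace α (Shift M A) ℂ}
    (hLc : IsRuelleOperator φ Lc) (u : HolderSpace α (Shift M A) ℝ) :
    Lc (HolderSpace.toComplex hα u) = HolderSpace.toComplex hα (L u) := by
  refine HolderSpace.ext fun x => (hLc _ x).unique ?_
  rw [HolderSpace.toComplex_apply]
  refine (Complex.hasSum_ofReal.2 (hL u x)).congr_fun fun a => ?_
  rw [HolderSpace.toComplex_apply]
  simp

end IsRuelleOperator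

/-! ### The invariant cone -/

/-- The cone of nonnegative functions `h` with `h x ≤ exp (a d(x, y) ^ α) h y` whenever the first
letters of `x` and `y` have the same predecessors (both letters `≥ j₀`, or equal). -/
def holderCone (M : Alphabet) (A : Matrix ℕ ℕ ℕ) (α : ℝ≥0) (j₀ : ℕ) (a : ℝ) :
    ConvexCone ℝ (HolderSpace α (Shift M A) ℝ) where
  carrier := {h | (∀ x, 0 ≤ h x) ∧ ∀ x y : Shift M A, min (x.1 0) j₀ = min (y.1 0) j₀ →
    h x ≤ Real.exp (a * dist x y ^ (α : ℝ)) * h y}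
  smul_mem' := by
    rintro c hc h ⟨h1, h2⟩
    refine ⟨fun x => mul_nonneg hc.le (h1 x), fun x y hxy => ?_⟩
    rw [HolderSpace.smul_apply, HolderSpace.smul_apply, mul_left_comm]
    exact mul_le_mul_of_nonneg_left (h2 x y hxy) hc.le
  add_mem' := by
    rintro h ⟨h1, h2⟩ g ⟨g1, g2⟩
    refine ⟨fun x => add_nonneg (h1 x) (g1 x), fun x y hxy => ?_⟩
    rw [HolderSpace.add_apply, HolderSpace.add_apply, mul_add]
    exact add_le_add (h2 x y hxy) (g2 x y hxy)

variable {j₀ : ℕ} {a : ℝ}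

theorem rpow_dist_le_one (x y : Shift M A) : dist x y ^ (α : ℝ) ≤ 1 :=
  Real.rpow_le_one dist_nonneg (Shift.dist_le_one x y) α.coe_nonneg

theorem exp_sub_one_le {a d : ℝ} (ha : 0 ≤ a) (hd : 0 ≤ d) (hd1 : d ≤ 1) :
    Real.exp (a * d) - 1 ≤ a * Real.exp a * d := by
  have h1 := Real.add_one_le_exp (-(a * d))
  have h2 : Real.exp (a * d) * Real.exp (-(a * d)) = 1 := by rw [← Real.exp_add]; simp
  have h3 : Real.exp (a * d) ≤ Real.exp a := Real.exp_le_exp.2 (mul_le_of_le_one_right ha hd1)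
  have h4 := Real.exp_pos (a * d)
  have h5 : 0 ≤ a * d := mul_nonneg ha hd
  calc Real.exp (a * d) - 1 ≤ Real.exp (a * d) * (a * d) := by nlinarith
    _ ≤ Real.exp a * (a * d) := mul_le_mul_of_nonneg_right h3 h5
    _ = _ := by ring

theorem holderCone_mono {a b : ℝ} (hab : a ≤ b) {h : HolderSpace α (Shift M A) ℝ}
    (hh : h ∈ holderCone M A α j₀ a) : h ∈ holderCone M A α j₀ b := by
  refine ⟨hh.1, fun x y hxy => (hh.2 x y hxy).trans ?_⟩
  refine mul_le_mul_of_nonneg_right (Real.exp_le_exp.2 ?_) (hh.1 y)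
  exact mul_le_mul_of_nonneg_right hab (by positivity)

/-- The Hölder norm of an element of the cone is controlled by its supremum. -/
theorem exists_norm_le_of_mem_holderCone (M : Alphabet) (A : Matrix ℕ ℕ ℕ) (α : ℝ≥0) (j₀ : ℕ)
    (ha : 0 ≤ a) : ∃ C, 2 ≤ C ∧ ∀ h ∈ holderCone M A α j₀ a, ∀ m, (∀ x, h x ≤ m) → 0 ≤ m →
      ‖h‖ ≤ C * m := by
  obtain ⟨ε, hε, -, hdist⟩ := Shift.exists_le_dist_of_not_agree M A (j₀ + 1)
  have hεα : 0 < ε ^ (α : ℝ) := by positivity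
  have hpos : 0 ≤ a * Real.exp a := mul_nonneg ha (Real.exp_pos a).le
  refine ⟨2 + (a * Real.exp a + 1 / ε ^ (α : ℝ)), ?_, fun h hh m hm hm0 => ?_⟩
  · have : 0 ≤ 1 / ε ^ (α : ℝ) := by positivity
    linarith
  have hle : ∀ x y : Shift M A, h x - h y ≤
      ((a * Real.exp a + 1 / ε ^ (α : ℝ)) * m) * dist x y ^ (α : ℝ) := fun x y => by
    have hd : 0 ≤ dist x y ^ (α : ℝ) := by positivity
    by_cases hxy : min (x.1 0) j₀ = min (y.1 0) j₀
    · have h1 := hh.2 x y hxy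
      have h2 := exp_sub_one_le ha hd (rpow_dist_le_one x y)
      have h3 : (Real.exp (a * dist x y ^ (α : ℝ)) - 1) * h y ≤
          (a * Real.exp a * dist x y ^ (α : ℝ)) * m :=
        mul_le_mul h2 (hm y) (hh.1 y) (mul_nonneg hpos hd)
      have h4 : 0 ≤ 1 / ε ^ (α : ℝ) * m * dist x y ^ (α : ℝ) := by positivity
      nlinarith
    · have h1 : ε ^ (α : ℝ) ≤ dist x y ^ (α : ℝ) :=
        Real.rpow_le_rpow hε.le (hdist x y fun h => hxy (min_eq_of_agree h)) α.coe_nonneg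
      have h2 : m ≤ 1 / ε ^ (α : ℝ) * m * dist x y ^ (α : ℝ) := by
        calc m = 1 / ε ^ (α : ℝ) * m * ε ^ (α : ℝ) := by field_simp
          _ ≤ _ := by gcongr
      have h3 : 0 ≤ a * Real.exp a * m * dist x y ^ (α : ℝ) := by positivity
      have h4 := hm x
      have h5 := hh.1 y
      nlinarith
  refine (HolderSpace.norm_le_of_bounds (B := m)
    (C := (a * Real.exp a + 1 / ε ^ (α : ℝ)) * m) hm0 (by positivity) (fun x => ?_)
    (fun x y => ?_)).trans ?_
  · rw [Real.norm_of_nonneg (hh.1 x)]; exact hm x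
  · rw [Real.norm_eq_abs, abs_sub_le_iff]
    exact ⟨hle x y, by rw [dist_comm]; exact hle y x⟩
  · nlinarith

theorem one_mem_holderCone (ha : 0 ≤ a) : (1 : HolderSpace α (Shift M A) ℝ) ∈
    holderCone M A α j₀ a := by
  refine ⟨fun x => zero_le_one, fun x y _ => ?_⟩
  simp only [HolderSpace.one_apply, mul_one]
  exact Real.one_le_exp (by positivity)

/-- The factor `2` leaves room: `C ‖ψ‖ - ψ ≥ ‖ψ‖` bounds the relative variation of `C ‖ψ‖ - ψ` by
`d(x, y) ^ α`. -/
theorem solid_holderCone (ha : 1 ≤ a) {C : ℝ} (hC : 2 ≤ C) (ψ : HolderSpace α (Shift M A) ℝ) :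
    (C * ‖ψ‖) • (1 : HolderSpace α (Shift M A) ℝ) - ψ ∈ holderCone M A α j₀ a := by
  have hψ := fun x => abs_le.1 (HolderSpace.norm_apply_le ψ x)
  have hn := norm_nonneg ψ
  refine ⟨fun x => ?_, fun x y _ => ?_⟩
  · have := (hψ x).2
    simp only [HolderSpace.sub_apply, HolderSpace.smul_apply, HolderSpace.one_apply, mul_one]
    nlinarith
  · simp only [HolderSpace.sub_apply, HolderSpace.smul_apply, HolderSpace.one_apply, mul_one]
    have h1 := (abs_le.1 (HolderSpace.norm_sub_apply_le ψ x y)).1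
    have h2 : ‖ψ‖ ≤ C * ‖ψ‖ - ψ y := by
      have := (hψ y).2
      nlinarith
    set d := dist x y ^ (α : ℝ)
    have hd : 0 ≤ d := by positivity
    have h3 : 1 + d ≤ Real.exp (a * d) := by
      have h4 := Real.add_one_le_exp (a * d)
      nlinarith
    have h5 : (1 + d) * (C * ‖ψ‖ - ψ y) ≤ Real.exp (a * d) * (C * ‖ψ‖ - ψ y) :=
      mul_le_mul_of_nonneg_right h3 (hn.trans h2)
    have h6 : d * ‖ψ‖ ≤ d * (C * ‖ψ‖ - ψ y) := mul_le_mul_of_nonneg_left h2 hd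
    have h7 : -(‖ψ‖ * d) ≤ ψ x - ψ y := h1
    linarith

theorem isClosed_holderCone :
    IsClosed (holderCone M A α j₀ a : Set (HolderSpace α (Shift M A) ℝ)) := by
  have hc : ∀ x : Shift M A, Continuous fun h : HolderSpace α (Shift M A) ℝ => h x :=
    fun x => (HolderSpace.eval (𝕜 := ℝ) (α := α) x).continuous
  have h1 : IsClosed {h : HolderSpace α (Shift M A) ℝ | ∀ x, 0 ≤ h x} := by
    simp only [Set.ofPred_forall]
    exact isClosed_iInter fun x => isClosed_le continuous_const (hc x)
  have h2 : IsClosed {h : HolderSpace α (Shift M A) ℝ | ∀ x y : Shift M A,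
      min (x.1 0) j₀ = min (y.1 0) j₀ → h x ≤ Real.exp (a * dist x y ^ (α : ℝ)) * h y} := by
    simp only [Set.ofPred_forall]
    exact isClosed_iInter fun x => isClosed_iInter fun y => isClosed_iInter fun _ =>
      isClosed_le (hc x) (continuous_const.mul (hc y))
  exact h1.inter h2

theorem exists_isSolidNormal_holderCone (ha : 1 ≤ a) (x₀ : Shift M A) :
    ∃ κ, IsSolidNormal (holderCone M A α j₀ a) 1 (HolderSpace.eval x₀) κ := by
  obtain ⟨C, hC, hnorm⟩ :=
    exists_norm_le_of_mem_holderCone M A α j₀ (zero_le_one.trans ha)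
  refine ⟨C, isClosed_holderCone, by linarith, one_mem_holderCone (zero_le_one.trans ha),
    solid_holderCone ha hC, fun h hh m hm => ?_, fun h hh => hh.1 x₀, rfl⟩
  have hle : ∀ x, h x ≤ m := fun x => by
    have := hm.1 x
    simp only [HolderSpace.sub_apply, HolderSpace.smul_apply, HolderSpace.one_apply,
      mul_one] at this
    linarith
  exact hnorm h hh m hle ((hh.1 x₀).trans (hle x₀))

/-- A positive operator that improves the Hölder constant of the cone and makes functions comparable
at all points has an image of finite diameter in the cone. -/
theorem exists_isPrimitiveOn (ha : 1 ≤ a) (x₀ : Shift M A)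
    {T : HolderSpace α (Shift M A) ℝ →L[ℝ] HolderSpace α (Shift M A) ℝ}
    (hpos : ∀ h : HolderSpace α (Shift M A) ℝ, (∀ x, 0 ≤ h x) → ∀ x, 0 ≤ T h x)
    (hmaps : ∀ h ∈ holderCone M A α j₀ a, T h ∈ holderCone M A α j₀ (a - 1))
    {δ₀ : ℝ} (hδ₀ : 0 < δ₀)
    (hlow : ∀ h ∈ holderCone M A α j₀ a, ∀ x y, δ₀ * h y ≤ T h x) :
    ∃ δ B, IsPrimitiveOn (holderCone M A α j₀ a) 1 (HolderSpace.eval x₀) δ B T := by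
  have ha0 : 0 < a := one_pos.trans_le ha
  obtain ⟨C, hC, hnorm⟩ := exists_norm_le_of_mem_holderCone M A α j₀ ha0.le
  have hea : 1 ≤ a * Real.exp a := by
    have := Real.one_le_exp ha0.le
    nlinarith
  set q := ‖T 1‖ / δ₀ with hq
  have hq0 : 0 ≤ q := by positivity
  refine ⟨δ₀ / (a * Real.exp a), max 1 (C * (C * q)), by positivity, le_max_left _ _,
    fun h hh => holderCone_mono (by linarith) (hmaps h hh), fun h hh => ?_, fun h hh => ?_⟩
  · have hTh := hmaps h hh
    have hε : δ₀ / (a * Real.exp a) * h x₀ * (a * Real.exp a) = δ₀ * h x₀ := by field_simp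
    have hε0 : 0 ≤ δ₀ / (a * Real.exp a) * h x₀ := mul_nonneg (by positivity) (hh.1 x₀)
    simp only [HolderSpace.eval_apply]
    set ε := δ₀ / (a * Real.exp a) * h x₀
    refine ⟨fun x => ?_, fun x y hxy => ?_⟩
    · simp only [HolderSpace.sub_apply, HolderSpace.smul_apply, HolderSpace.one_apply, mul_one]
      have := hlow h hh x x₀
      nlinarith
    · simp only [HolderSpace.sub_apply, HolderSpace.smul_apply, HolderSpace.one_apply, mul_one]
      have h1 := hTh.2 x y hxy
      have h2 := hlow h hh y x₀
      have h3 := hTh.1 y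
      have hd1 := rpow_dist_le_one (α := α) x y
      set d := dist x y ^ (α : ℝ)
      have hd : 0 ≤ d := by positivity
      have h4 := exp_sub_one_le ha0.le hd hd1
      have h5 : Real.exp ((a - 1) * d) + d ≤ Real.exp (a * d) := by
        have h6 : Real.exp (a * d) = Real.exp ((a - 1) * d) * Real.exp d := by
          rw [← Real.exp_add]; ring_nf
        have h7 : 1 ≤ Real.exp ((a - 1) * d) :=
          Real.one_le_exp (mul_nonneg (by linarith) hd)
        have h8 := Real.add_one_le_exp d
        rw [h6]
        nlinarith
      have h9 : ε * (Real.exp (a * d) - 1) ≤ d * T h y := by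
        calc ε * (Real.exp (a * d) - 1) ≤ ε * (a * Real.exp a * d) :=
              mul_le_mul_of_nonneg_left h4 hε0
          _ = d * (δ₀ * h x₀) := by rw [← hε]; ring
          _ ≤ d * T h y := mul_le_mul_of_nonneg_left h2 hd
      nlinarith
  · have hTh := holderCone_mono (b := a) (by linarith) (hmaps h hh)
    have hx₀ := hTh.1 x₀
    -- `h ≤ T h x₀ / δ₀` everywhere, hence `T h ≤ (T h x₀ / δ₀) T 1`
    have hle : ∀ x, T h x ≤ q * T h x₀ := fun x => by
      have h1 : ∀ y, 0 ≤ ((T h x₀ / δ₀) • (1 : HolderSpace α (Shift M A) ℝ) - h) y := fun y => by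
        simp only [HolderSpace.sub_apply, HolderSpace.smul_apply, HolderSpace.one_apply, mul_one]
        rw [sub_nonneg, le_div_iff₀ hδ₀, mul_comm]
        exact hlow h hh x₀ y
      have h2 := hpos _ h1 x
      rw [map_sub, map_smul, HolderSpace.sub_apply, HolderSpace.smul_apply, sub_nonneg] at h2
      have h3 : T 1 x ≤ ‖T 1‖ := (Real.le_norm_self _).trans (HolderSpace.norm_apply_le _ _)
      refine h2.trans ((mul_le_mul_of_nonneg_left h3 (by positivity)).trans_eq ?_)
      rw [hq]; ring
    have h1 := hnorm _ hTh _ hle (mul_nonneg hq0 hx₀)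
    have h2 := solid_holderCone (j₀ := j₀) ha hC (T h)
    have h3 : 0 ≤ max 1 (C * (C * q)) * T h x₀ - C * ‖T h‖ := by
      have h4 : C * (C * q) * T h x₀ ≤ max 1 (C * (C * q)) * T h x₀ :=
        mul_le_mul_of_nonneg_right (le_max_right _ _) hx₀
      have h5 : C * ‖T h‖ ≤ C * (C * (q * T h x₀)) :=
        mul_le_mul_of_nonneg_left h1 (by linarith)
      linarith
    obtain ⟨κ, hK⟩ := exists_isSolidNormal_holderCone (α := α) (j₀ := j₀) ha x₀
    have h4 := (holderCone M A α j₀ a).add_mem h2 (hK.smul_mem h3 hK.unit_mem)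
    convert! h4 using 1
    rw [HolderSpace.eval_apply]
    module

end Ruelle

/-! ### Action of the Ruelle operator on the cone -/

section Action

open MeasureTheory Filter

variable {M : Alphabet} {A : Matrix ℕ ℕ ℕ} {α : ℝ≥0} {ϕ : HolderSpace α (Shift M A) ℝ}
  {p : ℕ → ℝ} {φ : Shift M A → ℝ}
  {L : HolderSpace α (Shift M A) ℝ →L[ℝ] HolderSpace α (Shift M A) ℝ} {j₀ : ℕ}

theorem exp_potential (hp : ∀ k, 0 < p k) (hφ : ∀ x, φ x = ϕ x + Real.log (p (x.1 0)))
    (x : Shift M A) : Real.exp (φ x) = Real.exp (ϕ x) * p (x.1 0) := by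
  rw [hφ, Real.exp_add, Real.exp_log (hp _)]

/-- For suitable `a`, the Ruelle operator maps the cone with parameter `a` to the cone with
parameter `a - 1`: taking preimages divides distances by two, which outweighs the distortion of
the potential. -/
theorem exists_mapsTo_holderCone (hα : 0 < α)
    (hcol : ∀ a i j, min i j₀ = min j j₀ → A a i = A a j) (hp : ∀ k, 0 < p k)
    (hφ : ∀ x, φ x = ϕ x + Real.log (p (x.1 0))) (hL : IsRuelleOperator φ L) :
    ∃ a : ℝ, 1 ≤ a ∧ ∀ h ∈ holderCone M A α j₀ a, L h ∈ holderCone M A α j₀ (a - 1) := by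
  set θ : ℝ := (1 / 2 : ℝ) ^ (α : ℝ) with hθ
  have hθ0 : 0 < θ := by positivity
  have hθ1 : θ < 1 := Real.rpow_lt_one (by norm_num) (by norm_num) (NNReal.coe_pos.2 hα)
  have h1θ : 0 < 1 - θ := by linarith
  -- the solution of `θ (‖ϕ‖ + a) = a - 1`
  set a : ℝ := (θ * ‖ϕ‖ + 1) / (1 - θ) with ha
  have haθ : a * (1 - θ) = θ * ‖ϕ‖ + 1 := div_mul_cancel₀ _ h1θ.ne'
  have ha1 : 1 ≤ a := by
    rw [ha, le_div_iff₀ h1θ]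
    have : 0 ≤ θ * ‖ϕ‖ := by positivity
    linarith
  refine ⟨a, ha1, fun h hh => ⟨fun x => hL.nonneg hh.1 x, fun x y hxy => ?_⟩⟩
  have hA : ∀ b, A b (x.1 0) = 1 ↔ A b (y.1 0) = 1 := fun b => by rw [hcol b _ _ hxy]
  have hy := (Equiv.hasSum_iff (Equiv.subtypeEquivRight hA)).2 (hL h y)
  refine hasSum_le (fun b => ?_) (hL h x)
    (hy.mul_left (Real.exp ((a - 1) * dist x y ^ (α : ℝ))))
  obtain ⟨b, hb⟩ := b
  have hby := (hA b).1 hb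
  change Real.exp (φ (x.cons ⟨b, hb⟩)) * h (x.cons ⟨b, hb⟩) ≤
    Real.exp ((a - 1) * dist x y ^ (α : ℝ)) *
      (Real.exp (φ (y.cons ⟨b, hby⟩)) * h (y.cons ⟨b, hby⟩))
  have hd : dist (x.cons ⟨b, hb⟩) (y.cons ⟨b, hby⟩) ^ (α : ℝ) = θ * dist x y ^ (α : ℝ) := by
    rw [Shift.dist_cons, div_eq_mul_one_div, Real.mul_rpow dist_nonneg (by norm_num), mul_comm]
  have h1 := hh.2 (x.cons ⟨b, hb⟩) (y.cons ⟨b, hby⟩) rfl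
  have h2 := (abs_le.1 (HolderSpace.norm_sub_apply_le ϕ (x.cons ⟨b, hb⟩) (y.cons ⟨b, hby⟩))).2
  rw [hd] at h1 h2
  rw [exp_potential hp hφ, exp_potential hp hφ, Shift.cons_zero, Shift.cons_zero]
  set d := dist x y ^ (α : ℝ)
  have h3 : Real.exp (ϕ (x.cons ⟨b, hb⟩)) ≤
      Real.exp (‖ϕ‖ * (θ * d)) * Real.exp (ϕ (y.cons ⟨b, hby⟩)) := by
    rw [← Real.exp_add]
    exact Real.exp_le_exp.2 (by linarith)
  have h4 : Real.exp ((a - 1) * d) = Real.exp (‖ϕ‖ * (θ * d)) * Real.exp (a * (θ * d)) := by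
    rw [← Real.exp_add]
    congr 1
    linear_combination d * haθ
  calc Real.exp (ϕ (x.cons ⟨b, hb⟩)) * p b * h (x.cons ⟨b, hb⟩)
      ≤ (Real.exp (‖ϕ‖ * (θ * d)) * Real.exp (ϕ (y.cons ⟨b, hby⟩))) * p b *
        (Real.exp (a * (θ * d)) * h (y.cons ⟨b, hby⟩)) := by
        have := (hp b).le
        have := hh.1 (x.cons ⟨b, hb⟩)
        gcongr
    _ = _ := by rw [h4]; ring

theorem pow_succ_mapsTo_holderCone {a : ℝ}
    (hmaps : ∀ h ∈ holderCone M A α j₀ a, L h ∈ holderCone M A α j₀ (a - 1)) (n : ℕ) :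
    ∀ h ∈ holderCone M A α j₀ a, (L ^ (n + 1)) h ∈ holderCone M A α j₀ (a - 1) := by
  intro h hh
  rw [pow_succ']
  exact hmaps _ (IsSolidNormal.pow_mapsTo
    (fun g hg => holderCone_mono (by linarith) (hmaps g hg)) n h hh)

/-- A path of length `k` from `i` to `j` gives, for every `x` whose first letter has the
predecessors of `j`, a point of `σ⁻ᵏ x` starting with `i` that has a definite weight in the
sum `L ^ k h x`. -/
theorem exists_weight_of_matPow_pos (hA01 : ∀ i j, A i j = 0 ∨ A i j = 1)
    (hcol : ∀ a i j, min i j₀ = min j j₀ → A a i = A a j) (hp : ∀ k, 0 < p k)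
    (hφ : ∀ x, φ x = ϕ x + Real.log (p (x.1 0))) (hL : IsRuelleOperator φ L) (k i j : ℕ)
    (hk : 0 < matPow A k i j) :
    ∃ q, 0 < q ∧ ∀ x : Shift M A, min (x.1 0) j₀ = min j j₀ →
      ∃ x' : Shift M A, min (x'.1 0) j₀ = min i j₀ ∧
        ∀ h : HolderSpace α (Shift M A) ℝ, (∀ y, 0 ≤ h y) → q * h x' ≤ (L ^ k) h x := by
  induction k generalizing i with
  | zero =>
    have hij : i = j := by
      by_contra hne
      simp [matPow, hne] at hk
    subst hij
    exact ⟨1, one_pos, fun x hx => ⟨x, hx, fun h _ => by simp⟩⟩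
  | succ k ih =>
    rw [matPow, pos_iff_ne_zero, Ne, ENNReal.tsum_eq_zero] at hk
    push Not at hk
    obtain ⟨l, hl⟩ := hk
    obtain ⟨hl1, hl2⟩ := mul_ne_zero_iff.1 hl
    have hAil : A i l = 1 := (hA01 i l).resolve_left fun h => hl1 (by simp [h])
    obtain ⟨q, hq, hx⟩ := ih l (pos_iff_ne_zero.2 hl2)
    refine ⟨q * (Real.exp (-‖ϕ‖) * p i), mul_pos hq (mul_pos (Real.exp_pos _) (hp i)),
      fun x hxj => ?_⟩
    obtain ⟨y, hy, hbound⟩ := hx x hxj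
    have hAy : A i (y.1 0) = 1 := (hcol i _ _ hy).trans hAil
    refine ⟨y.cons ⟨i, hAy⟩, rfl, fun h hh => ?_⟩
    have h1 := hbound (L h) fun z => hL.nonneg hh z
    have h2 := hL.term_le hh y ⟨i, hAy⟩
    rw [exp_potential hp hφ, Shift.cons_zero] at h2
    have h3 : Real.exp (-‖ϕ‖) ≤ Real.exp (ϕ (y.cons ⟨i, hAy⟩)) :=
      Real.exp_le_exp.2 (abs_le.1 (HolderSpace.norm_apply_le ϕ _)).1
    have h4 : Real.exp (-‖ϕ‖) * p i * h (y.cons ⟨i, hAy⟩) ≤ L h y := by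
      refine le_trans ?_ h2
      have := (hp i).le
      have := hh (y.cons ⟨i, hAy⟩)
      gcongr
    rw [pow_succ, mul_assoc]
    exact (mul_le_mul_of_nonneg_left h4 hq.le).trans h1

/-- If `T` dominates a power of `L` along a path between any two letters, then it makes the
functions of the cone comparable at all points. -/
theorem exists_lower_bound (hA01 : ∀ i j, A i j = 0 ∨ A i j = 1)
    (hcol : ∀ a i j, min i j₀ = min j j₀ → A a i = A a j) (hp : ∀ k, 0 < p k)
    (hφ : ∀ x, φ x = ϕ x + Real.log (p (x.1 0))) (hL : IsRuelleOperator φ L) {a : ℝ}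
    (ha : 0 ≤ a) {T : HolderSpace α (Shift M A) ℝ →L[ℝ] HolderSpace α (Shift M A) ℝ}
    (hT : ∀ i j : Fin (j₀ + 1), ∃ k, 0 < matPow A k i j ∧
      ∀ h : HolderSpace α (Shift M A) ℝ, (∀ x, 0 ≤ h x) → ∀ x, (L ^ k) h x ≤ T h x) :
    ∃ δ, 0 < δ ∧ ∀ h ∈ holderCone M A α j₀ a, ∀ x y, δ * h y ≤ T h x := by
  choose k hk hkT using hT
  choose q hq hqx using fun i j : Fin (j₀ + 1) =>
    exists_weight_of_matPow_pos (M := M) hA01 hcol hp hφ hL (k i j) i j (hk i j)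
  obtain ⟨m, hm⟩ := Finite.exists_min fun r : Fin (j₀ + 1) × Fin (j₀ + 1) => q r.1 r.2
  refine ⟨q m.1 m.2 * Real.exp (-a), mul_pos (hq _ _) (Real.exp_pos _), fun h hh x y => ?_⟩
  let i : Fin (j₀ + 1) := ⟨min (y.1 0) j₀, by omega⟩
  let j : Fin (j₀ + 1) := ⟨min (x.1 0) j₀, by omega⟩
  obtain ⟨x', hx', hbound⟩ := hqx i j x (by simp [j])
  have h1 := hbound h hh.1
  have h2 := hkT i j h hh.1 x
  have h3 : h y ≤ Real.exp a * h x' := by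
    refine (hh.2 y x' (by rw [hx']; simp [i])).trans ?_
    refine mul_le_mul_of_nonneg_right (Real.exp_le_exp.2 ?_) (hh.1 x')
    exact mul_le_of_le_one_right ha (rpow_dist_le_one y x')
  have h4 : Real.exp (-a) * h y ≤ h x' := by
    rw [Real.exp_neg, inv_mul_le_iff₀ (Real.exp_pos a)]
    exact h3
  have h5 : q m.1 m.2 ≤ q i j := hm (i, j)
  calc q m.1 m.2 * Real.exp (-a) * h y = q m.1 m.2 * (Real.exp (-a) * h y) := mul_assoc _ _ _
    _ ≤ q i j * h x' := mul_le_mul h5 h4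
        (mul_nonneg (Real.exp_pos _).le (hh.1 y)) (hq i j).le
    _ ≤ T h x := h1.trans h2

/-- The letters of a random point are tight under an eigenfunctional of the dual operator: the
first letter because `∑ p = 1`, the next ones because `L (ψ ∘ σ) = ψ · L 1`. -/
theorem tendsto_eigenfunctional_indicator (hα : 0 < α) (hp : ∀ k, 0 < p k) (hp1 : HasSum p 1)
    (hφ : ∀ x, φ x = ϕ x + Real.log (p (x.1 0))) (hL : IsRuelleOperator φ L)
    {Λ : HolderSpace α (Shift M A) ℝ →L[ℝ] ℝ} (hΛ : IsPositiveFunctional Λ) {lam : ℝ}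
    (hlam : 0 < lam) (hΛL : ∀ ψ, Λ (L ψ) = lam * Λ ψ) (j : ℕ) :
    Tendsto (fun k => Λ (holderIndicator α {x | k < x.1 j})) atTop (nhds 0) := by
  have hmem : ∀ j k, {x : Shift M A | k < x.1 j} ∈ Shift.cylinders M A :=
    Shift.setOf_lt_mem_cylinders
  have hind : ∀ j k x, 0 ≤ holderIndicator α {x : Shift M A | k < x.1 j} x := fun j k x => by
    rw [holderIndicator_apply hα (hmem j k)]
    exact Set.indicator_nonneg (fun _ _ => zero_le_one) _
  have hΛL' : ∀ ψ, Λ ψ = lam⁻¹ * Λ (L ψ) := fun ψ => by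
    rw [hΛL, inv_mul_cancel_left₀ hlam.ne']
  induction j with
  | zero =>
    -- the mass of the letters `> k` under `p`
    have htail : Tendsto (fun k => ∑' b, p (b + (k + 1))) atTop (nhds 0) :=
      (tendsto_sum_nat_add p).comp (tendsto_add_atTop_nat 1)
    have hle : ∀ k x, L (holderIndicator α {x : Shift M A | k < x.1 0}) x ≤
        Real.exp ‖ϕ‖ * ∑' b, p (b + (k + 1)) := by
      intro k x
      have htail0 : HasSum (fun b : ℕ => if k < b then p b else 0) (∑' b, p (b + (k + 1))) := by
        refine (hasSum_nat_add_iff' (k + 1)).1 ?_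
        have h0 : ∑ b ∈ Finset.range (k + 1), (if k < b then p b else 0) = 0 :=
          Finset.sum_eq_zero fun b hb => if_neg (by have := Finset.mem_range.1 hb; omega)
        rw [h0, sub_zero]
        refine ((summable_nat_add_iff (k + 1)).2 hp1.summable).hasSum.congr_fun fun b => ?_
        exact if_pos (by omega)
      have hsum := htail0.mul_left (Real.exp ‖ϕ‖)
      refine hasSum_le_inj Subtype.val Subtype.val_injective (fun b _ => ?_) (fun b => ?_)
        (hL _ x) hsum
      · split_ifs
        · exact mul_nonneg (Real.exp_pos _).le (hp b).le
        · rw [mul_zero]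
      · rw [holderIndicator_apply hα (hmem 0 k), RCLike.ofReal_real_eq_id, id]
        by_cases hb : k < b.1
        · rw [if_pos hb, Set.indicator_of_mem (by exact hb), Pi.one_apply, mul_one,
            exp_potential hp hφ, Shift.cons_zero]
          refine mul_le_mul_of_nonneg_right (Real.exp_le_exp.2 ?_) (hp _).le
          exact (Real.le_norm_self _).trans (HolderSpace.norm_apply_le ϕ _)
        · rw [if_neg hb, Set.indicator_of_notMem (by exact hb), mul_zero, mul_zero]
    have hlim : Tendsto (fun k => lam⁻¹ * ((Real.exp ‖ϕ‖ * ∑' b, p (b + (k + 1))) * Λ 1))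
        atTop (nhds 0) := by
      simpa using ((htail.const_mul (Real.exp ‖ϕ‖)).mul_const (Λ 1)).const_mul lam⁻¹
    refine squeeze_zero (fun k => hΛ _ (hind 0 k)) (fun k => ?_) hlim
    rw [hΛL']
    refine mul_le_mul_of_nonneg_left ?_ (inv_pos.2 hlam).le
    rw [← smul_eq_mul, ← map_smul]
    refine hΛ.mono fun x => ?_
    rw [HolderSpace.smul_apply, HolderSpace.one_apply, mul_one]
    exact hle k x
  | succ j ih =>
    have hlim : Tendsto (fun k => lam⁻¹ * (‖L 1‖ * Λ (holderIndicator α {x | k < x.1 j})))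
        atTop (nhds 0) := by
      simpa using (ih.const_mul ‖L 1‖).const_mul lam⁻¹
    refine squeeze_zero (fun k => hΛ _ (hind (j + 1) k)) (fun k => ?_) hlim
    rw [hΛL']
    refine mul_le_mul_of_nonneg_left ?_ (inv_pos.2 hlam).le
    rw [← smul_eq_mul, ← map_smul]
    refine hΛ.mono fun x => ?_
    have h1 : ∀ y : Shift M A, holderIndicator α {x : Shift M A | k < x.1 (j + 1)} y =
        (1 : HolderSpace α (Shift M A) ℝ) y *
          holderIndicator α {x : Shift M A | k < x.1 j} y.shift := fun y => by
      rw [holderIndicator_apply hα (hmem _ k), holderIndicator_apply hα (hmem _ k),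
        HolderSpace.one_apply, one_mul]
      rfl
    rw [hL.apply_mul_shift h1, HolderSpace.smul_apply, mul_comm]
    exact mul_le_mul_of_nonneg_right
      ((Real.le_norm_self _).trans (HolderSpace.norm_apply_le _ x)) (hind j k x)

end Action

/-! ### Eigenfunction and eigenmeasure -/

section Perron

open MeasureTheory Filter

variable {M : Alphabet} {A : Matrix ℕ ℕ ℕ} {α : ℝ≥0}

/-- Integration with respect to a probability measure, as a functional on Hölder functions. -/
def integralFunctional (𝕜 : Type*) [RCLike 𝕜] (ρ : Measure (Shift M A)) [IsProbabilityMeasure ρ] :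
    HolderSpace α (Shift M A) 𝕜 →L[𝕜] 𝕜 :=
  have hint : ∀ ψ : HolderSpace α (Shift M A) 𝕜, Integrable (fun x => ψ x) ρ :=
    fun ψ => ψ.toBCF.integrable ρ
  LinearMap.mkContinuous
    { toFun := fun ψ => ∫ x, ψ x ∂ρ
      map_add' := fun ψ χ => integral_add (hint ψ) (hint χ)
      map_smul' := fun c ψ => integral_const_mul c _ } 1 (fun ψ => by
        have h : ‖∫ x, ψ x ∂ρ‖ ≤ ‖ψ‖ * ρ.real Set.univ :=
          norm_integral_le_of_norm_le_const (Eventually.of_forall (HolderSpace.norm_apply_le ψ))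
        rw [probReal_univ, mul_one] at h
        rw [one_mul]
        exact h)

@[simp] theorem integralFunctional_apply (𝕜 : Type*) [RCLike 𝕜] (ρ : Measure (Shift M A))
    [IsProbabilityMeasure ρ] (ψ : HolderSpace α (Shift M A) 𝕜) :
    integralFunctional 𝕜 ρ ψ = ∫ x, ψ x ∂ρ := rfl

/-- Every letter has a follower, which can be chosen in a finite set since large letters have the
same predecessors. -/
theorem exists_next (hA01 : ∀ i j, A i j = 0 ∨ A i j = 1) (hirr : IsIrreducible A) {j₀ : ℕ}
    (hcol : ∀ a i j, min i j₀ = min j j₀ → A a i = A a j) :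
    ∃ next : ℕ → ℕ, (∀ i, A i (next i) = 1) ∧ ∀ i, next i ≤ j₀ := by
  have h : ∀ i, ∃ l, A i l = 1 := fun i => by
    obtain ⟨k, hk, hpos⟩ := hirr i i
    obtain ⟨k, rfl⟩ := Nat.exists_eq_succ_of_ne_zero (Nat.one_le_iff_ne_zero.1 hk)
    rw [Nat.succ_eq_add_one, matPow, pos_iff_ne_zero, Ne, ENNReal.tsum_eq_zero] at hpos
    push Not at hpos
    obtain ⟨l, hl⟩ := hpos
    exact ⟨l, (hA01 i l).resolve_left fun h => hl (by simp [h])⟩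
  choose l hl using h
  exact ⟨fun i => min (l i) j₀, fun i => (hcol i _ _ (by simp)).trans (hl i),
    fun i => min_le_right _ _⟩

variable {ϕ : HolderSpace α (Shift M A) ℝ}
  {p : ℕ → ℝ} {φ : Shift M A → ℝ}
  {L : HolderSpace α (Shift M A) ℝ →L[ℝ] HolderSpace α (Shift M A) ℝ} {j₀ : ℕ}

theorem le_of_sub_mem_holderCone {a c : ℝ} {f : HolderSpace α (Shift M A) ℝ}
    (h : f - c • (1 : HolderSpace α (Shift M A) ℝ) ∈ holderCone M A α j₀ a) (x : Shift M A) :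
    c ≤ f x := by
  have := h.1 x
  simp only [HolderSpace.sub_apply, HolderSpace.smul_apply, HolderSpace.one_apply, mul_one] at this
  linarith

/-- For an irreducible matrix some sum `S = L + L ^ 2 + ⋯ + L ^ N` contracts the cone, even when no
power of `L` does. Since `L` commutes with `S`, the simple eigendata of `S` are eigendata of `L`. -/
theorem exists_eigendata (hA01 : ∀ i j, A i j = 0 ∨ A i j = 1)
    (hirr : IsIrreducible A) (hcol : ∀ a i j, min i j₀ = min j j₀ → A a i = A a j)
    (hp : ∀ k, 0 < p k) (hφ : ∀ x, φ x = ϕ x + Real.log (p (x.1 0)))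
    (hL : IsRuelleOperator φ L) (x₀ : Shift M A) {a : ℝ} (ha : 1 ≤ a)
    (hmaps : ∀ h ∈ holderCone M A α j₀ a, L h ∈ holderCone M A α j₀ (a - 1)) :
    ∃ (lam c : ℝ) (F : HolderSpace α (Shift M A) ℝ) (Λ : HolderSpace α (Shift M A) ℝ →L[ℝ] ℝ),
      0 < lam ∧ 0 < c ∧ F - c • (1 : HolderSpace α (Shift M A) ℝ) ∈ holderCone M A α j₀ a ∧
      L F = lam • F ∧ IsPositiveFunctional Λ ∧ Λ F = 1 ∧ (∀ ψ, Λ (L ψ) = lam * Λ ψ) ∧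
      (∀ ψ, L ψ = lam • ψ → ψ = Λ ψ • F) ∧
      ∀ Λ' : HolderSpace α (Shift M A) ℝ →L[ℝ] ℝ, (∀ ψ, Λ' (L ψ) = lam * Λ' ψ) →
        ∀ ψ, Λ' ψ = Λ' F * Λ ψ := by
  obtain ⟨κ, hK⟩ := exists_isSolidNormal_holderCone (α := α) (j₀ := j₀) ha x₀
  have hex : ∀ i j : Fin (j₀ + 1), ∃ k, 0 < matPow A (k + 1) i j := fun i j => by
    obtain ⟨k, hk, hpos⟩ := hirr i j
    exact ⟨k - 1, by rwa [Nat.sub_add_cancel hk]⟩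
  choose k hk using hex
  obtain ⟨m, hm⟩ := Finite.exists_max fun r : Fin (j₀ + 1) × Fin (j₀ + 1) => k r.1 r.2
  -- by the column condition, paths between the letters `0, …, j₀` suffice
  set N := k m.1 m.2 + 1
  set S : HolderSpace α (Shift M A) ℝ →L[ℝ] HolderSpace α (Shift M A) ℝ :=
    ∑ n ∈ Finset.range N, L ^ (n + 1) with hS
  have hSapply : ∀ ψ, S ψ = ∑ n ∈ Finset.range N, (L ^ (n + 1)) ψ := fun ψ => by
    rw [hS, _root_.sum_apply]
  have hSpos : ∀ h : HolderSpace α (Shift M A) ℝ, (∀ x, 0 ≤ h x) → ∀ x, 0 ≤ S h x := by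
    intro h hh x
    rw [hSapply, HolderSpace.sum_apply]
    exact Finset.sum_nonneg fun n _ => hL.pow_nonneg _ hh x
  have hSmaps : ∀ h ∈ holderCone M A α j₀ a, S h ∈ holderCone M A α j₀ (a - 1) := by
    intro h hh
    rw [hSapply]
    refine Finset.sum_induction _ (· ∈ holderCone M A α j₀ (a - 1))
      (fun _ _ hx hy => (holderCone M A α j₀ (a - 1)).add_mem hx hy) ?_
      (fun n _ => pow_succ_mapsTo_holderCone hmaps n h hh)
    exact ⟨fun x => le_rfl, fun x y _ => by simp⟩
  obtain ⟨δ₀, hδ₀, hlow⟩ := exists_lower_bound hA01 hcol hp hφ hL (a := a) (by linarith) (T := S)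
    (fun i j => ⟨k i j + 1, hk i j, fun h hh x => by
      rw [hSapply, HolderSpace.sum_apply]
      exact Finset.single_le_sum (f := fun n => (L ^ (n + 1)) h x)
        (fun n _ => hL.pow_nonneg _ hh x)
        (Finset.mem_range.2 (Nat.lt_succ_of_le (hm (i, j))))⟩)
  obtain ⟨δ, B, hT⟩ := exists_isPrimitiveOn ha x₀ hSpos hSmaps hδ₀ hlow
  obtain ⟨lamS, c, F, hlamS, hc, hSF, hFc⟩ := hT.exists_eigenvector hK
  obtain ⟨Λ, -, -, -, -, -, -, hlim⟩ := hT.exists_functional hK hlamS hc hSF hFc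
  have hFpos : ∀ x, 0 < F x := fun x => hc.trans_le (le_of_sub_mem_holderCone hFc x)
  have hF0 : F ≠ 0 := fun h => by
    have := hFpos x₀
    rw [h] at this
    exact lt_irrefl _ this
  -- an eigenvector of `S` for `lamS` is a multiple of `F`
  have heig : ∀ ψ, S ψ = lamS • ψ → ψ = Λ ψ • F := fun ψ hψ => by
    refine tendsto_nhds_unique (tendsto_const_nhds.congr fun n => ?_) (hlim ψ)
    rw [IsSolidNormal.pow_eigen hψ, smul_smul, inv_mul_cancel₀ (by positivity), one_smul]
  have hcommS : Commute S L :=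
    Commute.sum_left _ _ _ fun n _ => Commute.pow_left (Commute.refl L) _
  have hcomm : ∀ (n : ℕ) ψ, (S ^ n) (L ψ) = L ((S ^ n) ψ) := fun n ψ =>
    DFunLike.congr_fun (hcommS.pow_left n).eq ψ
  have hΛF : Λ F = 1 := by
    have h1 := heig F hSF
    have h2 : (Λ F - 1) • F = 0 := by rw [sub_smul, one_smul, ← h1, sub_self]
    exact sub_eq_zero.1 ((smul_eq_zero.1 h2).resolve_right hF0)
  have hLF : L F = Λ (L F) • F := by
    refine heig _ ?_
    have := hcomm 1 F
    rw [pow_one, hSF, map_smul] at this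
    exact this
  set lam := Λ (L F)
  have hpowsum : ∀ ψ, L ψ = lam • ψ → S ψ = (∑ n ∈ Finset.range N, lam ^ (n + 1)) • ψ :=
    fun ψ hψ => by
      rw [hSapply, Finset.sum_smul]
      exact Finset.sum_congr rfl fun n _ => IsSolidNormal.pow_eigen hψ (n + 1)
  have hlamS_eq : ∑ n ∈ Finset.range N, lam ^ (n + 1) = lamS := by
    have h1 := (hpowsum F hLF).symm.trans hSF
    exact smul_left_injective ℝ hF0 h1
  have hlam : 0 < lam := by
    have h1 : 0 ≤ lam * F x₀ := by
      have h2 := hL.nonneg (fun x => (hFpos x).le) x₀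
      rw [hLF] at h2
      exact h2
    rcases (nonneg_of_mul_nonneg_left h1 (hFpos x₀)).eq_or_lt with h2 | h2
    · rw [← h2] at hlamS_eq
      simp at hlamS_eq
      exact absurd hlamS_eq hlamS.ne
    · exact h2
  refine ⟨lam, c, F, Λ, hlam, hc, hFc, hLF, fun ψ hψ => ?_, hΛF, fun ψ => ?_, fun ψ hψ => ?_,
    fun Λ' hΛ' ψ => ?_⟩
  · have h1 : Tendsto (fun n : ℕ => ((lamS ^ n)⁻¹ • (S ^ n) ψ) x₀) atTop
        (nhds ((Λ ψ • F) x₀)) :=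
      ((HolderSpace.eval (𝕜 := ℝ) x₀).continuous.tendsto _).comp (hlim ψ)
    have hSn : ∀ n : ℕ, ∀ x, 0 ≤ (S ^ n) ψ x := fun n => by
      induction n with
      | zero => exact hψ
      | succ n ih => rw [pow_succ']; exact hSpos _ ih
    have h2 : 0 ≤ Λ ψ * F x₀ := ge_of_tendsto' h1 fun n =>
      mul_nonneg (by positivity) (hSn n x₀)
    exact nonneg_of_mul_nonneg_left h2 (hFpos x₀)
  · refine smul_left_injective ℝ hF0 (tendsto_nhds_unique (hlim (L ψ)) ?_)
    have h1 : Tendsto (fun n : ℕ => L ((lamS ^ n)⁻¹ • (S ^ n) ψ)) atTop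
        (nhds (L (Λ ψ • F))) := (L.continuous.tendsto _).comp (hlim ψ)
    have h2 : L (Λ ψ • F) = (lam * Λ ψ) • F := by
      rw [map_smul, hLF, smul_smul, mul_comm]
    rw [h2] at h1
    refine h1.congr fun n => ?_
    rw [map_smul, hcomm]
  · refine heig ψ ?_
    rw [hpowsum ψ hψ, hlamS_eq]
  · have hΛ'pow : ∀ (n : ℕ) χ, Λ' ((L ^ n) χ) = lam ^ n * Λ' χ := fun n => by
      induction n with
      | zero => intro χ; simp
      | succ n ih =>
        intro χ
        rw [pow_succ, pow_succ, mul_assoc, ← hΛ', ← ih]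
        rfl
    have hΛ'S : ∀ (n : ℕ) χ, Λ' ((S ^ n) χ) = lamS ^ n * Λ' χ := fun n => by
      induction n with
      | zero => intro χ; simp
      | succ n ih =>
        intro χ
        rw [pow_succ, pow_succ, mul_assoc]
        refine (ih (S χ)).trans ?_
        rw [hSapply, map_sum, ← hlamS_eq, Finset.sum_mul]
        exact congrArg _ (Finset.sum_congr rfl fun n _ => hΛ'pow _ _)
    have h1 : Tendsto (fun n : ℕ => Λ' ((lamS ^ n)⁻¹ • (S ^ n) ψ)) atTop
        (nhds (Λ' (Λ ψ • F))) := (Λ'.continuous.tendsto _).comp (hlim ψ)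
    rw [map_smul, smul_eq_mul, mul_comm] at h1
    refine tendsto_nhds_unique (tendsto_const_nhds.congr fun n => ?_) h1
    rw [map_smul, hΛ'S, smul_eq_mul, inv_mul_cancel_left₀ (by positivity)]

/-- The eigenfunctional of the dual operator is integration with respect to a probability measure
`ρ`, and every eigenfunctional for the same eigenvalue is a multiple of it. The eigenfunction is
normalized by `∫ f dρ = 1`. -/
theorem exists_eigenmeasure (hα : 0 < α) (hA01 : ∀ i j, A i j = 0 ∨ A i j = 1)
    (hirr : IsIrreducible A) (hcol : ∀ a i j, min i j₀ = min j j₀ → A a i = A a j)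
    (hp : ∀ k, 0 < p k) (hp1 : HasSum p 1) (hφ : ∀ x, φ x = ϕ x + Real.log (p (x.1 0)))
    (hL : IsRuelleOperator φ L) (x₀ : Shift M A) {a : ℝ} (ha : 1 ≤ a)
    (hmaps : ∀ h ∈ holderCone M A α j₀ a, L h ∈ holderCone M A α j₀ (a - 1)) :
    ∃ (lam c : ℝ) (f : HolderSpace α (Shift M A) ℝ) (ρ : Measure (Shift M A)),
      0 < lam ∧ 0 < c ∧ f - c • (1 : HolderSpace α (Shift M A) ℝ) ∈ holderCone M A α j₀ a ∧
      L f = lam • f ∧ IsProbabilityMeasure ρ ∧ (∀ ψ, ∫ x, L ψ x ∂ρ = lam * ∫ x, ψ x ∂ρ) ∧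
      ∫ x, f x ∂ρ = 1 ∧ (∀ ψ, L ψ = lam • ψ → ψ ∈ Submodule.span ℝ {f}) ∧
      ∀ Λ' : HolderSpace α (Shift M A) ℝ →L[ℝ] ℝ, (∀ ψ, Λ' (L ψ) = lam * Λ' ψ) →
        ∀ ψ, Λ' ψ = Λ' f * ∫ x, ψ x ∂ρ := by
  obtain ⟨lam, c, F, Λ, hlam, hc, hFc, hLF, hΛpos, hΛF, hΛL, hsimple, huniq⟩ :=
    exists_eigendata hA01 hirr hcol hp hφ hL x₀ ha hmaps
  obtain ⟨next, hnext, hnext_le⟩ := exists_next hA01 hirr hcol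
  obtain ⟨κ, hK⟩ := exists_isSolidNormal_holderCone (α := α) (j₀ := j₀) ha x₀
  have hΛ1 : 0 < Λ 1 := by
    have h1 : Λ F ≤ Λ (‖F‖ • 1) := hΛpos.mono fun x => by
      simpa using (Real.le_norm_self _).trans (HolderSpace.norm_apply_le F x)
    rw [hΛF, map_smul, smul_eq_mul] at h1
    exact pos_of_mul_pos_right (one_pos.trans_le h1) (norm_nonneg _)
  have hΛ1' : Λ 1 ≠ 0 := hΛ1.ne'
  have hpos : IsPositiveFunctional ((Λ 1)⁻¹ • Λ) := fun ψ hψ =>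
    mul_nonneg (inv_pos.2 hΛ1).le (hΛpos ψ hψ)
  have heig : ∀ ψ, ((Λ 1)⁻¹ • Λ) (L ψ) = lam * ((Λ 1)⁻¹ • Λ) ψ := fun ψ => by
    simp only [_root_.smul_apply, smul_eq_mul, hΛL]
    ring
  obtain ⟨ρ, hρ, hint⟩ := exists_measure_of_functional hα hpos
    (by simp only [_root_.smul_apply, smul_eq_mul]; exact inv_mul_cancel₀ hΛ1')
    hnext hnext_le (tendsto_eigenfunctional_indicator hα hp hp1 hφ hL hpos hlam heig)
  simp only [_root_.smul_apply, smul_eq_mul] at hint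
  refine ⟨lam, Λ 1 * c, Λ 1 • F, ρ, hlam, by positivity, ?_, ?_, hρ, fun ψ => ?_, ?_,
    fun ψ hψ => ?_, fun Λ' hΛ' ψ => ?_⟩
  · rw [mul_smul, ← smul_sub]
    exact hK.smul_mem hΛ1.le hFc
  · rw [map_smul, hLF, smul_comm]
  · rw [hint, hint, hΛL]; ring
  · rw [hint, map_smul, hΛF, smul_eq_mul, mul_one, inv_mul_cancel₀ hΛ1']
  · refine Submodule.mem_span_singleton.2 ⟨Λ ψ * (Λ 1)⁻¹, ?_⟩
    rw [smul_smul, mul_assoc, inv_mul_cancel₀ hΛ1', mul_one]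
    exact (hsimple ψ hψ).symm
  · rw [huniq Λ' hΛ' ψ, hint, map_smul, smul_eq_mul]
    field_simp

/-- In the aperiodic case a power `L ^ k` contracts the cone, and the iterates of `L` converge
exponentially fast to the eigenprojection. -/
theorem exists_exponential_convergence (hA01 : ∀ i j, A i j = 0 ∨ A i j = 1)
    (haper : IsAperiodic A) (hcol : ∀ a i j, min i j₀ = min j j₀ → A a i = A a j)
    (hp : ∀ k, 0 < p k) (hφ : ∀ x, φ x = ϕ x + Real.log (p (x.1 0)))
    (hL : IsRuelleOperator φ L) (x₀ : Shift M A) {a : ℝ} (ha : 1 ≤ a)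
    (hmaps : ∀ h ∈ holderCone M A α j₀ a, L h ∈ holderCone M A α j₀ (a - 1))
    {lam c C₀ : ℝ} {f : HolderSpace α (Shift M A) ℝ} {ρ : Measure (Shift M A)}
    [IsProbabilityMeasure ρ] (hlam : 0 < lam) (hc : 0 < c)
    (hfc : f - c • (1 : HolderSpace α (Shift M A) ℝ) ∈ holderCone M A α j₀ a)
    (hLf : L f = lam • f) (hρ : ∀ ψ, ∫ x, L ψ x ∂ρ = lam * ∫ x, ψ x ∂ρ)
    (hfρ : ∫ x, f x ∂ρ = 1) (hC₀ : 0 ≤ C₀)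
    (hbound : ∀ (n : ℕ) ψ, ‖(L ^ n) ψ‖ ≤ C₀ * lam ^ n * ‖ψ‖) :
    ∃ θ C : ℝ, 0 < θ ∧ θ < 1 ∧ 0 ≤ C ∧ ∀ (n : ℕ) (ψ : HolderSpace α (Shift M A) ℝ),
      ‖(L ^ n) ψ - (lam ^ n * ∫ x, ψ x ∂ρ) • f‖ ≤ C * (θ * lam) ^ n * ‖ψ‖ := by
  obtain ⟨k, hk, hkpos⟩ := haper
  obtain ⟨κ, hK⟩ := exists_isSolidNormal_holderCone (α := α) (j₀ := j₀) ha x₀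
  obtain ⟨δ₀, hδ₀, hlow⟩ := exists_lower_bound hA01 hcol hp hφ hL (a := a) (by linarith)
    (T := L ^ k) (fun i j => ⟨k, hkpos i j, fun h _ x => le_rfl⟩)
  have hkmaps : ∀ h ∈ holderCone M A α j₀ a, (L ^ k) h ∈ holderCone M A α j₀ (a - 1) := by
    have := pow_succ_mapsTo_holderCone hmaps (k - 1)
    rwa [Nat.sub_add_cancel hk] at this
  obtain ⟨δ, B, hT⟩ := exists_isPrimitiveOn ha x₀ (fun h hh => hL.pow_nonneg k hh) hkmaps hδ₀ hlow
  have hpowf : ∀ n : ℕ, (L ^ n) f = lam ^ n • f := IsSolidNormal.pow_eigen hLf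
  obtain ⟨Λ, θ, D, hθ0, hθ1, hD, hconv, hlim⟩ :=
    hT.exists_functional hK (pow_pos hlam k) hc (hpowf k) hfc
  have hρpow : ∀ (n : ℕ) ψ, ∫ x, (L ^ n) ψ x ∂ρ = lam ^ n * ∫ x, ψ x ∂ρ := fun n => by
    induction n with
    | zero => intro ψ; simp
    | succ n ih =>
      intro ψ
      rw [pow_succ, pow_succ, mul_assoc, ← hρ, ← ih]
      rfl
  have hΛ : ∀ ψ, Λ ψ = ∫ x, ψ x ∂ρ := fun ψ => by
    have h1 : Tendsto (fun n : ℕ => integralFunctional ℝ ρ (((lam ^ k) ^ n)⁻¹ • ((L ^ k) ^ n) ψ))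
        atTop (nhds (integralFunctional ℝ ρ (Λ ψ • f))) :=
      ((integralFunctional ℝ ρ).continuous.tendsto _).comp (hlim ψ)
    rw [map_smul, integralFunctional_apply, hfρ, smul_eq_mul, mul_one] at h1
    refine tendsto_nhds_unique h1 (tendsto_const_nhds.congr fun n => ?_)
    rw [map_smul, integralFunctional_apply, ← pow_mul, ← pow_mul, hρpow, smul_eq_mul,
      inv_mul_cancel_left₀ (by positivity)]
  have hk0 : 0 < k := hk
  -- the rate `θ` for `L ^ k` gives the rate `θ ^ (1 / k)` for `L`
  set τ : ℝ := θ ^ ((k : ℝ)⁻¹) with hτ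
  have hτ0 : 0 < τ := by positivity
  have hτ1 : τ < 1 := Real.rpow_lt_one hθ0.le hθ1 (by positivity)
  have hτk : τ ^ k = θ := Real.rpow_inv_natCast_pow hθ0.le hk0.ne'
  refine ⟨τ, C₀ * D * θ⁻¹, hτ0, hτ1, by positivity, fun m ψ => ?_⟩
  obtain ⟨n, r, hr, rfl⟩ : ∃ n r, r < k ∧ m = k * n + r :=
    ⟨m / k, m % k, Nat.mod_lt _ hk0, (Nat.div_add_mod m k).symm⟩
  have h1 := hconv n ψ
  rw [hΛ, ← pow_mul, ← pow_mul] at h1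
  have h2 : (L ^ (k * n + r)) ψ - (lam ^ (k * n + r) * ∫ x, ψ x ∂ρ) • f =
      (L ^ r) ((L ^ (k * n)) ψ - (lam ^ (k * n) * ∫ x, ψ x ∂ρ) • f) := by
    have h3 : (L ^ (k * n + r)) ψ = (L ^ r) ((L ^ (k * n)) ψ) := by
      rw [add_comm, pow_add]
      rfl
    rw [map_sub, map_smul, hpowf, smul_smul, h3]
    congr 2
    rw [pow_add]
    ring
  have h3 : θ ^ n ≤ θ⁻¹ * τ ^ (k * n + r) := by
    rw [pow_add, pow_mul, hτk, mul_left_comm]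
    refine le_mul_of_one_le_right (by positivity) ?_
    rw [le_inv_mul_iff₀ hθ0, mul_one, ← hτk]
    exact pow_le_pow_of_le_one hτ0.le hτ1.le hr.le
  rw [h2]
  calc _ ≤ C₀ * lam ^ r * (D * (θ * lam ^ k) ^ n * ‖ψ‖) :=
        (hbound r _).trans (mul_le_mul_of_nonneg_left h1 (by positivity))
    _ = C₀ * D * lam ^ (k * n + r) * ‖ψ‖ * θ ^ n := by rw [mul_pow, pow_add, pow_mul]; ring
    _ ≤ C₀ * D * lam ^ (k * n + r) * ‖ψ‖ * (θ⁻¹ * τ ^ (k * n + r)) := by gcongr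
    _ = _ := by rw [mul_pow]; ring

end Perron

/-! ### Spectrum of the complexified operator -/

section Complexification

variable {α : ℝ≥0} {Y : Type*} [MetricSpace Y]

namespace HolderSpace

theorem toComplex_smul (hα : 0 < α) (c : ℝ) (g : HolderSpace α Y ℝ) :
    toComplex hα (c • g) = (c : ℂ) • toComplex hα g :=
  ext fun x => by
    rw [smul_apply, toComplex_apply, toComplex_apply, smul_apply, Complex.ofReal_mul]

theorem toComplex_sub (hα : 0 < α) (g h : HolderSpace α Y ℝ) :
    toComplex hα (g - h) = toComplex hα g - toComplex hα h :=
  ext fun x => by simp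

/-- `Sc` is the complexification of `S`: it extends `S` from real to complex functions. -/
def IsComplexification (hα : 0 < α) (S : HolderSpace α Y ℝ →L[ℝ] HolderSpace α Y ℝ)
    (Sc : HolderSpace α Y ℂ →L[ℂ] HolderSpace α Y ℂ) : Prop :=
  ∀ u, Sc (toComplex hα u) = toComplex hα (S u)

namespace IsComplexification

variable {hα : 0 < α} {S T : HolderSpace α Y ℝ →L[ℝ] HolderSpace α Y ℝ}
  {Sc Tc : HolderSpace α Y ℂ →L[ℂ] HolderSpace α Y ℂ}

theorem apply_eq (h : IsComplexification hα S Sc) (ψ : HolderSpace α Y ℂ) :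
    Sc ψ = toComplex hα (S (re hα ψ)) + Complex.I • toComplex hα (S (im hα ψ)) := by
  conv_lhs => rw [re_add_im hα ψ, map_add, map_smul, h, h]

theorem re_apply (h : IsComplexification hα S Sc) (ψ : HolderSpace α Y ℂ) :
    re hα (Sc ψ) = S (re hα ψ) :=
  ext fun x => by rw [h.apply_eq]; simp

theorem im_apply (h : IsComplexification hα S Sc) (ψ : HolderSpace α Y ℂ) :
    im hα (Sc ψ) = S (im hα ψ) :=
  ext fun x => by rw [h.apply_eq]; simp

theorem pow (h : IsComplexification hα S Sc) (n : ℕ) : IsComplexification hα (S ^ n) (Sc ^ n) := by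
  induction n with
  | zero => intro u; rfl
  | succ n ih =>
    intro u
    rw [pow_succ, pow_succ, mul_apply_eq_comp, mul_apply_eq_comp, h, ih]

/-- Taking real or imaginary parts and embedding real functions each have norm at most `2` here,
which gives the factor `8`. -/
theorem norm_le (h : IsComplexification hα S Sc) {b : ℝ} (hb : 0 ≤ b)
    (hS : ∀ u, ‖S u‖ ≤ b * ‖u‖) : ‖Sc‖ ≤ 8 * b := by
  refine Sc.opNorm_le_bound (by positivity) fun ψ => ?_
  have key : ∀ u : HolderSpace α Y ℝ, ‖u‖ ≤ 2 * ‖ψ‖ → ‖toComplex hα (S u)‖ ≤ 4 * b * ‖ψ‖ :=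
    fun u hu => calc
      ‖toComplex hα (S u)‖ ≤ 2 * ‖S u‖ := norm_toComplex_le hα _
      _ ≤ 2 * (b * (2 * ‖ψ‖)) := by
        gcongr
        exact (hS u).trans (mul_le_mul_of_nonneg_left hu hb)
      _ = _ := by ring
  rw [h.apply_eq]
  refine (norm_add_le _ _).trans ?_
  rw [norm_smul, Complex.norm_I, one_mul]
  linarith [key _ (norm_re_le hα ψ), key _ (norm_im_le hα ψ)]

theorem mem_span_of_eigenvector (h : IsComplexification hα S Sc) {lam : ℝ}
    {f : HolderSpace α Y ℝ} (hS : ∀ ψ, S ψ = lam • ψ → ψ ∈ Submodule.span ℝ {f})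
    {ψ : HolderSpace α Y ℂ} (hψ : Sc ψ = (lam : ℂ) • ψ) :
    ψ ∈ Submodule.span ℂ {toComplex hα f} := by
  have h1 : S (re hα ψ) = lam • re hα ψ := by
    rw [← h.re_apply, hψ]
    exact ext fun x => Complex.re_ofReal_mul _ _
  have h2 : S (im hα ψ) = lam • im hα ψ := by
    rw [← h.im_apply, hψ]
    exact ext fun x => Complex.im_ofReal_mul _ _
  obtain ⟨s, hs⟩ := Submodule.mem_span_singleton.1 (hS _ h1)
  obtain ⟨t, ht⟩ := Submodule.mem_span_singleton.1 (hS _ h2)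
  refine Submodule.mem_span_singleton.2 ⟨s + Complex.I * t, ?_⟩
  rw [re_add_im hα ψ, ← hs, ← ht, toComplex_smul, toComplex_smul, smul_smul, add_smul]

end IsComplexification

end HolderSpace

end Complexification

section ComplexSpectrum

open MeasureTheory HolderSpace

variable {M : Alphabet} {A : Matrix ℕ ℕ ℕ} {α : ℝ≥0} {hα : 0 < α}
  {L : HolderSpace α (Shift M A) ℝ →L[ℝ] HolderSpace α (Shift M A) ℝ}
  {Lc : HolderSpace α (Shift M A) ℂ →L[ℂ] HolderSpace α (Shift M A) ℂ}
  {ρ : Measure (Shift M A)} [IsProbabilityMeasure ρ] {lam : ℝ} {f : HolderSpace α (Shift M A) ℝ}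

theorem integralFunctional_toComplex (hα : 0 < α) (u : HolderSpace α (Shift M A) ℝ) :
    integralFunctional ℂ ρ (toComplex hα u) = ((∫ x, u x ∂ρ : ℝ) : ℂ) := by
  simp only [integralFunctional_apply, toComplex_apply]
  exact integral_ofReal

theorem integralFunctional_complexification (h : IsComplexification hα L Lc)
    (hρ : ∀ ψ, ∫ x, L ψ x ∂ρ = lam * ∫ x, ψ x ∂ρ) (ψ : HolderSpace α (Shift M A) ℂ) :
    integralFunctional ℂ ρ (Lc ψ) = lam * integralFunctional ℂ ρ ψ := by
  conv_rhs => rw [re_add_im hα ψ]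
  rw [h.apply_eq]
  simp only [map_add, map_smul, integralFunctional_toComplex, hρ, smul_eq_mul, Complex.ofReal_mul]
  ring

theorem finrank_maxGenEigenspace_complexification (h : IsComplexification hα L Lc)
    (hLf : L f = lam • f) (hρ : ∀ ψ, ∫ x, L ψ x ∂ρ = lam * ∫ x, ψ x ∂ρ)
    (hfρ : ∫ x, f x ∂ρ = 1) (hsimple : ∀ ψ, L ψ = lam • ψ → ψ ∈ Submodule.span ℝ {f}) :
    Module.finrank ℂ (Module.End.maxGenEigenspace
      (Lc : Module.End ℂ (HolderSpace α (Shift M A) ℂ)) (lam : ℂ)) = 1 := by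
  have hΛf : integralFunctional ℂ ρ (toComplex hα f) = 1 := by
    rw [integralFunctional_toComplex, hfρ, Complex.ofReal_one]
  rw [maxGenEigenspace_eq_span (F := toComplex hα f)
    (Lc : Module.End ℂ (HolderSpace α (Shift M A) ℂ)) (integralFunctional ℂ ρ).toLinearMap
    ((h f).trans (by rw [hLf, toComplex_smul])) (integralFunctional_complexification h hρ)
    (fun h0 => one_ne_zero (hΛf.symm.trans h0)) (fun ψ hψ => h.mem_span_of_eigenvector hsimple hψ)]
  refine finrank_span_singleton fun h0 => ?_
  rw [h0, map_zero] at hΛf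
  exact zero_ne_one hΛf

theorem norm_le_of_mem_spectrum_complexification (h : IsComplexification hα L Lc) {C : ℝ}
    (hC : 0 ≤ C) (hlam : 0 ≤ lam) (hbound : ∀ (n : ℕ) ψ, ‖(L ^ n) ψ‖ ≤ C * lam ^ n * ‖ψ‖) {z : ℂ}
    (hz : z ∈ spectrum ℂ Lc) : ‖z‖ ≤ lam :=
  norm_le_of_mem_spectrum_of_norm_pow_le (C := 8 * C) hlam
    (fun n => ((h.pow n).norm_le (by positivity) (hbound n)).trans_eq (by ring)) hz

/-- Exponential convergence of the iterates of `L` to the eigenprojection bounds the spectrum of the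
complexification away from the eigenvalue. -/
theorem norm_le_of_mem_spectrum_complexification_of_ne (h : IsComplexification hα L Lc)
    (hLf : L f = lam • f) (hρ : ∀ ψ, ∫ x, L ψ x ∂ρ = lam * ∫ x, ψ x ∂ρ) (hfρ : ∫ x, f x ∂ρ = 1)
    {C r : ℝ} (hC : 0 ≤ C) (hr : 0 ≤ r) (hconv : ∀ (n : ℕ) (ψ : HolderSpace α (Shift M A) ℝ),
      ‖(L ^ n) ψ - (lam ^ n * ∫ x, ψ x ∂ρ) • f‖ ≤ C * r ^ n * ‖ψ‖)
    {z : ℂ} (hz : z ∈ spectrum ℂ Lc) (hne : z ≠ lam) : ‖z‖ ≤ r := by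
  set P : HolderSpace α (Shift M A) ℂ →L[ℂ] HolderSpace α (Shift M A) ℂ :=
    (integralFunctional ℂ ρ).smulRight (toComplex hα f) with hP
  have hPapply : ∀ ψ, P ψ = integralFunctional ℂ ρ ψ • toComplex hα f := fun ψ => rfl
  set Q : HolderSpace α (Shift M A) ℝ →L[ℝ] HolderSpace α (Shift M A) ℝ :=
    (integralFunctional ℝ ρ).smulRight f
  have hΛf : integralFunctional ℂ ρ (toComplex hα f) = 1 := by
    rw [integralFunctional_toComplex, hfρ, Complex.ofReal_one]
  refine norm_le_of_mem_spectrum_of_ne (p := P) (C := 8 * C) hr ?_ ?_ ?_ (fun n => ?_) hz hne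
  · refine ContinuousLinearMap.ext fun ψ => ?_
    rw [mul_apply_eq_comp, hPapply ψ, map_smul, hPapply (toComplex hα f), hΛf, one_smul]
  · refine ContinuousLinearMap.ext fun ψ => ?_
    rw [mul_apply_eq_comp, _root_.smul_apply, hPapply, map_smul, h, hLf, toComplex_smul,
      smul_comm]
  · refine ContinuousLinearMap.ext fun ψ => ?_
    rw [mul_apply_eq_comp, _root_.smul_apply, hPapply, hPapply,
      integralFunctional_complexification h hρ, smul_smul]
  · have hn : IsComplexification hα
        (L ^ n - lam ^ n • Q) (Lc ^ n - (lam : ℂ) ^ n • P) := by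
      intro u
      have h1 : (Lc ^ n - (lam : ℂ) ^ n • P) (toComplex hα u) =
          (Lc ^ n) (toComplex hα u) - (lam : ℂ) ^ n • P (toComplex hα u) := rfl
      have h2 : (L ^ n - lam ^ n • Q) u =
          (L ^ n) u - lam ^ n • ((∫ x, u x ∂ρ) • f) := rfl
      rw [h1, h2, h.pow n, hPapply, integralFunctional_toComplex, toComplex_sub, toComplex_smul,
        toComplex_smul, Complex.ofReal_pow]
    refine (hn.norm_le (b := C * r ^ n) (by positivity) fun u => ?_).trans_eq (by ring)
    have h2 : (L ^ n - lam ^ n • Q) u =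
        (L ^ n) u - lam ^ n • ((∫ x, u x ∂ρ) • f) := rfl
    rw [h2, smul_smul]
    exact hconv n u

end ComplexSpectrum

/-! ### The normalized operator and the invariant measure -/

section Normalized

open MeasureTheory Filter HolderSpace

theorem HolderSpace.exists_inv {α : ℝ≥0} {Y : Type*} [MetricSpace Y] (hα : 0 < α)
    {f : HolderSpace α Y ℝ} {c : ℝ} (hc : 0 < c) (hf : ∀ x, c ≤ f x) :
    ∃ g : HolderSpace α Y ℝ, ∀ x, g x = (f x)⁻¹ := by
  have hpos : ∀ x, 0 < f x := fun x => hc.trans_le (hf x)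
  refine ⟨ofBounds hα (fun x => (f x)⁻¹) (B := c⁻¹) (C := (c * c)⁻¹ * ‖f‖) (fun x => ?_)
    (fun x y => ?_), fun x => rfl⟩
  · rw [Real.norm_eq_abs, abs_of_pos (inv_pos.2 (hpos x))]
    exact inv_anti₀ hc (hf x)
  · have h1 : (f x)⁻¹ - (f y)⁻¹ = (f x * f y)⁻¹ * (f y - f x) := by
      have := (hpos x).ne'
      have := (hpos y).ne'
      field_simp
    rw [h1, norm_mul, Real.norm_eq_abs, abs_of_pos (inv_pos.2 (mul_pos (hpos x) (hpos y))),
      mul_assoc, norm_sub_rev]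
    exact mul_le_mul (inv_anti₀ (by positivity) (mul_le_mul (hf x) (hf y) hc.le (hpos x).le))
      (norm_sub_apply_le f x y) (norm_nonneg _) (by positivity)

variable {M : Alphabet} {A : Matrix ℕ ℕ ℕ} {α : ℝ≥0} {φ : Shift M A → ℝ}
  {L : HolderSpace α (Shift M A) ℝ →L[ℝ] HolderSpace α (Shift M A) ℝ} {lam : ℝ}
  {f g : HolderSpace α (Shift M A) ℝ} {ρ : Measure (Shift M A)}

/-- The operator `ψ ↦ lam⁻¹ g L (f ψ)`, to be used with `g = f⁻¹`. -/
def normalizedOperator (hα : 0 < α) (f g : HolderSpace α (Shift M A) ℝ) (lam : ℝ)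
    (L : HolderSpace α (Shift M A) ℝ →L[ℝ] HolderSpace α (Shift M A) ℝ) :
    HolderSpace α (Shift M A) ℝ →L[ℝ] HolderSpace α (Shift M A) ℝ :=
  lam⁻¹ • (mulReal hα g ∘L L ∘L mulReal hα f)

theorem normalizedOperator_apply (hα : 0 < α) (ψ : HolderSpace α (Shift M A) ℝ) (x : Shift M A) :
    normalizedOperator hα f g lam L ψ x = lam⁻¹ * (g x * L (mulReal hα f ψ) x) := rfl

theorem isRuelleOperator_normalizedOperator (hα : 0 < α) (hL : IsRuelleOperator φ L)
    (hlam : 0 < lam) (hf : ∀ x, 0 < f x) (hg : ∀ x, g x = (f x)⁻¹) :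
    IsRuelleOperator (fun x => φ x + Real.log (f x) - Real.log (f x.shift) - Real.log lam)
      (normalizedOperator hα f g lam L) := by
  intro ψ x
  rw [normalizedOperator_apply]
  refine (((hL (mulReal hα f ψ) x).mul_left (g x)).mul_left lam⁻¹).congr_fun fun a => ?_
  dsimp only
  rw [Shift.shift_cons, Real.exp_sub, Real.exp_sub, Real.exp_add, Real.exp_log (hf _),
    Real.exp_log (hf _), Real.exp_log hlam, hg, mulReal_apply]
  simp only [RCLike.ofReal_real_eq_id, id]
  rw [div_eq_mul_inv, div_eq_mul_inv]
  ring

theorem mulReal_normalizedOperator (hα : 0 < α) (hfg : ∀ x, f x * g x = 1)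
    (ψ : HolderSpace α (Shift M A) ℝ) :
    mulReal hα f (normalizedOperator hα f g lam L ψ) = lam⁻¹ • L (mulReal hα f ψ) :=
  ext fun x => by
    rw [mulReal_apply, normalizedOperator_apply, HolderSpace.smul_apply]
    simp only [RCLike.ofReal_real_eq_id, id]
    rw [mul_left_comm, ← mul_assoc (f x), hfg, one_mul]

theorem mulReal_normalizedOperator_pow (hα : 0 < α) (hfg : ∀ x, f x * g x = 1) (n : ℕ)
    (ψ : HolderSpace α (Shift M A) ℝ) :
    mulReal hα f ((normalizedOperator hα f g lam L ^ n) ψ) =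
      (lam ^ n)⁻¹ • (L ^ n) (mulReal hα f ψ) := by
  induction n with
  | zero => simp
  | succ n ih =>
    rw [pow_succ', mul_apply_eq_comp, mulReal_normalizedOperator hα hfg, ih, map_smul, smul_smul,
      pow_succ' L, mul_apply_eq_comp, pow_succ', mul_inv]

theorem normalizedOperator_one (hα : 0 < α) (hlam : 0 < lam) (hfg : ∀ x, f x * g x = 1)
    (hLf : L f = lam • f) : normalizedOperator hα f g lam L 1 = 1 :=
  ext fun x => by
    have h1 : mulReal hα f 1 = f := ext fun x => mul_one (f x)
    rw [normalizedOperator_apply, h1, hLf, HolderSpace.smul_apply, mul_left_comm (g x),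
      mul_comm (g x), hfg, mul_one, inv_mul_cancel₀ hlam.ne', one_apply]

theorem integral_withDensity_holder (hα : 0 < α) (hf : ∀ x, 0 < f x)
    (ψ : HolderSpace α (Shift M A) ℝ) :
    ∫ x, ψ x ∂ρ.withDensity (fun x => ENNReal.ofReal (f x)) = ∫ x, mulReal hα f ψ x ∂ρ := by
  rw [integral_withDensity_eq_integral_toReal_smul
    f.toBCF.continuous.measurable.ennreal_ofReal (by simp)]
  refine integral_congr_ae (Eventually.of_forall fun x => ?_)
  simp only [ENNReal.toReal_ofReal (hf x).le]
  rfl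

theorem isProbabilityMeasure_withDensity [IsFiniteMeasure ρ] (hf : ∀ x, 0 < f x)
    (hfρ : ∫ x, f x ∂ρ = 1) :
    IsProbabilityMeasure (ρ.withDensity fun x => ENNReal.ofReal (f x)) := by
  refine ⟨?_⟩
  rw [withDensity_apply _ MeasurableSet.univ, Measure.restrict_univ,
    ← ofReal_integral_eq_lintegral_ofReal (f.integrable ρ)
      (Eventually.of_forall fun x => (hf x).le), hfρ, ENNReal.ofReal_one]

theorem isDualImage_normalizedOperator (hα : 0 < α) (hlam : 0 < lam) (hf : ∀ x, 0 < f x)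
    (hfg : ∀ x, f x * g x = 1) (hρ : ∀ ψ, ∫ x, L ψ x ∂ρ = lam * ∫ x, ψ x ∂ρ) :
    IsDualImage (normalizedOperator hα f g lam L)
      (ρ.withDensity fun x => ENNReal.ofReal (f x))
      (ρ.withDensity fun x => ENNReal.ofReal (f x)) := by
  intro ψ
  rw [integral_withDensity_holder hα hf, integral_withDensity_holder hα hf,
    mulReal_normalizedOperator hα hfg]
  simp only [HolderSpace.smul_apply]
  rw [integral_const_mul, hρ, inv_mul_cancel_left₀ hlam.ne']

/-- If `ν` is fixed by the dual of the normalized operator, then `ψ ↦ ∫ f⁻¹ ψ dν` is an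
eigenfunctional of `L`, hence determined by its value at `f`. -/
theorem eq_withDensity_of_isDualImage (hα : 0 < α) (hlam : 0 < lam) (hf : ∀ x, 0 < f x)
    (hfg : ∀ x, f x * g x = 1) [IsFiniteMeasure (ρ.withDensity fun x => ENNReal.ofReal (f x))]
    (huniq : ∀ Λ' : HolderSpace α (Shift M A) ℝ →L[ℝ] ℝ, (∀ ψ, Λ' (L ψ) = lam * Λ' ψ) →
      ∀ ψ, Λ' ψ = Λ' f * ∫ x, ψ x ∂ρ)
    {ν : Measure (Shift M A)} [IsProbabilityMeasure ν]
    (hν : IsDualImage (normalizedOperator hα f g lam L) ν ν) :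
    ν = ρ.withDensity fun x => ENNReal.ofReal (f x) := by
  have hgf : ∀ ψ : HolderSpace α (Shift M A) ℝ, mulReal hα g (mulReal hα f ψ) = ψ :=
    fun ψ => ext fun x => by
    rw [mulReal_apply, mulReal_apply]
    simp only [RCLike.ofReal_real_eq_id, id]
    rw [← mul_assoc, mul_comm (g x), hfg, one_mul]
  have hfg' : ∀ ψ : HolderSpace α (Shift M A) ℝ, mulReal hα f (mulReal hα g ψ) = ψ :=
    fun ψ => ext fun x => by
    rw [mulReal_apply, mulReal_apply]
    simp only [RCLike.ofReal_real_eq_id, id]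
    rw [← mul_assoc, hfg, one_mul]
  set Λ' : HolderSpace α (Shift M A) ℝ →L[ℝ] ℝ := integralFunctional ℝ ν ∘L mulReal hα g
  have hΛ' : ∀ ψ, Λ' ψ = ∫ x, mulReal hα g ψ x ∂ν := fun ψ => rfl
  have heig : ∀ ψ, Λ' (L ψ) = lam * Λ' ψ := fun ψ => by
    have h1 : ∀ x, normalizedOperator hα f g lam L (mulReal hα g ψ) x =
        lam⁻¹ * mulReal hα g (L ψ) x := fun x => by
      rw [normalizedOperator_apply, hfg']
      rfl
    rw [hΛ', hΛ', hν (mulReal hα g ψ)]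
    simp only [h1]
    rw [integral_const_mul, mul_inv_cancel_left₀ hlam.ne']
  have hΛ'f : Λ' f = 1 := by
    rw [hΛ']
    have h1 : ∀ x, mulReal hα g f x = 1 := fun x => (mul_comm _ _).trans (hfg x)
    simp only [h1, integral_const, probReal_univ, smul_eq_mul, mul_one]
  refine measure_ext_of_integral hα fun ψ => ?_
  have h := huniq Λ' heig (mulReal hα f ψ)
  rw [hΛ'f, one_mul, hΛ', hgf] at h
  rw [h, integral_withDensity_holder hα hf]

/-- A measure fixed by the dual of a normalized Ruelle operator is shift invariant, because
`N (ψ ∘ σ) = ψ`. -/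
theorem measurePreserving_of_isDualImage (hα : 0 < α)
    {N : HolderSpace α (Shift M A) ℝ →L[ℝ] HolderSpace α (Shift M A) ℝ}
    (hN : IsRuelleOperator φ N) (hN1 : N 1 = 1) {μ : Measure (Shift M A)} [IsFiniteMeasure μ]
    (hμ : IsDualImage N μ μ) : MeasurePreserving Shift.shift μ μ := by
  refine ⟨Shift.continuous_shift.measurable, Shift.measure_ext fun s hs => ?_⟩
  have hs' := Shift.preimage_shift_mem_cylinders hs
  rw [Measure.map_apply Shift.continuous_shift.measurable
    (Shift.isOpen_of_mem_cylinders hs).measurableSet]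
  have h1 : ∀ x, N (holderIndicator α (Shift.shift ⁻¹' s)) x = holderIndicator α s x := fun x => by
    rw [hN.apply_mul_shift (f := 1) (ψ := fun x => holderIndicator α s x) (fun x => ?_), hN1,
      one_apply, mul_one]
    rw [holderIndicator_apply hα hs', holderIndicator_apply hα hs, one_apply, one_mul]
    rfl
  have h2 := hμ (holderIndicator α (Shift.shift ⁻¹' s))
  simp only [h1] at h2
  rw [integral_holderIndicator hα μ hs, integral_holderIndicator hα μ hs'] at h2
  rwa [measureReal_def, measureReal_def, ENNReal.toReal_eq_toReal_iff' (measure_ne_top _ _)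
    (measure_ne_top _ _)] at h2

theorem tendstoUniformly_normalizedOperator_pow (hα : 0 < α) (hlam : 0 < lam)
    (hf : ∀ x, 0 < f x) (hfg : ∀ x, f x * g x = 1) {θ C : ℝ} (hθ0 : 0 < θ) (hθ1 : θ < 1)
    (hconv : ∀ (n : ℕ) (ψ : HolderSpace α (Shift M A) ℝ),
      ‖(L ^ n) ψ - (lam ^ n * ∫ x, ψ x ∂ρ) • f‖ ≤ C * (θ * lam) ^ n * ‖ψ‖)
    (ψ : HolderSpace α (Shift M A) ℝ) :
    TendstoUniformly (fun (n : ℕ) (x : Shift M A) => (normalizedOperator hα f g lam L ^ n) ψ x)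
      (fun _ => ∫ y, ψ y ∂ρ.withDensity (fun x => ENNReal.ofReal (f x))) atTop := by
  set χ := mulReal hα f ψ
  rw [integral_withDensity_holder hα hf]
  set I := ∫ x, χ x ∂ρ
  have hbound : ∀ (n : ℕ) (x : Shift M A),
      dist I ((normalizedOperator hα f g lam L ^ n) ψ x) ≤ ‖g‖ * C * ‖χ‖ * θ ^ n := by
    intro n x
    have hf0 : f x ≠ 0 := (hf x).ne'
    have h1 : f x * (normalizedOperator hα f g lam L ^ n) ψ x = (lam ^ n)⁻¹ * (L ^ n) χ x :=
      congrArg (fun u : HolderSpace α (Shift M A) ℝ => u x)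
        (mulReal_normalizedOperator_pow hα hfg n ψ)
    have h2 : (normalizedOperator hα f g lam L ^ n) ψ x - I =
        g x * ((lam ^ n)⁻¹ * ((L ^ n) χ - (lam ^ n * I) • f) x) := by
      refine mul_left_cancel₀ hf0 ?_
      rw [mul_sub, h1, ← mul_assoc (f x), hfg, one_mul, HolderSpace.sub_apply,
        HolderSpace.smul_apply, mul_sub, mul_assoc (lam ^ n), inv_mul_cancel_left₀ (by positivity),
        mul_comm I]
    rw [dist_comm, Real.dist_eq, h2, abs_mul, abs_mul, abs_of_pos (by positivity : 0 < (lam ^ n)⁻¹)]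
    calc |g x| * ((lam ^ n)⁻¹ * |((L ^ n) χ - (lam ^ n * I) • f) x|)
        ≤ ‖g‖ * ((lam ^ n)⁻¹ * (C * (θ * lam) ^ n * ‖χ‖)) := by
          gcongr
          · exact norm_apply_le g x
          · exact (norm_apply_le _ x).trans (hconv n χ)
      _ = _ := by rw [mul_pow]; field_simp
  have hlim : Tendsto (fun n : ℕ => ‖g‖ * C * ‖χ‖ * θ ^ n) atTop (nhds 0) := by
    simpa using (tendsto_pow_atTop_nhds_zero_of_lt_one hθ0.le hθ1).const_mul (‖g‖ * C * ‖χ‖)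
  rw [Metric.tendstoUniformly_iff]
  intro ε hε
  filter_upwards [hlim.eventually_lt_const hε] with n hn x
  exact (hbound n x).trans_lt hn

end Normalized

theorem Shift.nonempty_of_next {M : Alphabet} {A : Matrix ℕ ℕ ℕ} {next : ℕ → ℕ}
    (hnext : ∀ i, A i (next i) = 1) : Nonempty (Shift M A) :=
  ⟨⟨fun n => next^[n] 0, fun n => by
    change A (next^[n] 0) (next^[n + 1] 0) = 1
    rw [Function.iterate_succ_apply']
    exact hnext _⟩⟩

end RPF

end

theorem proposition2
    (M : RPF.Alphabet) (A : Matrix ℕ ℕ ℕ)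
    (hA01 : ∀ i j, A i j = 0 ∨ A i j = 1)
    (hirr : RPF.IsIrreducible A)
    (hcol : ∃ j₀, ∀ j, j₀ ≤ j → ∀ i, A i j = A i j₀)
    (α : ℝ≥0) (hα : 0 < α)
    (ϕ : RPF.HolderSpace α (RPF.Shift M A) ℝ)
    (p : ℕ → ℝ) (hp : ∀ k, 0 < p k) (hp1 : HasSum p 1)
    (φ : RPF.Shift M A → ℝ) (hφ : ∀ x, φ x = ϕ x + Real.log (p (x.1 0))) :
    -- the Ruelle operator is well defined, on real and on complex Hölder functions
    ∃ (L : RPF.HolderSpace α (RPF.Shift M A) ℝ →L[ℝ] RPF.HolderSpace α (RPF.Shift M A) ℝ)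
      (Lc : RPF.HolderSpace α (RPF.Shift M A) ℂ →L[ℂ] RPF.HolderSpace α (RPF.Shift M A) ℂ),
      RPF.IsRuelleOperator φ L ∧ RPF.IsRuelleOperator φ Lc ∧
    ∃ (lam : ℝ) (f : RPF.HolderSpace α (RPF.Shift M A) ℝ)
      (ρ : MeasureTheory.Measure (RPF.Shift M A)),
      -- (1) eigenvalue and eigenfunction; simplicity and maximality
      0 < lam ∧ (∃ c, 0 < c ∧ ∀ x, c ≤ f x) ∧ L f = lam • f ∧
      Module.End.maxGenEigenspace
        (L : Module.End ℝ (RPF.HolderSpace α (RPF.Shift M A) ℝ)) lam = Submodule.span ℝ {f} ∧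
      Module.finrank ℂ (Module.End.maxGenEigenspace
        (Lc : Module.End ℂ (RPF.HolderSpace α (RPF.Shift M A) ℂ)) (lam : ℂ)) = 1 ∧
      (∀ z ∈ spectrum ℂ Lc, ‖z‖ ≤ lam) ∧
      -- (2) eigenprobability of the dual operator
      MeasureTheory.IsProbabilityMeasure ρ ∧
      RPF.IsDualImage L ρ (ENNReal.ofReal lam • ρ) ∧
      -- (3) the normalized potential, its operator and the invariant Gibbs state
      ∃ Lbar : RPF.HolderSpace α (RPF.Shift M A) ℝ →L[ℝ] RPF.HolderSpace α (RPF.Shift M A) ℝ,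
        RPF.IsRuelleOperator
          (fun x => φ x + Real.log (f x) - Real.log (f x.shift) - Real.log lam) Lbar ∧
      ∃ μ : MeasureTheory.Measure (RPF.Shift M A),
        MeasureTheory.IsProbabilityMeasure μ ∧
        RPF.IsDualImage Lbar μ μ ∧
        (∀ ν : MeasureTheory.Measure (RPF.Shift M A), MeasureTheory.IsProbabilityMeasure ν →
          RPF.IsDualImage Lbar ν ν → ν = μ) ∧
        MeasureTheory.MeasurePreserving RPF.Shift.shift μ μ ∧
        μ = ρ.withDensity (fun x => ENNReal.ofReal (f x)) ∧
        -- (4) the aperiodic case: uniform convergence and spectral gap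
        (RPF.IsAperiodic A →
          (∀ ψ : RPF.HolderSpace α (RPF.Shift M A) ℝ,
            TendstoUniformly (fun (n : ℕ) (x : RPF.Shift M A) => (Lbar ^ n) ψ x)
              (fun _ => ∫ y, ψ y ∂μ) Filter.atTop) ∧
          ∃ r : ℝ, 0 ≤ r ∧ r < lam ∧ ∀ z ∈ spectrum ℂ Lc, z ≠ (lam : ℂ) → ‖z‖ ≤ r) := by
  obtain ⟨j₀, hj₀⟩ := hcol
  have hcol : ∀ a i j, min i j₀ = min j j₀ → A a i = A a j := fun a i j hij => by
    have h : ∀ k, A a k = A a (min k j₀) := fun k => by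
      rcases le_total k j₀ with hk | hk
      · rw [min_eq_left hk]
      · rw [min_eq_right hk, hj₀ k hk]
    rw [h i, h j, hij]
  obtain ⟨next, hnext, -⟩ := RPF.exists_next hA01 hirr hcol
  obtain ⟨x₀⟩ := RPF.Shift.nonempty_of_next (M := M) hnext
  obtain ⟨L, hL⟩ := RPF.exists_isRuelleOperator ℝ hα hcol hp hp1 hφ
  obtain ⟨Lc, hLc⟩ := RPF.exists_isRuelleOperator ℂ hα hcol hp hp1 hφ
  obtain ⟨a, ha, hmaps⟩ := RPF.exists_mapsTo_holderCone hα hcol hp hφ hL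
  obtain ⟨lam, c, f, ρ, hlam, hc, hfc, hLf, hρ, hLρ, hfρ, hsimple, huniq⟩ :=
    RPF.exists_eigenmeasure hα hA01 hirr hcol hp hp1 hφ hL x₀ ha hmaps
  obtain ⟨κ, hK⟩ := RPF.exists_isSolidNormal_holderCone (α := α) (j₀ := j₀) ha x₀
  obtain ⟨C₀, hC₀, hbound⟩ := hK.norm_pow_le
    (fun h hh => RPF.holderCone_mono (by linarith) (hmaps h hh)) hlam hc hLf hfc
  have hfle := RPF.le_of_sub_mem_holderCone hfc
  have hf : ∀ x, 0 < f x := fun x => hc.trans_le (hfle x)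
  obtain ⟨g, hg⟩ := RPF.HolderSpace.exists_inv hα hc hfle
  have hfg : ∀ x, f x * g x = 1 := fun x => by rw [hg, mul_inv_cancel₀ (hf x).ne']
  have hcompl : RPF.HolderSpace.IsComplexification hα L Lc := hL.toComplex hα hLc
  have hN := RPF.isRuelleOperator_normalizedOperator hα hL hlam hf hg
  have hμ := RPF.isProbabilityMeasure_withDensity hf hfρ
  have hdual := RPF.isDualImage_normalizedOperator hα hlam hf hfg hLρ
  refine ⟨L, Lc, hL, hLc, lam, f, ρ, hlam, ⟨c, hc, hfle⟩, hLf,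
    RPF.maxGenEigenspace_eq_span _ (RPF.integralFunctional ℝ ρ).toLinearMap hLf hLρ
      (fun h0 => one_ne_zero (hfρ.symm.trans h0)) hsimple,
    RPF.finrank_maxGenEigenspace_complexification hcompl hLf hLρ hfρ hsimple,
    fun z hz => RPF.norm_le_of_mem_spectrum_complexification hcompl hC₀ hlam.le hbound hz,
    hρ, fun ψ => ?_, RPF.normalizedOperator hα f g lam L, hN,
    ρ.withDensity (fun x => ENNReal.ofReal (f x)), hμ, hdual,
    fun ν _ hν => RPF.eq_withDensity_of_isDualImage hα hlam hf hfg huniq hν,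
    RPF.measurePreserving_of_isDualImage hα hN
      (RPF.normalizedOperator_one hα hlam hfg hLf) hdual, rfl, fun haper => ?_⟩
  · rw [MeasureTheory.integral_smul_measure, ENNReal.toReal_ofReal hlam.le, hLρ, smul_eq_mul]
  · obtain ⟨θ, C, hθ0, hθ1, hC, hconv⟩ := RPF.exists_exponential_convergence hA01 haper hcol hp hφ
      hL x₀ ha hmaps hlam hc hfc hLf hLρ hfρ hC₀ hbound
    refine ⟨RPF.tendstoUniformly_normalizedOperator_pow hα hlam hf hfg hθ0 hθ1 hconv,
      θ * lam, by positivity, mul_lt_of_lt_one_left hlam hθ1, fun z hz hne => ?_⟩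
    exact RPF.norm_le_of_mem_spectrum_complexification_of_ne hcompl hLf hLρ hfρ hC (by positivity)
      hconv hz hne
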